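/- Let $k$ be a field, $a\ge 3$ an integer, $q\in k$ a primitive $a$-th root of unity, and $A=k\langle X,Y\rangle/(X^a,\,XY-qYX,\,Y^a)$, with $x,y$ the residue classes of $X,Y$. Let $A^e=A\otimes_k A^{\mathrm{op}}$, acting on $A$ by $(b\otimes c)\cdot m=bmc$, and let $HH^n(A)=\operatorname{Ext}^n_{A^e}(A,A)$, with the Yoneda product on $HH^*(A)$. For $s\ge 0$ put $$\tau_1(s)=q^s(1\otimes x)-x\otimes 1,\qquad \tau_2(s)=1\otimes y-q^s(y\otimes 1),$$ $$\gamma_1(s)=\sum_{j=0}^{a-1}q^{js}(x^{a-1-j}\otimes x^j),\qquad \gamma_2(s)=\sum_{j=0}^{a-1}q^{js}(y^j\otimes y^{a-1-j}).$$ Let $P_n$ be the free left $A^e$-module with basis $f^n_0,\dots,f^n_n$, put $f^n_{-1}=f^n_{n+1}=0$, let $\mu:P_0\to A$ be the $A^e$-linear map with $f^0_0\mapsto 1$, and let $d_n:P_n\to P_{n-1}$ $(n\ge 1)$ be the $A^e$-linear maps with $$d_{2t}(f^{2t}_i)=\begin{cases}\gamma_2\left(\tfrac{ai}{2}\right)f^{2t-1}_i+\gamma_1\left(\tfrac{2at-ai}{2}\right)f^{2t-1}_{i-1}&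 i \text{ even}\\ -\tau_2\left(\tfrac{ai-a+2}{2}\right)f^{2t-1}_i+\tau_1\left(\tfrac{2at-ai-a+2}{2}\right)f^{2t-1}_{i-1}& i\text{ odd,}\end{cases}$$ $$d_{2t+1}(f^{2t+1}_i)=\begin{cases}\tau_2\left(\tfrac{ai}{2}\right)f^{2t}_i+\gamma_1\left(\tfrac{2at-ai+2}{2}\right)f^{2t}_{i-1}& i \text{ even}\\ -\gamma_2\left(\tfrac{ai-a+2}{2}\right)f^{2t}_i+\tau_1\left(\tfrac{2at-ai+a}{2}\right)f^{2t}_{i-1}& i\text{ odd.}\end{cases}$$ Then $\cdots\to P_2\to P_1\to P_0\xrightarrow{\mu} A\to 0$ is a projective resolution of $A$ over $A^e$, so that every $A^e$-linear map $p:P_n\to A$ with $p\circ d_{n+1}=0$ has a class in $HH^n(A)$. Fix $t\ge 0$. For $0\le j\le 2t$ let $\zeta_j:P_{2t}\to A$ be the $A^e$-linear map with $f^{2t}_j\mapsto 1$ and $f^{2t}_i\mapsto 0$ for $i\ne j$; for even $j$ let $\eta_j^+:P_{2t}\to A$ be the one with $f^{2t}_j\mapsto x^{a-1}y^{a-1}$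 and $f^{2t}_i\mapsto 0$ for $i\neq j$; for odd $j$ let $\eta_j^-:P_{2t}\to A$ be the one with $f^{2t}_j\mapsto xy$ and $f^{2t}_i\mapsto 0$ for $i\ne j$. These $4t+2$ maps vanish on the image of $d_{2t+1}$, and: (a) the classes of the $\zeta_j$ $(0\le j\le 2t)$, the $\eta_j^+$ ($j$ even) and the $\eta_j^-$ ($j$ odd) form a $k$-basis of $HH^{2t}(A)$; (b) the classes of the $\eta_j^+$ and $\eta_j^-$ are nilpotent in $HH^*(A)$. -/

import Mathlib

open CategoryTheory Abelian
open scoped TensorProduct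

universe u

noncomputable section

namespace QCI

section
variable {k E : Type u} [Field k] [Ring E] [Algebra k E]

theorem qpow {q : k} {U V : E} (h : U * V = q • (V * U)) (n m : ℕ) :
    U ^ n * V ^ m = q ^ (n * m) • (V ^ m * U ^ n) := by
  have h1 : ∀ n : ℕ, U ^ n * V = q ^ n • (V * U ^ n) := by
    intro n
    induction n with
    | zero => simp
    | succ n ih =>
      rw [pow_succ, mul_assoc, h, mul_smul_comm, ← mul_assoc, ih, smul_mul_assoc, smul_smul,
        mul_assoc, pow_succ' q]
  induction m with
  | zero => simp
  | succ m ih =>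
    rw [pow_succ, ← mul_assoc, ih, smul_mul_assoc, mul_assoc, h1, mul_smul_comm, smul_smul,
      ← mul_assoc, ← pow_add, Nat.mul_succ]

variable (q : k) (a : ℕ)

theorem geom_left {U V : E} (h : Commute U V) (hU : U ^ a = 0) (hV : V ^ a = 0) (s : ℕ) :
    (∑ j ∈ Finset.range a, q ^ (j * s) • (U ^ j * V ^ (a - 1 - j))) * (V - q ^ s • U) = 0 := by
  have hc : Commute (q ^ s • U) V := h.smul_left _
  have := hc.geom_sum₂_mul a
  rw [smul_pow, hU, hV] at this
  rw [← neg_sub, mul_neg, neg_eq_zero]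
  simpa [smul_pow, smul_mul_assoc, ← pow_mul, mul_comm] using this

theorem geom_right {U V : E} (h : Commute U V) (hU : U ^ a = 0) (hV : V ^ a = 0) (s : ℕ) :
    (V - q ^ s • U) * (∑ j ∈ Finset.range a, q ^ (j * s) • (U ^ j * V ^ (a - 1 - j))) = 0 := by
  have hc : Commute (q ^ s • U) V := h.smul_left _
  have := hc.mul_geom_sum₂ a
  rw [smul_pow, hU, hV] at this
  rw [← neg_sub, neg_mul, neg_eq_zero]
  simpa [smul_pow, smul_mul_assoc, ← pow_mul, mul_comm] using this

theorem geom_left' {U V : E} (h : Commute U V) (hU : U ^ a = 0) (hV : V ^ a = 0) (s : ℕ) :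
    (∑ j ∈ Finset.range a, q ^ (j * s) • (U ^ j * V ^ (a - 1 - j))) * (q ^ s • U - V) = 0 := by
  rw [← neg_sub, mul_neg, geom_left q a h hU hV, neg_zero]

theorem geom_right' {U V : E} (h : Commute U V) (hU : U ^ a = 0) (hV : V ^ a = 0) (s : ℕ) :
    (q ^ s • U - V) * (∑ j ∈ Finset.range a, q ^ (j * s) • (U ^ j * V ^ (a - 1 - j))) = 0 := by
  rw [← neg_sub, neg_mul, geom_right q a h hU hV, neg_zero]

variable {X X' Y Y' : E}

theorem mono_comm
    (hXY' : Commute X Y') (hYX' : Commute Y X')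
    (hXY : X * Y = q • (Y * X)) (hYX : Y' * X' = q • (X' * Y'))
    (b b' c c' : ℕ) :
    q ^ (b * c) • ((Y ^ c * Y' ^ c') * (X ^ b * X' ^ b'))
      = q ^ (c' * b') • ((X ^ b * X' ^ b') * (Y ^ c * Y' ^ c')) := by
  have h1 := qpow hXY b c
  have h2 := qpow hYX c' b'
  have h3 : Commute (X ^ b) (Y' ^ c') := hXY'.pow_pow _ _
  have h4 : Commute (Y ^ c) (X' ^ b') := hYX'.pow_pow _ _
  calc _ = (q ^ (b * c) • (Y ^ c * X ^ b)) * (Y' ^ c' * X' ^ b') := by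
        rw [smul_mul_assoc]
        congr 1
        simp only [mul_assoc]
        rw [← mul_assoc (Y' ^ c'), ← h3.eq, mul_assoc]
    _ = X ^ b * (Y ^ c * X' ^ b') * Y' ^ c' * q ^ (c' * b') • 1 := by
        rw [← h1, h2]
        simp [mul_assoc]
    _ = _ := by
        rw [h4.eq]
        simp [mul_assoc]

theorem mono_comm'
    (hXY' : Commute X Y') (hYX' : Commute Y X')
    (hXY : X * Y = q • (Y * X)) (hYX : Y' * X' = q • (X' * Y'))
    {b b' c c' n e f : ℕ} (hn : e = n + b * c) (hf : f = n + c' * b') :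
    q ^ e • ((Y ^ c * Y' ^ c') * (X ^ b * X' ^ b'))
      = q ^ f • ((X ^ b * X' ^ b') * (Y ^ c * Y' ^ c')) := by
  rw [hn, hf, pow_add, pow_add, mul_smul, mul_smul, mono_comm q hXY' hYX' hXY hYX]

theorem cross_gg
    (hXY' : Commute X Y') (hYX' : Commute Y X')
    (hXY : X * Y = q • (Y * X)) (hYX : Y' * X' = q • (X' * Y'))
    (s u : ℕ) :
    (∑ j ∈ Finset.range a, q ^ (j * (s + (a - 1))) • (Y ^ j * Y' ^ (a - 1 - j)))
        * (∑ j ∈ Finset.range a, q ^ (j * u) • (X ^ (a - 1 - j) * X' ^ j))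
      = (∑ j ∈ Finset.range a, q ^ (j * (u + (a - 1))) • (X ^ (a - 1 - j) * X' ^ j))
        * (∑ j ∈ Finset.range a, q ^ (j * s) • (Y ^ j * Y' ^ (a - 1 - j))) := by
  rw [Finset.sum_mul_sum, Finset.sum_mul_sum, Finset.sum_comm]
  refine Finset.sum_congr rfl fun l hl => Finset.sum_congr rfl fun m hm => ?_
  rw [smul_mul_smul_comm, smul_mul_smul_comm, ← pow_add, ← pow_add]
  obtain ⟨l', hl'⟩ : ∃ l', a - 1 = l + l' := ⟨a - 1 - l, by simp at hl; omega⟩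
  obtain ⟨m', hm'⟩ : ∃ m', a - 1 = m + m' := ⟨a - 1 - m, by simp at hm; omega⟩
  have e1 : a - 1 - l = l' := by omega
  have e2 : a - 1 - m = m' := by omega
  refine mono_comm' q hXY' hYX' hXY hYX (n := m * s + l * u + m * l) ?_ ?_
  · rw [e1, hl']; ring
  · rw [e2, hm']; ring

theorem cross_tt
    (hXY' : Commute X Y') (hYX' : Commute Y X')
    (hXY : X * Y = q • (Y * X)) (hYX : Y' * X' = q • (X' * Y'))
    (s u : ℕ) :
    (Y' - q ^ (s + 1) • Y) * (q ^ u • X' - X)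
      = (q ^ (u + 1) • X' - X) * (Y' - q ^ s • Y) := by
  have h3 : Y' * X = X * Y' := hXY'.eq.symm
  have h4 : Y * X' = X' * Y := hYX'.eq
  simp only [sub_mul, mul_sub, smul_mul_assoc, mul_smul_comm, h3, h4, hXY, hYX, smul_smul,
    smul_sub, pow_succ]
  module

theorem cross_tg
    (hXY' : Commute X Y') (hYX' : Commute Y X')
    (hXY : X * Y = q • (Y * X)) (hYX : Y' * X' = q • (X' * Y'))
    (s u : ℕ) :
    (Y' - q ^ (s + (a - 1)) • Y) * (∑ j ∈ Finset.range a, q ^ (j * u) • (X ^ (a - 1 - j) * X' ^ j))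
      = (∑ j ∈ Finset.range a, q ^ (j * (u + 1)) • (X ^ (a - 1 - j) * X' ^ j))
        * (Y' - q ^ s • Y) := by
  rw [Finset.mul_sum, Finset.sum_mul]
  refine Finset.sum_congr rfl fun l hl => ?_
  obtain ⟨l', hl'⟩ : ∃ l', a - 1 = l + l' := ⟨a - 1 - l, by simp at hl; omega⟩
  have e1 : a - 1 - l = l' := by omega
  have A := mono_comm' q hXY' hYX' hXY hYX (b := l') (b' := l) (c := 0) (c' := 1)
    (n := l * u) (e := l * u) (f := l * (u + 1)) (by ring) (by ring)
  have B := mono_comm' q hXY' hYX' hXY hYX (b := l') (b' := l) (c := 1) (c' := 0)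
    (n := s + l + l * u) (e := s + (l + l') + l * u) (f := s + l * (u + 1)) (by ring) (by ring)
  simp only [pow_zero, pow_one, one_mul, mul_one] at A B
  simp only [hl', Nat.add_sub_cancel_left, sub_mul, mul_sub, smul_mul_assoc, mul_smul_comm, smul_smul]
  linear_combination (norm := module) A - B

theorem cross_gt
    (hXY' : Commute X Y') (hYX' : Commute Y X')
    (hXY : X * Y = q • (Y * X)) (hYX : Y' * X' = q • (X' * Y'))
    (s u : ℕ) :
    (∑ j ∈ Finset.range a, q ^ (j * (s + 1)) • (Y ^ j * Y' ^ (a - 1 - j))) * (q ^ u • X' - X)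
      = (q ^ (u + (a - 1)) • X' - X)
        * (∑ j ∈ Finset.range a, q ^ (j * s) • (Y ^ j * Y' ^ (a - 1 - j))) := by
  rw [Finset.mul_sum, Finset.sum_mul]
  refine Finset.sum_congr rfl fun m hm => ?_
  obtain ⟨m', hm'⟩ : ∃ m', a - 1 = m + m' := ⟨a - 1 - m, by simp at hm; omega⟩
  have e1 : a - 1 - m = m' := by omega
  have A := mono_comm' q hXY' hYX' hXY hYX (b := 0) (b' := 1) (c := m) (c' := m')
    (n := m * (s + 1) + u) (e := m * (s + 1) + u) (f := u + (m + m') + m * s) (by ring) (by ring)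
  have B := mono_comm' q hXY' hYX' hXY hYX (b := 1) (b' := 0) (c := m) (c' := m')
    (n := m * s) (e := m * (s + 1)) (f := m * s) (by ring) (by ring)
  simp only [pow_zero, pow_one, one_mul, mul_one] at A B
  simp only [hm', Nat.add_sub_cancel_left, sub_mul, mul_sub, smul_mul_assoc, mul_smul_comm, smul_smul]
  linear_combination (norm := module) A - B

end

/-- The relations `X ^ a = 0`, `X Y = q Y X`, `Y ^ a = 0` in the free algebra `k⟨X, Y⟩`, where
`X`, `Y` are the generators with index `0`, `1`. -/
inductive Rel (k : Type u) [Field k] (a : ℕ) (q : k) :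
    FreeAlgebra k (Fin 2) → FreeAlgebra k (Fin 2) → Prop
  | x_pow : Rel k a q (FreeAlgebra.ι k 0 ^ a) 0
  | x_mul_y : Rel k a q (FreeAlgebra.ι k 0 * FreeAlgebra.ι k 1)
      (q • (FreeAlgebra.ι k 1 * FreeAlgebra.ι k 0))
  | y_pow : Rel k a q (FreeAlgebra.ι k 1 ^ a) 0

/-- The quantum complete intersection `A = k⟨X, Y⟩ / (X ^ a, X Y - q Y X, Y ^ a)`. -/
def Alg (k : Type u) [Field k] (a : ℕ) (q : k) : Type u := RingQuot (Rel k a q)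

instance instRingAlg (k : Type u) [Field k] (a : ℕ) (q : k) : Ring (Alg k a q) :=
  inferInstanceAs (Ring (RingQuot (Rel k a q)))

instance instAlgebraAlg (k : Type u) [Field k] (a : ℕ) (q : k) : Algebra k (Alg k a q) :=
  inferInstanceAs (Algebra k (RingQuot (Rel k a q)))

/-- The quotient map `k⟨X, Y⟩ → A`. -/
def mk (k : Type u) [Field k] (a : ℕ) (q : k) : FreeAlgebra k (Fin 2) →ₐ[k] Alg k a q :=
  RingQuot.mkAlgHom k (Rel k a q)

theorem mk_rel {k : Type u} [Field k] {a : ℕ} {q : k} {v w : FreeAlgebra k (Fin 2)}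
    (h : Rel k a q v w) : mk k a q v = mk k a q w :=
  RingQuot.mkAlgHom_rel k h

/-- The enveloping algebra `A ⊗ Aᵒᵖ`. -/
def Env (k : Type u) [Field k] (a : ℕ) (q : k) : Type u := Alg k a q ⊗[k] (Alg k a q)ᵐᵒᵖ

instance instRingEnv (k : Type u) [Field k] (a : ℕ) (q : k) : Ring (Env k a q) :=
  inferInstanceAs (Ring (Alg k a q ⊗[k] (Alg k a q)ᵐᵒᵖ))

instance instAlgebraEnv (k : Type u) [Field k] (a : ℕ) (q : k) : Algebra k (Env k a q) :=
  inferInstanceAs (Algebra k (Alg k a q ⊗[k] (Alg k a q)ᵐᵒᵖ))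

/-- `A` as a left module over its enveloping algebra: `(b ⊗ c) • m = b * m * c`. -/
instance instModuleEnvAlg (k : Type u) [Field k] (a : ℕ) (q : k) :
    Module (Env k a q) (Alg k a q) :=
  (TensorProduct.Algebra.module : Module (Alg k a q ⊗[k] (Alg k a q)ᵐᵒᵖ) (Alg k a q))

variable {k : Type u} [Field k] (a : ℕ) (q : k)

/-- The residue class of `X`. -/
def x : Alg k a q := mk k a q (FreeAlgebra.ι k 0)

/-- The residue class of `Y`. -/
def y : Alg k a q := mk k a q (FreeAlgebra.ι k 1)

/-- The element `b ⊗ c` of the enveloping algebra. -/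
def tmul {a : ℕ} {q : k} (b c : Alg k a q) : Env k a q := b ⊗ₜ[k] MulOpposite.op c

theorem tmul_smul (b c m : Alg k a q) : tmul b c • m = b * m * c := by
  change b * (m * c) = b * m * c
  rw [mul_assoc]

theorem tmul_mul_tmul (b c b' c' : Alg k a q) :
    tmul b c * tmul b' c' = tmul (b * b') (c' * c) :=
  Algebra.TensorProduct.tmul_mul_tmul b b' (MulOpposite.op c) (MulOpposite.op c')

theorem tmul_one_one : tmul (1 : Alg k a q) 1 = 1 := rfl

theorem smul_tmul_left (r : k) (b c : Alg k a q) : tmul (r • b) c = r • tmul b c :=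
  (TensorProduct.smul_tmul' r b (MulOpposite.op c)).symm

theorem smul_tmul_right (r : k) (b c : Alg k a q) : tmul b (r • c) = r • tmul b c :=
  TensorProduct.tmul_smul r b (MulOpposite.op c)

theorem tmul_zero_left (c : Alg k a q) : tmul 0 c = 0 := TensorProduct.zero_tmul _ _

theorem tmul_zero_right (b : Alg k a q) : tmul b 0 = 0 := TensorProduct.tmul_zero _ _

theorem tmul_pow (b c : Alg k a q) (n : ℕ) : tmul b c ^ n = tmul (b ^ n) (c ^ n) := by
  induction n with
  | zero => simp [tmul_one_one]
  | succ n ih => rw [pow_succ, ih, tmul_mul_tmul, pow_succ, pow_succ']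

theorem x_mul_y : x a q * y a q = q • (y a q * x a q) := by
  have h := mk_rel (Rel.x_mul_y (a := a) (q := q))
  simpa [x, y] using h

theorem x_pow : x a q ^ a = 0 := by
  have h := mk_rel (Rel.x_pow (a := a) (q := q))
  simpa [x] using h

theorem y_pow : y a q ^ a = 0 := by
  have h := mk_rel (Rel.y_pow (a := a) (q := q))
  simpa [y] using h

/-- `τ₁(s) = q ^ s (1 ⊗ x) - x ⊗ 1`. -/
def tau₁ (s : ℕ) : Env k a q := q ^ s • tmul 1 (x a q) - tmul (x a q) 1

/-- `τ₂(s) = 1 ⊗ y - q ^ s (y ⊗ 1)`. -/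
def tau₂ (s : ℕ) : Env k a q := tmul 1 (y a q) - q ^ s • tmul (y a q) 1

/-- `γ₁(s) = ∑ j, q ^ (j s) (x ^ (a - 1 - j) ⊗ x ^ j)`, the sum over `0 ≤ j ≤ a - 1`. -/
def gamma₁ (s : ℕ) : Env k a q :=
  ∑ j ∈ Finset.range a, q ^ (j * s) • tmul (x a q ^ (a - 1 - j)) (x a q ^ j)

/-- `γ₂(s) = ∑ j, q ^ (j s) (y ^ j ⊗ y ^ (a - 1 - j))`, the sum over `0 ≤ j ≤ a - 1`. -/
def gamma₂ (s : ℕ) : Env k a q :=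
  ∑ j ∈ Finset.range a, q ^ (j * s) • tmul (y a q ^ j) (y a q ^ (a - 1 - j))

/-- The free module of rank `n + 1` over the enveloping algebra. -/
abbrev P (n : ℕ) : Type u := Fin (n + 1) → Env k a q

/-- The generator `f_i^n` of `P n` for `0 ≤ i ≤ n`; it is `0` for all other `i`. -/
def gen (n : ℕ) (i : ℤ) : P a q n := fun j => if (j : ℤ) = i then 1 else 0

/-- The image of the generator `f_i^n` under `d_n : P n → P (n - 1)`, for `n = m + 1` and
`0 ≤ i ≤ n`; here `t = ⌊n / 2⌋`. All quotients by `2` are exact, and all differences are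
nonnegative wherever the generator next to them does not vanish. -/
def dGen (m : ℕ) (i : ℕ) : P a q m :=
  let t := (m + 1) / 2
  if Even (m + 1) then
    if Even i then
      gamma₂ a q (a * i / 2) • gen a q m i
        + gamma₁ a q ((2 * a * t - a * i) / 2) • gen a q m (i - 1)
    else
      -(tau₂ a q ((a * i + 2 - a) / 2) • gen a q m i)
        + tau₁ a q ((2 * a * t + 2 - a * i - a) / 2) • gen a q m (i - 1)
  else
    if Even i then
      tau₂ a q (a * i / 2) • gen a q m i
        + gamma₁ a q ((2 * a * t + 2 - a * i) / 2) • gen a q m (i - 1)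
    else
      -(gamma₂ a q ((a * i + 2 - a) / 2) • gen a q m i)
        + tau₁ a q ((2 * a * t + a - a * i) / 2) • gen a q m (i - 1)

/-- The differential `d_{m+1} : P (m + 1) → P m`. -/
def d (m : ℕ) : P a q (m + 1) →ₗ[Env k a q] P a q m :=
  Fintype.linearCombination (Env k a q) fun i : Fin (m + 1 + 1) => dGen a q m i

/-- The `A ⊗ Aᵒᵖ`-linear map `P n → A` sending each generator `f_i^n` to `p i`. -/
def cochain (n : ℕ) (p : Fin (n + 1) → Alg k a q) : P a q n →ₗ[Env k a q] Alg k a q :=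
  Fintype.linearCombination (Env k a q) p

/-- The augmentation `P 0 → A`, sending `f_0^0` to `1`, that is `b ⊗ c ↦ b c`. -/
def mu : P a q 0 →ₗ[Env k a q] Alg k a q := cochain a q 0 fun _ => 1

theorem d_gen (m : ℕ) {i : ℕ} (hi : i ≤ m + 1) : d a q m (gen a q (m + 1) i) = dGen a q m i := by
  have h : gen a q (m + 1) i = Pi.single (⟨i, by omega⟩ : Fin (m + 1 + 1)) 1 := by
    funext j
    simp [gen, Pi.single_apply, Fin.ext_iff]
  rw [h]
  simp [d]

theorem cochain_gen (n : ℕ) (p : Fin (n + 1) → Alg k a q) (i : Fin (n + 1)) :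
    cochain a q n p (gen a q n i) = p i := by
  have h : gen a q n i = Pi.single i 1 := by
    funext j
    simp [gen, Pi.single_apply, Fin.ext_iff]
  rw [h]
  simp [cochain]

theorem gen_eq_zero {n : ℕ} {i : ℤ} (h : i < 0 ∨ (n : ℤ) < i) : gen a q n i = 0 := by
  funext j
  have := j.2
  simp only [gen, Pi.zero_apply, ite_eq_right_iff]
  omega

theorem gamma₁_eq (s : ℕ) :
    gamma₁ a q s = ∑ j ∈ Finset.range a, q ^ (j * s) •
      (tmul (x a q) 1 ^ (a - 1 - j) * tmul 1 (x a q) ^ j) := by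
  simp [gamma₁, tmul_pow, tmul_mul_tmul]

theorem gamma₂_eq (s : ℕ) :
    gamma₂ a q s = ∑ j ∈ Finset.range a, q ^ (j * s) •
      (tmul (y a q) 1 ^ j * tmul 1 (y a q) ^ (a - 1 - j)) := by
  simp [gamma₂, tmul_pow, tmul_mul_tmul]

theorem commute_tmul (b c : Alg k a q) : Commute (tmul b 1) (tmul 1 c) := by
  simp [Commute, SemiconjBy, tmul_mul_tmul]

theorem tmul_xy :
    tmul (x a q) 1 * tmul (y a q) 1 = q • (tmul (y a q) 1 * tmul (x a q) 1) := by
  simp [x_mul_y, tmul_mul_tmul, smul_tmul_left]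

theorem tmul_op_yx :
    tmul 1 (y a q) * tmul 1 (x a q) = q • (tmul 1 (x a q) * tmul 1 (y a q)) := by
  simp [x_mul_y, tmul_mul_tmul, smul_tmul_right]

theorem gamma₂_mul_tau₂ (s : ℕ) : gamma₂ a q s * tau₂ a q s = 0 := by
  rw [gamma₂_eq, tau₂]
  refine geom_left q a (commute_tmul a q _ _) ?_ ?_ s <;>
    simp [tmul_pow, y_pow, tmul_zero_left, tmul_zero_right]

theorem tau₂_mul_gamma₂ (s : ℕ) : tau₂ a q s * gamma₂ a q s = 0 := by
  rw [gamma₂_eq, tau₂]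
  refine geom_right q a (commute_tmul a q _ _) ?_ ?_ s <;>
    simp [tmul_pow, y_pow, tmul_zero_left, tmul_zero_right]

theorem gamma₁_mul_tau₁ (s : ℕ) : gamma₁ a q s * tau₁ a q s = 0 := by
  rw [gamma₁_eq, tau₁]
  simp only [((commute_tmul a q (x a q) (x a q)).pow_pow _ _).eq]
  refine geom_left' q a (commute_tmul a q _ _).symm ?_ ?_ s <;>
    simp [tmul_pow, x_pow, tmul_zero_left, tmul_zero_right]

theorem tau₁_mul_gamma₁ (s : ℕ) : tau₁ a q s * gamma₁ a q s = 0 := by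
  rw [gamma₁_eq, tau₁]
  simp only [((commute_tmul a q (x a q) (x a q)).pow_pow _ _).eq]
  refine geom_right' q a (commute_tmul a q _ _).symm ?_ ?_ s <;>
    simp [tmul_pow, x_pow, tmul_zero_left, tmul_zero_right]

theorem gamma₂_mul_gamma₁ (s u : ℕ) :
    gamma₂ a q (s + (a - 1)) * gamma₁ a q u = gamma₁ a q (u + (a - 1)) * gamma₂ a q s := by
  simp only [gamma₁_eq, gamma₂_eq]
  exact cross_gg q a (commute_tmul a q _ _) (commute_tmul a q _ _) (tmul_xy a q)
    (tmul_op_yx a q) s u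

theorem tau₂_mul_tau₁ (s u : ℕ) :
    tau₂ a q (s + 1) * tau₁ a q u = tau₁ a q (u + 1) * tau₂ a q s :=
  cross_tt q (commute_tmul a q _ _) (commute_tmul a q _ _) (tmul_xy a q) (tmul_op_yx a q) s u

theorem tau₂_mul_gamma₁ (s u : ℕ) :
    tau₂ a q (s + (a - 1)) * gamma₁ a q u = gamma₁ a q (u + 1) * tau₂ a q s := by
  simp only [gamma₁_eq]
  exact cross_tg q a (commute_tmul a q _ _) (commute_tmul a q _ _) (tmul_xy a q)
    (tmul_op_yx a q) s u

theorem gamma₂_mul_tau₁ (s u : ℕ) :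
    gamma₂ a q (s + 1) * tau₁ a q u = tau₁ a q (u + (a - 1)) * gamma₂ a q s := by
  simp only [gamma₂_eq]
  exact cross_gt q a (commute_tmul a q _ _) (commute_tmul a q _ _) (tmul_xy a q)
    (tmul_op_yx a q) s u

theorem dGen_even_even {m j s : ℕ} (h : m + 1 = 2 * (j + s)) :
    dGen a q m (2 * j) = gamma₂ a q (a * j) • gen a q m (2 * j)
      + gamma₁ a q (a * s) • gen a q m (2 * j - 1) := by
  have e1 : a * (2 * j) / 2 = a * j := by
    rw [show a * (2 * j) = 2 * (a * j) by ring]; omega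
  have e2 : (2 * a * (j + s) - a * (2 * j)) / 2 = a * s := by
    rw [show 2 * a * (j + s) = 2 * (a * s) + a * (2 * j) by ring]; omega
  have e3 : (2 * (j + s)) / 2 = j + s := by omega
  simp [dGen, h, e1, e2, e3]

theorem dGen_even_odd {m j s : ℕ} (h : m + 1 = 2 * (j + s + 1)) :
    dGen a q m (2 * j + 1) = -(tau₂ a q (a * j + 1) • gen a q m (2 * j + 1))
      + tau₁ a q (a * s + 1) • gen a q m (2 * j) := by
  have e1 : (a * (2 * j + 1) + 2 - a) / 2 = a * j + 1 := by
    rw [show a * (2 * j + 1) = 2 * (a * j) + a by ring]; omega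
  have e2 : (2 * a * (j + s + 1) + 2 - a * (2 * j + 1) - a) / 2 = a * s + 1 := by
    rw [show 2 * a * (j + s + 1) = 2 * (a * s) + (a * (2 * j + 1) + a) by ring]; omega
  have e3 : (2 * (j + s + 1)) / 2 = j + s + 1 := by omega
  have e4 : ¬ Even (2 * j + 1) := by simp
  simp [dGen, h, e1, e2, e3, e4]

theorem dGen_odd_even {m j s : ℕ} (h : m + 1 = 2 * (j + s) + 1) :
    dGen a q m (2 * j) = tau₂ a q (a * j) • gen a q m (2 * j)
      + gamma₁ a q (a * s + 1) • gen a q m (2 * j - 1) := by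
  have e1 : a * (2 * j) / 2 = a * j := by
    rw [show a * (2 * j) = 2 * (a * j) by ring]; omega
  have e2 : (2 * a * (j + s) + 2 - a * (2 * j)) / 2 = a * s + 1 := by
    rw [show 2 * a * (j + s) = 2 * (a * s) + a * (2 * j) by ring]; omega
  have e3 : (2 * (j + s) + 1) / 2 = j + s := by omega
  have e4 : ¬ Even (2 * (j + s) + 1) := by simp
  simp only [dGen, h, e1, e2, e3, e4]
  simp

theorem dGen_odd_odd {m j s : ℕ} (h : m + 1 = 2 * (j + s) + 1) :
    dGen a q m (2 * j + 1) = -(gamma₂ a q (a * j + 1) • gen a q m (2 * j + 1))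
      + tau₁ a q (a * s) • gen a q m (2 * j) := by
  have e1 : (a * (2 * j + 1) + 2 - a) / 2 = a * j + 1 := by
    rw [show a * (2 * j + 1) = 2 * (a * j) + a by ring]; omega
  have e2 : (2 * a * (j + s) + a - a * (2 * j + 1)) / 2 = a * s := by
    rw [show 2 * a * (j + s) + a = 2 * (a * s) + a * (2 * j + 1) by ring]; omega
  have e3 : (2 * (j + s) + 1) / 2 = j + s := by omega
  have e4 : ¬ Even (2 * (j + s) + 1) := by simp
  have e5 : ¬ Even (2 * j + 1) := by simp
  simp only [dGen, h, e1, e2, e3, e4, e5]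
  simp

theorem gen_neg_one (n : ℕ) : gen a q n (-1) = 0 := gen_eq_zero a q (by omega)

theorem gen_succ (n : ℕ) {i : ℤ} (h : i = n + 1) : gen a q n i = 0 :=
  gen_eq_zero a q (by omega)

theorem comp_aux {M : Type u} [AddCommGroup M] [Module (Env k a q) M]
    {α β α' β' γ γ' : Env k a q} {u v w : M}
    (h₁ : α * α' = 0) (h₂ : β * β' = 0) (h₃ : (α * γ) • v = (β * γ') • v) :
    α • (α' • u + γ • v) + β • (-(γ' • v) + β' • w) = 0 := by
  simp only [smul_add, smul_neg, smul_smul, h₁, h₂, h₃, zero_smul]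
  abel

theorem comp_aux' {M : Type u} [AddCommGroup M] [Module (Env k a q) M]
    {α β α' β' γ γ' : Env k a q} {u v w : M}
    (h₁ : α * α' = 0) (h₂ : β * β' = 0) (h₃ : (α * γ) • v = (β * γ') • v) :
    -(α • (-(α' • u) + γ • v)) + β • (γ' • v + β' • w) = 0 := by
  simp only [smul_add, smul_neg, smul_smul, h₁, h₂, h₃, zero_smul]
  abel

theorem d_gen_of_eq (m : ℕ) {i : ℕ} {z : ℤ} (hz : z = i) (hi : i ≤ m + 1) :
    d a q m (gen a q (m + 1) z) = dGen a q m i := by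
  rw [hz, d_gen a q m hi]

theorem d_gen_odd_even {m j s : ℕ} (h : m + 2 = 2 * (j + s)) :
    d a q m (gen a q (m + 1) (2 * j)) = tau₂ a q (a * j) • gen a q m (2 * j)
      + gamma₁ a q (a * (s - 1) + 1) • gen a q m (2 * j - 1) := by
  rcases s with _ | s
  · rw [gen_succ a q (m + 1) (by omega), gen_eq_zero a q (n := m) (by omega),
      gen_succ a q m (by omega)]
    simp
  · rw [d_gen_of_eq a q m (i := 2 * j) (by push_cast; rfl) (by omega),
      dGen_odd_even a q (j := j) (s := s) (by omega)]
    rfl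

theorem d_gen_odd_odd {m j s : ℕ} (h : m + 2 = 2 * (j + s)) :
    d a q m (gen a q (m + 1) (2 * j - 1))
      = -(gamma₂ a q (a * (j - 1) + 1) • gen a q m (2 * j - 1))
        + tau₁ a q (a * s) • gen a q m (2 * j - 2) := by
  rcases j with _ | j
  · rw [gen_eq_zero a q (n := m + 1) (by omega), gen_eq_zero a q (n := m) (by omega),
      gen_eq_zero a q (n := m) (by omega)]
    simp
  · rw [d_gen_of_eq a q m (i := 2 * j + 1) (by push_cast; ring) (by omega),
      dGen_odd_odd a q (j := j) (s := s) (by omega)]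
    congr 4 <;> push_cast <;> ring

theorem d_gen_even_odd {m j s : ℕ} (h : m + 1 = 2 * (j + s)) :
    d a q m (gen a q (m + 1) (2 * j - 1))
      = -(tau₂ a q (a * (j - 1) + 1) • gen a q m (2 * j - 1))
        + tau₁ a q (a * s + 1) • gen a q m (2 * j - 2) := by
  rcases j with _ | j
  · rw [gen_eq_zero a q (n := m + 1) (by omega), gen_eq_zero a q (n := m) (by omega),
      gen_eq_zero a q (n := m) (by omega)]
    simp
  · rw [d_gen_of_eq a q m (i := 2 * j + 1) (by push_cast; ring) (by omega),
      dGen_even_odd a q (j := j) (s := s) (by omega)]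
    congr 4 <;> push_cast <;> ring

theorem d_gen_even_odd' {m j s : ℕ} (h : m + 1 = 2 * (j + s)) :
    d a q m (gen a q (m + 1) (2 * j + 1))
      = -(tau₂ a q (a * j + 1) • gen a q m (2 * j + 1))
        + tau₁ a q (a * (s - 1) + 1) • gen a q m (2 * j) := by
  rcases s with _ | s
  · rw [gen_succ a q (m + 1) (by omega), gen_eq_zero a q (n := m) (by omega),
      gen_succ a q m (by omega)]
    simp
  · rw [d_gen_of_eq a q m (i := 2 * j + 1) (by push_cast; rfl) (by omega),
      dGen_even_odd a q (j := j) (s := s) (by omega)]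
    rfl

theorem d_dGen_zero (m i : ℕ) (h : a = 0) : d a q m (dGen a q (m + 1) i) = 0 := by
  have h0 : (1 : Alg k a q) = 0 := by
    have := x_pow a q
    rwa [show x a q ^ a = 1 by rw [h, pow_zero]] at this
  have h1 : (1 : Env k a q) = 0 := by rw [← tmul_one_one, h0, tmul_zero_left]
  funext j
  rw [← one_mul (d a q m _ j), h1, zero_mul, Pi.zero_apply]

theorem d_dGen (m i : ℕ) (hi : i ≤ m + 2) : d a q m (dGen a q (m + 1) i) = 0 := by
  rcases Nat.eq_zero_or_pos a with ha | ha
  · exact d_dGen_zero a q m i ha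
  have hsucc : ∀ n : ℕ, a * (n + 1) = a * n + 1 + (a - 1) := by
    intro n
    rw [Nat.mul_succ]
    omega
  obtain ⟨j, rfl | rfl⟩ := Nat.even_or_odd' i <;>
  obtain ⟨t, ht | ht⟩ := Nat.even_or_odd' m
  · obtain ⟨s, hs⟩ : ∃ s, t + 1 = j + s := ⟨t + 1 - j, by omega⟩
    rw [dGen_even_even a q (j := j) (s := s) (by omega), map_add, map_smul, map_smul,
      d_gen_odd_even a q (j := j) (s := s) (by omega),
      d_gen_odd_odd a q (j := j) (s := s) (by omega)]
    refine comp_aux a q (gamma₂_mul_tau₂ a q _) (gamma₁_mul_tau₁ a q _) ?_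
    rcases j with _ | j
    · rw [gen_eq_zero a q (by omega), smul_zero, smul_zero]
    rcases s with _ | s
    · rw [gen_eq_zero a q (by omega), smul_zero, smul_zero]
    · rw [hsucc j, hsucc s, gamma₂_mul_gamma₁]
      rfl
  · obtain ⟨s, hs⟩ : ∃ s, t + 1 = j + s := ⟨t + 1 - j, by omega⟩
    rw [dGen_odd_even a q (j := j) (s := s) (by omega), map_add, map_smul, map_smul,
      d_gen_of_eq a q m (i := 2 * j) (by push_cast; rfl) (by omega),
      dGen_even_even a q (j := j) (s := s) (by omega),
      d_gen_even_odd a q (j := j) (s := s) (by omega)]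
    refine comp_aux a q (tau₂_mul_gamma₂ a q _) (gamma₁_mul_tau₁ a q _) ?_
    rcases j with _ | j
    · rw [gen_eq_zero a q (by omega), smul_zero, smul_zero]
    · rw [hsucc j, tau₂_mul_gamma₁]
      rfl
  · obtain ⟨s, hs⟩ : ∃ s, t = j + s := ⟨t - j, by omega⟩
    rw [dGen_even_odd a q (j := j) (s := s) (by omega), map_add, map_neg, map_smul, map_smul,
      d_gen_of_eq a q m (i := 2 * j + 1) (by push_cast; rfl) (by omega),
      d_gen_of_eq a q m (i := 2 * j) (by push_cast; rfl) (by omega),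
      dGen_odd_odd a q (j := j) (s := s) (by omega),
      dGen_odd_even a q (j := j) (s := s) (by omega)]
    refine comp_aux' a q (tau₂_mul_gamma₂ a q _) (tau₁_mul_gamma₁ a q _) ?_
    rw [tau₂_mul_tau₁]
  · obtain ⟨s, hs⟩ : ∃ s, t + 1 = j + s := ⟨t + 1 - j, by omega⟩
    rw [dGen_odd_odd a q (j := j) (s := s) (by omega), map_add, map_neg, map_smul, map_smul,
      d_gen_even_odd' a q (j := j) (s := s) (by omega),
      d_gen_of_eq a q m (i := 2 * j) (by push_cast; rfl) (by omega),
      dGen_even_even a q (j := j) (s := s) (by omega)]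
    refine comp_aux' a q (gamma₂_mul_tau₂ a q _) (tau₁_mul_gamma₁ a q _) ?_
    rcases s with _ | s
    · rw [gen_eq_zero a q (by omega), smul_zero, smul_zero]
    · rw [hsucc s, ← gamma₂_mul_tau₁]
      rfl

theorem d_comp_d (m : ℕ) : d a q m ∘ₗ d a q (m + 1) = 0 := by
  refine LinearMap.pi_ext' fun i => LinearMap.ext_ring ?_
  have h : (Pi.single i 1 : P a q (m + 1 + 1)) = gen a q (m + 1 + 1) ((i : ℕ) : ℤ) := by
    funext j
    simp [gen, Pi.single_apply, Fin.ext_iff]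
  have hi := i.2
  simp only [LinearMap.comp_apply, LinearMap.single_apply, h, LinearMap.zero_apply]
  rw [d_gen a q (m + 1) (by omega), d_dGen a q m i (by omega)]

theorem mu_comp_d : mu a q ∘ₗ d a q 0 = 0 := by
  have h0 : mu a q (gen a q 0 0) = 1 := cochain_gen a q 0 _ 0
  refine LinearMap.pi_ext' fun i => LinearMap.ext_ring ?_
  have h : (Pi.single i 1 : P a q (0 + 1)) = gen a q (0 + 1) ((i : ℕ) : ℤ) := by
    funext j
    simp [gen, Pi.single_apply, Fin.ext_iff]
  have hi := i.2
  simp only [LinearMap.comp_apply, LinearMap.single_apply, h, LinearMap.zero_apply]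
  rw [d_gen a q 0 (by omega)]
  obtain hi | hi : (i : ℕ) = 2 * 0 ∨ (i : ℕ) = 2 * 0 + 1 := by omega
  · rw [hi, dGen_odd_even a q (j := 0) (s := 0) (by omega),
      gen_eq_zero a q (i := 2 * (0 : ℕ) - 1) (by omega)]
    simp [h0, tau₂, sub_smul, tmul_smul]
  · rw [hi, dGen_odd_odd a q (j := 0) (s := 0) (by omega),
      gen_eq_zero a q (i := 2 * (0 : ℕ) + 1) (by omega)]
    simp [h0, tau₁, sub_smul, tmul_smul]

/-- The algebra `A` as an object of the category of left modules over `A ⊗ Aᵒᵖ`. -/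
abbrev algObj : ModuleCat.{u} (Env k a q) := ModuleCat.of (Env k a q) (Alg k a q)

/-- The complex `⋯ → P 2 → P 1 → P 0`. -/
def complex : ChainComplex (ModuleCat.{u} (Env k a q)) ℕ :=
  ChainComplex.of (fun n => ModuleCat.of (Env k a q) (P a q n))
    (fun n => ModuleCat.ofHom (d a q n)) fun n => by
      rw [← ModuleCat.ofHom_comp, d_comp_d]
      rfl

theorem complex_d (n : ℕ) : (complex a q).d (n + 1) n = ModuleCat.ofHom (d a q n) :=
  ChainComplex.of_d (fun n => ModuleCat.of (Env k a q) (P a q n))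
    (fun n => ModuleCat.ofHom (d a q n)) n

/-- The augmented complex, as a morphism from the complex `P` to `A` placed in degree `0`; it is
given by `mu` in degree `0`. -/
def augmentation : complex a q ⟶ (ChainComplex.single₀ _).obj (algObj a q) :=
  (ChainComplex.toSingle₀Equiv (complex a q) (algObj a q)).symm
    ⟨ModuleCat.ofHom (mu a q), by
      have e : ModuleCat.ofHom (d a q 0) ≫ ModuleCat.ofHom (mu a q) = 0 := by
        rw [← ModuleCat.ofHom_comp, mu_comp_d]
        rfl
      rw [complex_d]
      exact e⟩

theorem augmentation_f_zero : (augmentation a q).f 0 = ModuleCat.ofHom (mu a q) :=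
  congrArg Subtype.val ((ChainComplex.toSingle₀Equiv (complex a q) (algObj a q)).apply_symm_apply _)

/-- `P` as a projective resolution of `A`, once its augmentation is known to be a
quasi-isomorphism, that is, once `⋯ → P 1 → P 0 → A → 0` is known to be exact. -/
def resolution (h : QuasiIso (augmentation a q)) : ProjectiveResolution (algObj a q) where
  complex := complex a q
  projective n := inferInstanceAs (Projective (ModuleCat.of (Env k a q) (P a q n)))
  π := augmentation a q
  quasiIso := h

/-- The Hochschild cohomology `HH^n(A) = Ext^n(A, A)` over `A ⊗ Aᵒᵖ`. -/
abbrev HH (n : ℕ) : Type u := Ext (algObj a q) (algObj a q) n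

variable {a q}

/-- The class in `HH^n(A)` of a cocycle `p : P n → A`. -/
def hhClass (h : QuasiIso (augmentation a q)) {n : ℕ} (p : P a q n →ₗ[Env k a q] Alg k a q)
    (hp : p ∘ₗ d a q n = 0) : HH a q n :=
  (resolution a q h).extMk (ModuleCat.ofHom p) (n + 1) rfl (by
    have e : ModuleCat.ofHom (d a q n) ≫ ModuleCat.ofHom p = 0 := by
      rw [← ModuleCat.ofHom_comp, hp]
      rfl
    change (complex a q).d (n + 1) n ≫ ModuleCat.ofHom p = 0
    rw [complex_d]
    exact e)

/-- The powers of a homogeneous element of `HH^*(A)` with respect to the Yoneda product. -/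
def hhPow {n : ℕ} (z : HH a q n) : (m : ℕ) → HH a q (n * m)
  | 0 => Ext.mk₀ (𝟙 (algObj a q))
  | m + 1 => (hhPow z m).comp z rfl

/-- A homogeneous element of `HH^*(A)` is nilpotent if one of its powers is zero (the zeroth power
is the identity, which is nonzero as soon as `A` is). -/
def HHNilpotent {n : ℕ} (z : HH a q n) : Prop := ∃ m, hhPow z m = 0

variable (a q)

/-- The map `ζ_j : P (2 t) → A` with `f_j ↦ 1` and `f_i ↦ 0` for `i ≠ j`. -/
def zeta (t : ℕ) (j : Fin (2 * t + 1)) : P a q (2 * t) →ₗ[Env k a q] Alg k a q :=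
  cochain a q (2 * t) fun i => if i = j then 1 else 0

/-- The map `η_j^+ : P (2 t) → A` with `f_j ↦ x ^ (a - 1) y ^ (a - 1)` and `f_i ↦ 0` for `i ≠ j`;
it is used for even `j`. -/
def etaPlus (t : ℕ) (j : Fin (2 * t + 1)) : P a q (2 * t) →ₗ[Env k a q] Alg k a q :=
  cochain a q (2 * t) fun i => if i = j then x a q ^ (a - 1) * y a q ^ (a - 1) else 0

/-- The map `η_j^- : P (2 t) → A` with `f_j ↦ x y` and `f_i ↦ 0` for `i ≠ j`; it is used for
odd `j`. -/
def etaMinus (t : ℕ) (j : Fin (2 * t + 1)) : P a q (2 * t) →ₗ[Env k a q] Alg k a q :=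
  cochain a q (2 * t) fun i => if i = j then x a q * y a q else 0

/-- The index set of the classes `η_j^±`: the even `j` for `η_j^+`, the odd `j` for `η_j^-`. -/
abbrev EtaIndex (t : ℕ) : Type :=
  {j : Fin (2 * t + 1) // Even (j : ℕ)} ⊕ {j : Fin (2 * t + 1) // Odd (j : ℕ)}

/-- The maps `η_j^+` for even `j` and `η_j^-` for odd `j`. -/
def eta (t : ℕ) : EtaIndex t → (P a q (2 * t) →ₗ[Env k a q] Alg k a q) :=
  Sum.elim (fun j => etaPlus a q t j.1) (fun j => etaMinus a q t j.1)

end QCI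

end

/-! The left regular representation on coefficient functions shows that the `x ^ u * y ^ v` with `u,
v < a` form a basis of A. Elements of A^e therefore have well-defined coefficients with respect to
the powers of U = 1 ⊗ y. Put V = q^s (y ⊗ 1), which commutes with U. Then τ₂(s) = U - V, and γ₂(s)
is the geometric sum ∑ V^j U^(a-1-j), with U^a = V^a = 0. Division with remainder by U - V shows
that each of the right multiplications by τ₂(s) and γ₂(s) has the image of the other as its kernel.
Up to units the same holds for τ₁(s) and γ₁(s).

Since q^a = 1, the coefficients of d depend only on parities. So P is the total complex of a double
complex with f_i^n in column i and row r = n - i, vertical maps ±τ₂, ±γ₂ and horizontal maps τ₁, γ₁.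
The columns are exact above row 0. Their cokernels at row 0 are represented by A ⊗ k[x], on which
the horizontal maps form an exact row ending in A. A diagram chase (`chase`, `exact_d`,
`exact_d_zero`) gives the resolution. Give x and y degree 1 and f_i^n degree `wt (n - i) + wt i`:
then d preserves degrees and every division respects the degree filtration, so a cycle of filtration
e bounds a chain of filtration e.

In even degree, at an even generator, the cocycle condition leaves the monomials 1, x^(a-1) y^(a-1),
x^(a-1), y^(a-1), and ties the coefficients of the last two to the neighbouring odd values, so that
a coboundary removes them. At an odd generator, the images of τ₁(1) and τ₂(1) contain all monomials
except 1 and xy. No coboundary has the two remaining coefficients at any generator. Thus a class is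
determined by two free coefficients per generator (`hhClass_eq_zero_iff_coef`), which gives the
basis.

Each η raises degrees by at least a - at, so by filtered exactness it lifts to a chain map that does
the same. Its square then has values of degree at least 2a at even generators and at least a + 2 at
odd ones. The essential coefficients sit in degrees 0, 2a - 2 and 0, 2 respectively, so they all
vanish and the square is zero. -/

noncomputable section

/-! ### Yoneda products computed by chain lifts -/

section YonedaProduct

universe w v u'

open CochainComplex HomComplex Localization

variable {C : Type u'} [Category.{v} C] [Abelian C] {X Y Z : C}

namespace CategoryTheory.ProjectiveResolution

open Classical in
/-- The components, in all integral degrees, of a family of maps `R_{n + m} ⟶ S_m`. -/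
def shiftMapF (R : ProjectiveResolution X) (S : ProjectiveResolution Y) {n : ℕ}
    (φ : ∀ m, R.complex.X (n + m) ⟶ S.complex.X m) (i : ℤ) :
    R.cochainComplex.X i ⟶ S.cochainComplex.X (i + n) :=
  -- Without such an `m` the degree `i + n` is positive and the target is zero, so `0` is the only
  -- possible value.
  if h : ∃ m : ℕ, -(m : ℤ) = i + n then
    (R.cochainComplexXIso i (n + h.choose) (by have := h.choose_spec; push_cast; lia)).hom ≫
      φ h.choose ≫ (S.cochainComplexXIso (i + n) h.choose h.choose_spec).inv
  else 0

theorem shiftMapF_eq (R : ProjectiveResolution X) (S : ProjectiveResolution Y) {n : ℕ}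
    (φ : ∀ m, R.complex.X (n + m) ⟶ S.complex.X m) {i : ℤ} {m : ℕ} (h : -(m : ℤ) = i + n) :
    shiftMapF R S φ i = (R.cochainComplexXIso i (n + m) (by push_cast; lia)).hom ≫
      φ m ≫ (S.cochainComplexXIso (i + n) m h).inv := by
  have h' : ∃ m : ℕ, -(m : ℤ) = i + n := ⟨m, h⟩
  have e : h'.choose = m := by have := h'.choose_spec; lia
  rw [shiftMapF, dif_pos h']
  subst e
  rfl

theorem shiftMapF_comm (R : ProjectiveResolution X) (S : ProjectiveResolution Y) {n : ℕ}
    (φ : ∀ m, R.complex.X (n + m) ⟶ S.complex.X m)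
    (hφ : ∀ m, R.complex.d (n + (m + 1)) (n + m) ≫ φ m = φ (m + 1) ≫ S.complex.d (m + 1) m)
    (i : ℤ) :
    shiftMapF R S φ i ≫ S.cochainComplex.d (i + n) (i + 1 + n)
      = R.cochainComplex.d i (i + 1) ≫ shiftMapF R S φ (i + 1) := by
  by_cases h : ∃ m : ℕ, -(m : ℤ) = i + 1 + n
  · obtain ⟨m, hm⟩ := h
    rw [shiftMapF_eq R S φ hm, shiftMapF_eq R S φ (m := m + 1) (by push_cast; lia),
      R.cochainComplex_d i (i + 1) (n + (m + 1)) (n + m) (by push_cast; lia) (by push_cast; lia),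
      S.cochainComplex_d (i + n) (i + 1 + n) (m + 1) m (by push_cast; lia) (by lia)]
    simp [reassoc_of% (hφ m)]
  · have h1 : shiftMapF R S φ (i + 1) = 0 := dif_neg h
    have h2 : 0 < i + 1 + n := by
      by_contra h0
      exact h ⟨(-(i + 1 + n)).toNat, by lia⟩
    have h3 : Limits.IsZero (S.cochainComplex.X (i + 1 + n)) :=
      CochainComplex.isZero_of_isStrictlyLE _ 0 _ h2
    exact h3.eq_of_tgt _ _

/-- The map of complexes `R ⟶ S[n]` given by a chain map `R_{n + m} ⟶ S_m`. -/
def shiftMap (R : ProjectiveResolution X) (S : ProjectiveResolution Y) {n : ℕ} (hn : Even n)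
    (φ : ∀ m, R.complex.X (n + m) ⟶ S.complex.X m)
    (hφ : ∀ m, R.complex.d (n + (m + 1)) (n + m) ≫ φ m = φ (m + 1) ≫ S.complex.d (m + 1) m) :
    R.cochainComplex ⟶ S.cochainComplex⟦(n : ℤ)⟧ where
  f i := shiftMapF R S φ i
  comm' i j hij := by
    obtain rfl : i + 1 = j := hij
    -- The differential of the shift by n carries the sign (-1)^n, which is trivial for even n.
    rw [CochainComplex.shiftFunctor_obj_d', Int.negOnePow_even _ (by exact_mod_cast hn), one_smul]
    exact shiftMapF_comm R S φ hφ i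

/-- In a product of two classes, the first ends with the projection π of a resolution and the second
starts with the inverse of it. By `hr` these cancel by associativity, and Φ is followed directly by
Γ. -/
theorem shiftedHom_comp_cancel {D : Type*} [Category* D] [HasShift D ℤ] {A B E F G H I : D}
    {n m p : ℤ} (α : A ⟶ B) (Φ : ShiftedHom B E n) (π : E ⟶ F) (s : F ⟶ G) (r : G ⟶ E)
    (hr : π ≫ s ≫ r = 𝟙 E) (Γ : ShiftedHom E H m) (β : H ⟶ I) (h : m + n = p) :
    ((ShiftedHom.mk₀ (0 : ℤ) rfl α).comp ((Φ.comp (ShiftedHom.mk₀ (0 : ℤ) rfl π)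
        (zero_add _)).comp (ShiftedHom.mk₀ (0 : ℤ) rfl s) (zero_add _)) (add_zero _)).comp
      ((ShiftedHom.mk₀ (0 : ℤ) rfl r).comp (Γ.comp (ShiftedHom.mk₀ (0 : ℤ) rfl β) (zero_add _))
        (add_zero _)) h
    = (ShiftedHom.mk₀ (0 : ℤ) rfl α).comp ((Φ.comp Γ h).comp (ShiftedHom.mk₀ (0 : ℤ) rfl β)
        (zero_add _)) (add_zero _) := by
  rw [ShiftedHom.comp_assoc _ _ _ (add_zero _) h (by simpa using h)]
  congr 1
  rw [ShiftedHom.comp_assoc Φ _ _ _ (zero_add _) (by simp), ShiftedHom.mk₀_comp_mk₀,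
    ShiftedHom.comp_assoc Φ _ _ _ (add_zero _) (by simpa using h),
    ← ShiftedHom.comp_assoc (ShiftedHom.mk₀ (0 : ℤ) rfl _) _ _ (zero_add _) _ (by simp),
    ShiftedHom.mk₀_comp_mk₀, Category.assoc, hr,
    ShiftedHom.mk₀_id_comp, ShiftedHom.comp_assoc Φ _ _ h (zero_add _) (by simpa using h)]

/-- The target is concentrated in degree 0, so only the component starting in degree -n can be
nonzero. -/
theorem cocycle_toSingle_ext {K : CochainComplex C ℤ} {n : ℤ}
    {c c' : Cocycle K ((singleFunctor C 0).obj X) n}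
    (h : c.1.v (-n) 0 (by lia) = c'.1.v (-n) 0 (by lia)) : c = c' := by
  ext p q hpq
  by_cases hq : q = 0
  · subst hq
    obtain rfl : p = -n := by lia
    exact h
  · exact (HomologicalComplex.isZero_single_obj_X (ComplexShape.up ℤ) 0 X q hq).eq_of_tgt _ _

theorem cochainComplexXIso_inv_XIsoOfEq (S : ProjectiveResolution Y) {i j : ℤ} {m : ℕ}
    (h : -(m : ℤ) = i) (e : i = j) :
    (S.cochainComplexXIso i m h).inv ≫ (HomologicalComplex.XIsoOfEq S.cochainComplex e).hom
      = (S.cochainComplexXIso j m (h.trans e)).inv := by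
  subst e
  simp

theorem toSingleMk_v_eq (S : ProjectiveResolution Y) {m : ℕ} (g : S.complex.X m ⟶ Z) {i : ℤ}
    (h : -(m : ℤ) = i) :
    (Cochain.toSingleMk ((S.cochainComplexXIso (-m) m rfl).hom ≫ g) (n := m) (q := 0)
      (by simp)).v i 0 (by lia) = (S.cochainComplexXIso i m h).hom ≫ g ≫
        (HomologicalComplex.singleObjXSelf (.up ℤ) 0 Z).inv := by
  subst h
  simp
  rfl

omit [Abelian C] in
theorem comp_aux {P Q T U V : C} (A : P ≅ Q) (b : Q ⟶ T) (c : T ⟶ U) (d : U ⟶ V) (e : V ⟶ T)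
    (h : c ≫ d ≫ e = 𝟙 T) : b = (A.inv ≫ ((A.hom ≫ b) ≫ c) ≫ d) ≫ e := by
  simp [h]

/-- In the one relevant degree -n the right-hand side is φ 0 followed by the augmentation, which is
f by `hfφ`. -/
theorem toSingleMk_eq (R : ProjectiveResolution X) (S : ProjectiveResolution Y) {n : ℕ}
    (hn : Even n) (φ : ∀ m, R.complex.X (n + m) ⟶ S.complex.X m)
    (hφ : ∀ m, R.complex.d (n + (m + 1)) (n + m) ≫ φ m = φ (m + 1) ≫ S.complex.d (m + 1) m)
    (f : R.complex.X n ⟶ Y) (hf : R.complex.d (n + 1) n ≫ f = 0)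
    (hfφ : φ 0 ≫ S.π.f 0 = f) :
    Cocycle.toSingleMk ((R.cochainComplexXIso (-n) n rfl).hom ≫ f) (n := n) (q := 0) (by simp)
      (-(n + 1 : ℕ)) (by lia) (by rw [cochainComplex_d _ _ _ _ _ rfl rfl]; simpa) =
      (Cocycle.equivHomShift (shiftMap R S hn φ hφ)).postcomp S.π' := by
  apply cocycle_toSingle_ext
  rw [Cocycle.toSingleMk_coe, Cochain.toSingleMk_v]
  simp [Cocycle.equivHomShift_apply, Cochain.rightUnshift_v _ _ _ _ _ _ _ (add_zero _), π'_f_zero]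
  have e := shiftMapF_eq R S φ (i := -n) (m := 0) (by simp)
  change _ = (shiftMapF R S φ (-n) ≫ _) ≫ _
  rw [e]
  simp only [Category.assoc]
  rw [← Category.assoc _ (HomologicalComplex.XIsoOfEq _ _).hom, cochainComplexXIso_inv_XIsoOfEq]
  simp only [Iso.inv_hom_id_assoc]
  congr 1
  rw [← hfφ]
  exact Category.assoc _ _ _

/-- In the one relevant degree -(n + m) the shifted chain map is φ m and the cocycle of g is g; what
remains is to identify the shift isomorphisms. -/
theorem toSingleMk_comp_eq (R : ProjectiveResolution X) (S : ProjectiveResolution Y) {n m : ℕ}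
    (hn : Even n) (φ : ∀ m, R.complex.X (n + m) ⟶ S.complex.X m)
    (hφ : ∀ m, R.complex.d (n + (m + 1)) (n + m) ≫ φ m = φ (m + 1) ≫ S.complex.d (m + 1) m)
    (g : S.complex.X m ⟶ Z) (hg : S.complex.d (m + 1) m ≫ g = 0)
    (hg' : R.complex.d (n + m + 1) (n + m) ≫ φ m ≫ g = 0) :
    Cocycle.toSingleMk ((R.cochainComplexXIso (-(n + m : ℕ)) (n + m) rfl).hom ≫ φ m ≫ g)
        (n := (n + m : ℕ)) (q := 0) (by simp) (-(n + m + 1 : ℕ)) (by lia)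
        (by rw [cochainComplex_d _ _ _ _ _ rfl rfl]; simpa) =
      Cocycle.equivHomShift (ShiftedHom.comp (shiftMap R S hn φ hφ)
        (Cocycle.equivHomShift.symm
          (Cocycle.toSingleMk ((S.cochainComplexXIso (-m) m rfl).hom ≫ g) (n := m) (q := 0)
            (by simp) (-(m + 1 : ℕ)) (by lia)
            (by rw [cochainComplex_d _ _ _ _ _ rfl rfl]; simpa)))
        (show (m : ℤ) + n = (n + m : ℕ) by push_cast; ring)) := by
  apply cocycle_toSingle_ext
  rw [Cocycle.toSingleMk_coe, Cochain.toSingleMk_v]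
  simp [Cocycle.equivHomShift_apply, Cochain.rightUnshift_v _ _ _ _ _ _ _ (add_zero _),
    ShiftedHom.comp, Cocycle.equivHomShift_symm_apply]
  have e := shiftMapF_eq R S φ (i := -(n + m)) (m := m) (by simp)
  change _ = (shiftMapF R S φ (-(n + m)) ≫ _) ≫ _
  rw [e, Cochain.rightShift_v _ _ _ _ _ _ _ 0 (by simp), toSingleMk_v_eq _ _ (by simp),
    shiftFunctorAdd'_inv_app_f']
  simp only [Category.assoc]
  refine Eq.trans ?_ (Category.assoc _ _ _).symm
  refine congrArg (CategoryStruct.comp (R.cochainComplexXIso (-(n + m)) (n + m) _).hom) ?_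
  refine Eq.trans ?_ (Category.assoc _ _ _).symm
  refine congrArg (CategoryStruct.comp (φ m)) ?_
  refine comp_aux _ _ _ _ _ ?_
  simp only [CochainComplex.shiftFunctorObjXIso, HomologicalComplex.XIsoOfEq, eqToIso.inv,
    eqToIso.hom]
  exact (congrArg (_ ≫ ·) (eqToHom_trans _ _)).trans (eqToHom_trans _ _)

variable [HasExt.{w} C]

/-- In the derived category the class of f is the shifted chain map φ followed by the augmentation
of S, and the class of g begins with the inverse of that augmentation. -/
theorem extMk_comp_extMk (R : ProjectiveResolution X) (S : ProjectiveResolution Y) {n m : ℕ}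
    (hn : Even n) (φ : ∀ m, R.complex.X (n + m) ⟶ S.complex.X m)
    (hφ : ∀ m, R.complex.d (n + (m + 1)) (n + m) ≫ φ m = φ (m + 1) ≫ S.complex.d (m + 1) m)
    (f : R.complex.X n ⟶ Y) (hf : R.complex.d (n + 1) n ≫ f = 0)
    (hfφ : φ 0 ≫ S.π.f 0 = f)
    (g : S.complex.X m ⟶ Z) (hg : S.complex.d (m + 1) m ≫ g = 0)
    (hg' : R.complex.d (n + m + 1) (n + m) ≫ φ m ≫ g = 0) :
    (R.extMk f (n + 1) rfl hf).comp (S.extMk g (m + 1) rfl hg) rfl =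
      R.extMk (φ m ≫ g) (n + m + 1) rfl hg' := by
  have := HasDerivedCategory.standard C
  ext
  have key1 := toSingleMk_eq R S hn φ hφ f hf hfφ
  have key2 := toSingleMk_comp_eq R S hn φ hφ g hg hg'
  simp only [Ext.comp_hom, extMk_hom]
  rw [key1, key2, Cocycle.equivHomShift_symm_postcomp, AddEquiv.symm_apply_apply,
    AddEquiv.symm_apply_apply, ShiftedHom.map_comp]
  have e1 : (shiftMap R S hn φ hφ) ≫ (shiftFunctor (CochainComplex C ℤ) (n:ℤ)).map S.π' =
    ShiftedHom.comp (shiftMap R S hn φ hφ) (ShiftedHom.mk₀ (0:ℤ) rfl S.π') (zero_add _) := by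
    rw [ShiftedHom.comp_mk₀]
  rw [e1, ShiftedHom.map_comp, ShiftedHom.map_mk₀]
  refine shiftedHom_comp_cancel _ _ _ _ _ ?_ _ _ _
  simp

/-- There are no nonzero coboundaries in degree 0: they would come from the term of R in
cohomological degree 1, which is zero. -/
theorem extMk_zero_eq_zero_iff (R : ProjectiveResolution X) (f : R.complex.X 0 ⟶ Y)
    (hf : R.complex.d 1 0 ≫ f = 0) : R.extMk f 1 rfl hf = 0 ↔ f = 0 := by
  refine ⟨fun h => ?_, fun h => by subst h; exact R.extMk_zero 1 rfl⟩
  rw [← R.extEquivCohomologyClass.apply_eq_iff_eq, extEquivCohomologyClass_extMk,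
    extEquivCohomologyClass_zero, CohomologyClass.mk_eq_zero_iff,
    Cocycle.toSingleMk_mem_coboundaries_iff _ _ _ _ _ 1 (by simp)] at h
  obtain ⟨g, hg⟩ := h
  have h0 : Limits.IsZero (R.cochainComplex.X 1) :=
    CochainComplex.isZero_of_isStrictlyLE _ 0 _ (by lia)
  rw [h0.eq_of_src g 0, Limits.comp_zero] at hg
  rw [← cancel_epi (R.cochainComplexXIso (-(0 : ℕ)) 0 rfl).hom, Limits.comp_zero]
  exact hg.symm

theorem extMk_smul {K : Type*} [CommRing K] [Linear K C] (R : ProjectiveResolution X) {n : ℕ}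
    (f : R.complex.X n ⟶ Y) (hf : R.complex.d (n + 1) n ≫ f = 0) (r : K) :
    R.extMk (r • f) (n + 1) rfl (by rw [Linear.comp_smul, hf, smul_zero]) =
      r • R.extMk f (n + 1) rfl hf := by
  rw [Ext.smul_eq_comp_mk₀, extMk_comp_mk₀]
  congr 1
  simp

end CategoryTheory.ProjectiveResolution

end YonedaProduct

/-! ### The monomial basis of A and multiplication in coordinates -/

namespace QCI

variable {k : Type u} [Field k] (a : ℕ) (q : k)

/-- Left multiplication by `x` on coefficient functions with respect to the `x ^ u * y ^ v`. -/
def opX : (ℕ → ℕ → k) →ₗ[k] (ℕ → ℕ → k) where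
  toFun f u v := if 1 ≤ u ∧ u < a then f (u - 1) v else 0
  map_add' f g := by ext u v; simp only [Pi.add_apply]; split_ifs <;> simp
  map_smul' c f := by ext u v; simp

/-- Left multiplication by `y` on coefficient functions. -/
def opY : (ℕ → ℕ → k) →ₗ[k] (ℕ → ℕ → k) where
  toFun f u v := if 1 ≤ v ∧ v < a then q⁻¹ ^ u * f u (v - 1) else 0
  map_add' f g := by ext u v; simp only [Pi.add_apply]; split_ifs <;> simp [mul_add]
  map_smul' c f := by ext u v; simp; ring_nf

variable {a q}

theorem opX_apply (f : ℕ → ℕ → k) (u v : ℕ) :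
    opX a f u v = if 1 ≤ u ∧ u < a then f (u - 1) v else 0 := rfl

theorem opY_apply (f : ℕ → ℕ → k) (u v : ℕ) :
    opY a q f u v = if 1 ≤ v ∧ v < a then q⁻¹ ^ u * f u (v - 1) else 0 := rfl

theorem opX_pow_of_lt (n : ℕ) : ∀ (f : ℕ → ℕ → k) (u v : ℕ), u < n → (opX a ^ n) f u v = 0 := by
  induction n with
  | zero => intro f u v h; omega
  | succ n ih =>
    intro f u v h
    rw [pow_succ', Module.End.mul_apply, opX_apply]
    split_ifs with h'
    · exact ih _ _ _ (by omega)
    · rfl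

theorem opY_pow_of_lt (n : ℕ) :
    ∀ (f : ℕ → ℕ → k) (u v : ℕ), v < n → (opY a q ^ n) f u v = 0 := by
  induction n with
  | zero => intro f u v h; omega
  | succ n ih =>
    intro f u v h
    rw [pow_succ', Module.End.mul_apply, opY_apply]
    split_ifs with h'
    · rw [ih _ _ _ (by omega), mul_zero]
    · rfl

theorem opX_pow (ha : 0 < a) : (opX a : (ℕ → ℕ → k) →ₗ[k] _) ^ a = 0 := by
  ext f u v
  by_cases h : u < a
  · exact opX_pow_of_lt a f u v h
  · obtain ⟨n, rfl⟩ := Nat.exists_eq_succ_of_ne_zero ha.ne'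
    rw [Nat.succ_eq_add_one, pow_succ', Module.End.mul_apply, opX_apply, if_neg (by omega)]
    rfl

theorem opY_pow (ha : 0 < a) : opY a q ^ a = 0 := by
  ext f u v
  by_cases h : v < a
  · exact opY_pow_of_lt a f u v h
  · obtain ⟨n, rfl⟩ := Nat.exists_eq_succ_of_ne_zero ha.ne'
    rw [Nat.succ_eq_add_one, pow_succ', Module.End.mul_apply, opY_apply, if_neg (by omega)]
    rfl

/-- Shifting u by one changes the factor `q⁻¹ ^ u` of `opY` by `q⁻¹`, which is the twist in xy = q
yx. -/
theorem opX_opY (hq : q ≠ 0) (f : ℕ → ℕ → k) :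
    opX a (opY a q f) = q • opY a q (opX a f) := by
  ext u v
  simp only [Pi.smul_apply, opX_apply, opY_apply, smul_eq_mul]
  obtain _ | u := u
  · simp
  · split_ifs <;> simp_all [pow_succ]
    field_simp

variable (a q) in
/-- The left regular representation of `A` on coefficient functions. -/
def rep (ha : 0 < a) (hq : q ≠ 0) : Alg k a q →ₐ[k] Module.End k (ℕ → ℕ → k) :=
  RingQuot.liftAlgHom k ⟨FreeAlgebra.lift k ![opX a, opY a q], by
    intro v w h
    induction h with
    | x_pow => simpa using opX_pow ha
    | x_mul_y =>
      simp only [map_mul, map_smul, FreeAlgebra.lift_ι_apply]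
      exact LinearMap.ext fun f => opX_opY hq f
    | y_pow => simpa using opY_pow ha⟩

theorem rep_x (ha : 0 < a) (hq : q ≠ 0) : rep a q ha hq (x a q) = opX a := by
  change rep a q ha hq (RingQuot.mkAlgHom k (Rel k a q) _) = _
  exact (RingQuot.liftAlgHom_mkAlgHom_apply k _ _ _).trans (by simp)

theorem rep_y (ha : 0 < a) (hq : q ≠ 0) : rep a q ha hq (y a q) = opY a q := by
  change rep a q ha hq (RingQuot.mkAlgHom k (Rel k a q) _) = _
  exact (RingQuot.liftAlgHom_mkAlgHom_apply k _ _ _).trans (by simp)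

open Classical in
variable (a q) in
/-- The coefficient functions of the elements of `A` with respect to the `x ^ u * y ^ v`. -/
def coef : Alg k a q →ₗ[k] (ℕ → ℕ → k) :=
  if h : 0 < a ∧ q ≠ 0 then
    (LinearMap.applyₗ (fun u v => if u = 0 ∧ v = 0 then (1 : k) else 0)).comp
      (rep a q h.1 h.2).toLinearMap
  else 0

section

variable (ha : 0 < a) (hq : q ≠ 0)
include ha hq

theorem coef_apply (m : Alg k a q) :
    coef a q m = rep a q ha hq m (fun u v => if u = 0 ∧ v = 0 then (1 : k) else 0) := by
  rw [coef, dif_pos ⟨ha, hq⟩]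
  rfl

theorem coef_one (u v : ℕ) :
    coef a q 1 u v = if u = 0 ∧ v = 0 then 1 else 0 := by
  rw [coef_apply ha hq, map_one]
  rfl

theorem coef_x_mul (m : Alg k a q) : coef a q (x a q * m) = opX a (coef a q m) := by
  rw [coef_apply ha hq, coef_apply ha hq, map_mul, rep_x]
  rfl

theorem coef_y_mul (m : Alg k a q) : coef a q (y a q * m) = opY a q (coef a q m) := by
  rw [coef_apply ha hq, coef_apply ha hq, map_mul, rep_y]
  rfl

end

theorem alg_induction {C : Alg k a q → Prop} (h1 : C 1) (hadd : ∀ m n, C m → C n → C (m + n))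
    (hsmul : ∀ (r : k) m, C m → C (r • m)) (hx : ∀ m, C m → C (x a q * m))
    (hy : ∀ m, C m → C (y a q * m)) (m : Alg k a q) : C m := by
  obtain ⟨w, hw⟩ := RingQuot.mkAlgHom_surjective k (Rel k a q) m
  change mk k a q w = m at hw
  subst hw
  -- Stability of C under left multiplication by w is the stronger claim that passes to products.
  suffices h : ∀ n, C n → C (mk k a q w * n) by simpa using h 1 h1
  induction w using FreeAlgebra.induction with
  | grade0 r => intro n hn; rw [AlgHom.commutes, ← Algebra.smul_def]; exact hsmul r n hn
  | grade1 i =>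
    fin_cases i
    · exact hx
    · exact hy
  | mul v w hv hw => intro n hn; rw [map_mul, mul_assoc]; exact hv _ (hw _ hn)
  | add v w hv hw => intro n hn; rw [map_add, add_mul]; exact hadd _ _ (hv _ hn) (hw _ hn)

theorem y_mul_x_pow (hq : q ≠ 0) (i : ℕ) :
    y a q * x a q ^ i = q⁻¹ ^ i • (x a q ^ i * y a q) := by
  have h := qpow (x_mul_y a q) i 1
  rw [pow_one, mul_one] at h
  rw [h, smul_smul, ← mul_pow, inv_mul_cancel₀ hq, one_pow, one_smul]

theorem y_pow_mul_x_pow (hq : q ≠ 0) (i j : ℕ) :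
    y a q ^ j * x a q ^ i = q⁻¹ ^ (i * j) • (x a q ^ i * y a q ^ j) := by
  have h := qpow (x_mul_y a q) i j
  rw [h, smul_smul, ← mul_pow, inv_mul_cancel₀ hq, one_pow, one_smul]

theorem span_mono (hq : q ≠ 0) :
    Submodule.span k (Set.range fun p : ℕ × ℕ => x a q ^ p.1 * y a q ^ p.2) = ⊤ := by
  rw [eq_top_iff]
  rintro m -
  induction m using alg_induction with
  | h1 => exact Submodule.subset_span ⟨(0, 0), by simp⟩
  | hadd m n hm hn => exact Submodule.add_mem _ hm hn
  | hsmul r m hm => exact Submodule.smul_mem _ _ hm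
  | hx m hm =>
    induction hm using Submodule.span_induction with
    | mem z hz =>
      obtain ⟨p, rfl⟩ := hz
      refine Submodule.subset_span ⟨(p.1 + 1, p.2), ?_⟩
      simp [pow_succ', mul_assoc]
    | zero => simp
    | add m n _ _ hm hn => rw [mul_add]; exact Submodule.add_mem _ hm hn
    | smul r m _ hm => rw [mul_smul_comm]; exact Submodule.smul_mem _ _ hm
  | hy m hm =>
    induction hm using Submodule.span_induction with
    | mem z hz =>
      obtain ⟨p, rfl⟩ := hz
      dsimp only
      rw [← mul_assoc, y_mul_x_pow hq, smul_mul_assoc, mul_assoc, ← pow_succ']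
      exact Submodule.smul_mem _ _ (Submodule.subset_span ⟨(p.1, p.2 + 1), rfl⟩)
    | zero => simp
    | add m n _ _ hm hn => rw [mul_add]; exact Submodule.add_mem _ hm hn
    | smul r m _ hm => rw [mul_smul_comm]; exact Submodule.smul_mem _ _ hm

theorem linearMap_ext_mono (hq : q ≠ 0) {M : Type*} [AddCommMonoid M] [Module k M]
    {f g : Alg k a q →ₗ[k] M} (h : ∀ i j : ℕ, f (x a q ^ i * y a q ^ j) = g (x a q ^ i * y a q ^ j)) :
    f = g :=
  LinearMap.ext_on_range (span_mono hq) fun p => h p.1 p.2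

theorem x_pow_eq_zero {n : ℕ} (h : a ≤ n) : x a q ^ n = 0 := pow_eq_zero_of_le h (x_pow a q)

theorem y_pow_eq_zero {n : ℕ} (h : a ≤ n) : y a q ^ n = 0 := pow_eq_zero_of_le h (y_pow a q)

section

variable (ha : 0 < a) (hq : q ≠ 0)
include ha hq

/-- This is the linear independence of the monomials with exponents below a; `span_mono` supplies
the spanning. -/
theorem coef_mono (i j u v : ℕ) :
    coef a q (x a q ^ i * y a q ^ j) u v = if i = u ∧ j = v ∧ u < a ∧ v < a then 1 else 0 := by
  induction i generalizing u v with
  | zero =>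
    rw [pow_zero, one_mul]
    induction j generalizing u v with
    | zero =>
      rw [pow_zero, coef_one ha hq]
      exact if_congr (by omega) rfl rfl
    | succ j ih =>
      rw [pow_succ', coef_y_mul ha hq, opY_apply, ih]
      by_cases hu : u = 0
      · subst hu
        simp only [pow_zero, one_mul, true_and]
        split_ifs <;> first | rfl | omega
      · simp [Ne.symm hu]
  | succ i ih =>
    rw [pow_succ', mul_assoc, coef_x_mul ha hq, opX_apply, ih, ← ite_and]
    exact if_congr (by omega) rfl rfl

theorem coef_out {u v : ℕ} (h : a ≤ u ∨ a ≤ v) (m : Alg k a q) : coef a q m u v = 0 := by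
  have e : (LinearMap.proj v).comp ((LinearMap.proj u).comp (coef a q)) = 0 := by
    refine linearMap_ext_mono hq fun i j => ?_
    simp only [LinearMap.comp_apply, LinearMap.proj_apply, coef_mono ha hq, LinearMap.zero_apply]
    exact if_neg (by omega)
  exact LinearMap.congr_fun e m

theorem sum_coef (m : Alg k a q) :
    ∑ u ∈ Finset.range a, ∑ v ∈ Finset.range a, coef a q m u v • (x a q ^ u * y a q ^ v) = m := by
  have e : (∑ u ∈ Finset.range a, ∑ v ∈ Finset.range a,
      ((LinearMap.proj v).comp ((LinearMap.proj u).comp (coef a q))).smulRight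
        (x a q ^ u * y a q ^ v)) = LinearMap.id := by
    refine linearMap_ext_mono hq fun i j => ?_
    simp only [LinearMap.comp_apply, LinearMap.proj_apply, coef_mono ha hq, LinearMap.sum_apply,
      LinearMap.smulRight_apply, LinearMap.id_apply]
    by_cases hi : a ≤ i
    · rw [x_pow_eq_zero hi, zero_mul]
      refine Finset.sum_eq_zero fun u hu => Finset.sum_eq_zero fun v hv => ?_
      rw [Finset.mem_range] at hu
      rw [if_neg (by omega), zero_smul]
    by_cases hj : a ≤ j
    · rw [y_pow_eq_zero hj, mul_zero]
      refine Finset.sum_eq_zero fun u hu => Finset.sum_eq_zero fun v hv => ?_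
      rw [Finset.mem_range] at hv
      rw [if_neg (by omega), zero_smul]
    rw [Finset.sum_eq_single_of_mem i (by simp; omega), Finset.sum_eq_single_of_mem j (by simp; omega),
      if_pos (by omega), one_smul]
    · intro v _ hv
      rw [if_neg (by omega), zero_smul]
    · intro u _ hu
      refine Finset.sum_eq_zero fun v hv => ?_
      rw [if_neg (by omega), zero_smul]
  have := LinearMap.congr_fun e m
  simpa using this

theorem alg_ext {m n : Alg k a q} (h : ∀ u v, u < a → v < a → coef a q m u v = coef a q n u v) :
    m = n := by
  rw [← sum_coef ha hq m, ← sum_coef ha hq n]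
  refine Finset.sum_congr rfl fun u hu => Finset.sum_congr rfl fun v hv => ?_
  rw [h u v (by simpa using hu) (by simpa using hv)]

theorem coef_x_pow_mul (j : ℕ) (m : Alg k a q) (u v : ℕ) :
    coef a q (x a q ^ j * m) u v = if j ≤ u ∧ u < a then coef a q m (u - j) v else 0 := by
  induction j generalizing u with
  | zero =>
    simp only [pow_zero, one_mul, Nat.zero_le, true_and, Nat.sub_zero]
    split_ifs with h
    · rfl
    · exact coef_out ha hq (by omega) m
  | succ j ih =>
    rw [pow_succ', mul_assoc, coef_x_mul ha hq, opX_apply, ih, ← ite_and, Nat.sub_sub,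
      Nat.add_comm 1]
    exact if_congr (by omega) rfl rfl

theorem coef_y_pow_mul (j : ℕ) (m : Alg k a q) (u v : ℕ) :
    coef a q (y a q ^ j * m) u v =
      if j ≤ v ∧ v < a then q⁻¹ ^ (u * j) * coef a q m u (v - j) else 0 := by
  induction j generalizing v with
  | zero =>
    simp only [pow_zero, one_mul, Nat.zero_le, true_and, Nat.sub_zero, Nat.mul_zero]
    split_ifs with h
    · rfl
    · exact coef_out ha hq (by omega) m
  | succ j ih =>
    rw [pow_succ', mul_assoc, coef_y_mul ha hq, opY_apply, ih, Nat.sub_sub,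
      Nat.add_comm 1, mul_ite, mul_zero, ← ite_and, ← mul_assoc, ← pow_add, Nat.mul_succ,
      Nat.add_comm u]
    exact if_congr (by omega) rfl rfl

/-- Right multiplication commutes with left multiplications, so an induction over left factors
reduces everything to m = 1. The factor `q⁻¹ ^ v` comes from y^v x = q^(-v) x y^v. -/
theorem coef_mul_x (m : Alg k a q) (u v : ℕ) :
    coef a q (m * x a q) u v =
      if 1 ≤ u ∧ u < a then q⁻¹ ^ v * coef a q m (u - 1) v else 0 := by
  induction m using alg_induction generalizing u v with
  | h1 =>
    rw [one_mul, ← mul_one (x a q), coef_x_mul ha hq, opX_apply, coef_one ha hq]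
    by_cases hv : v = 0 <;> simp [hv]
  | hadd m n hm hn =>
    rw [add_mul, map_add, Pi.add_apply, Pi.add_apply, hm, hn, map_add]
    split_ifs <;> simp [mul_add]
  | hsmul r m hm =>
    rw [smul_mul_assoc, map_smul, Pi.smul_apply, Pi.smul_apply, hm, map_smul]
    split_ifs <;> simp [mul_left_comm]
  | hx m hm =>
    rw [mul_assoc, coef_x_mul ha hq, opX_apply, hm, coef_x_mul ha hq, opX_apply, mul_ite, mul_zero]
  | hy m hm =>
    rw [mul_assoc, coef_y_mul ha hq, opY_apply, hm, coef_y_mul ha hq, opY_apply]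
    obtain _ | u := u
    · simp
    obtain _ | v := v
    · simp
    simp only [Nat.add_sub_cancel, mul_ite, mul_zero, ← ite_and]
    exact if_congr (by omega) (by simp only [pow_succ]; ring) rfl

theorem coef_mul_y (m : Alg k a q) (u v : ℕ) :
    coef a q (m * y a q) u v = if 1 ≤ v ∧ v < a then coef a q m u (v - 1) else 0 := by
  induction m using alg_induction generalizing u v with
  | h1 =>
    rw [one_mul, ← mul_one (y a q), coef_y_mul ha hq, opY_apply, coef_one ha hq]
    by_cases hv : u = 0 <;> simp [hv]
  | hadd m n hm hn =>
    rw [add_mul, map_add, Pi.add_apply, Pi.add_apply, hm, hn, map_add]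
    split_ifs <;> simp
  | hsmul r m hm =>
    rw [smul_mul_assoc, map_smul, Pi.smul_apply, Pi.smul_apply, hm, map_smul]
    split_ifs <;> simp
  | hx m hm =>
    rw [mul_assoc, coef_x_mul ha hq, opX_apply, hm, coef_x_mul ha hq, opX_apply,
      ← ite_and, ← ite_and]
    exact if_congr (by omega) rfl rfl
  | hy m hm =>
    rw [mul_assoc, coef_y_mul ha hq, opY_apply, hm, coef_y_mul ha hq, opY_apply, mul_ite, mul_zero]

theorem coef_mul_x_pow (j : ℕ) (m : Alg k a q) (u v : ℕ) :
    coef a q (m * x a q ^ j) u v =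
      if j ≤ u ∧ u < a then q⁻¹ ^ (v * j) * coef a q m (u - j) v else 0 := by
  induction j generalizing u with
  | zero =>
    simp only [pow_zero, mul_one, Nat.zero_le, true_and, Nat.sub_zero, Nat.mul_zero, one_mul]
    split_ifs with h
    · rfl
    · exact coef_out ha hq (by omega) m
  | succ j ih =>
    rw [pow_succ, ← mul_assoc, coef_mul_x ha hq, ih, Nat.sub_sub,
      Nat.add_comm 1, mul_ite, mul_zero, ← ite_and, ← mul_assoc, ← pow_add, Nat.mul_succ,
      Nat.add_comm v]
    exact if_congr (by omega) rfl rfl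

theorem coef_mul_y_pow (j : ℕ) (m : Alg k a q) (u v : ℕ) :
    coef a q (m * y a q ^ j) u v = if j ≤ v ∧ v < a then coef a q m u (v - j) else 0 := by
  induction j generalizing v with
  | zero =>
    simp only [pow_zero, mul_one, Nat.zero_le, true_and, Nat.sub_zero]
    split_ifs with h
    · rfl
    · exact coef_out ha hq (by omega) m
  | succ j ih =>
    rw [pow_succ, ← mul_assoc, coef_mul_y ha hq, ih, ← ite_and, Nat.sub_sub,
      Nat.add_comm 1]
    exact if_congr (by omega) rfl rfl

end

end QCI

/-! ### Division by U - V for commuting U and V, and coefficient maps on A^e -/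

namespace QCI

section Coefficients

variable {k E : Type u} [Field k] [Ring E] [Algebra k E]

/-- The maps `c n` are the coefficients with respect to the powers `U ^ n`, `n < a`. -/
structure IsCoeff (a : ℕ) (U : E) (c : ℕ → E →ₗ[k] E) : Prop where
  sum (z : E) : ∑ n ∈ Finset.range a, c n z * U ^ n = z
  zero (z : E) : c 0 (z * U) = 0
  succ (n : ℕ) (z : E) (hn : n + 1 < a) : c (n + 1) (z * U) = c n z

variable {a : ℕ} {U V : E} {c : ℕ → E →ₗ[k] E}

/-- The substitution of `V` for `U`. -/
def evalCoeff (a : ℕ) (V : E) (c : ℕ → E →ₗ[k] E) (z : E) : E :=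
  ∑ n ∈ Finset.range a, c n z * V ^ n

/-- The quotient of `z - evalCoeff a V c z` by `U - V`. -/
def quotCoeff (a : ℕ) (U V : E) (c : ℕ → E →ₗ[k] E) (z : E) : E :=
  ∑ n ∈ Finset.range a, c n z * ∑ i ∈ Finset.range n, U ^ i * V ^ (n - 1 - i)

theorem IsCoeff.eval_add_quot (h : IsCoeff a U c) (hUV : Commute U V) (z : E) :
    z = evalCoeff a V c z + quotCoeff a U V c z * (U - V) := by
  conv_lhs => rw [← h.sum z]
  rw [evalCoeff, quotCoeff, Finset.sum_mul, ← Finset.sum_add_distrib]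
  refine Finset.sum_congr rfl fun n _ => ?_
  rw [mul_assoc, hUV.geom_sum₂_mul, mul_sub]
  abel

/-- After the index shift coming from U, the two sums differ only by the top term `c (a - 1) z * V ^
a`, which is zero. -/
theorem IsCoeff.eval_mul_left (h : IsCoeff a U c) (hV : ∀ n z, c n (z * V) = c n z * V)
    (hVa : V ^ a = 0) (z : E) : evalCoeff a V c (z * (U - V)) = 0 := by
  simp only [evalCoeff, mul_sub, map_sub, sub_mul, Finset.sum_sub_distrib]
  rw [sub_eq_zero]
  obtain _ | b := a
  · simp
  rw [Finset.sum_range_succ', h.zero, zero_mul, add_zero, Finset.sum_range_succ]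
  simp only [hV, mul_assoc, ← pow_succ']
  rw [hVa, mul_zero, add_zero]
  refine Finset.sum_congr rfl fun n hn => ?_
  rw [h.succ n z (by simpa using hn)]

theorem IsCoeff.apply_mul_pow (h : IsCoeff a U c) (z : E) (j : ℕ) :
    ∀ n, n + j < a → c (n + j) (z * U ^ j) = c n z := by
  induction j with
  | zero => simp
  | succ j ih =>
    intro n hn
    rw [pow_succ, ← mul_assoc, ← add_assoc, h.succ _ _ (by omega), ih n (by omega)]

theorem apply_mul_pow_of_commute (hV : ∀ n z, c n (z * V) = c n z * V) (n : ℕ) (z : E) (j : ℕ) :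
    c n (z * V ^ j) = c n z * V ^ j := by
  induction j with
  | zero => simp
  | succ j ih => rw [pow_succ, ← mul_assoc, hV, ih, mul_assoc]

/-- From zU = zV follows `c n z = c (n + 1) z * V`, so all coefficients are determined by the top
one and assemble to the geometric sum. -/
theorem IsCoeff.exact_sub (h : IsCoeff a U c)
    (hV : ∀ n z, c n (z * V) = c n z * V) {z : E} (hz : z * (U - V) = 0) :
    z = c (a - 1) z * ∑ j ∈ Finset.range a, V ^ j * U ^ (a - 1 - j) := by
  rw [mul_sub, sub_eq_zero] at hz
  have key : ∀ j n, n + j + 1 = a → c n z = c (a - 1) z * V ^ j := by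
    intro j
    induction j with
    | zero => intro n hn; simp [← hn]
    | succ j ih =>
      intro n hn
      rw [← h.succ n z (by omega), hz, hV, ih (n + 1) (by omega), mul_assoc, ← pow_succ]
  conv_lhs => rw [← h.sum z]
  rw [← Finset.sum_range_reflect, Finset.mul_sum]
  refine Finset.sum_congr rfl fun n hn => ?_
  rw [key n _ (by simp at hn; omega), mul_assoc]

/-- The coefficient of U^(a-1) in the product of z with the geometric sum is exactly the value of z
at V. -/
theorem IsCoeff.eval_eq_zero (h : IsCoeff a U c) (hUV : Commute U V)
    (hV : ∀ n z, c n (z * V) = c n z * V) {z : E}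
    (hz : z * ∑ j ∈ Finset.range a, V ^ j * U ^ (a - 1 - j) = 0) : evalCoeff a V c z = 0 := by
  have e := congrArg (c (a - 1)) hz
  rw [map_zero, Finset.mul_sum, map_sum] at e
  rw [← e, evalCoeff]
  refine Finset.sum_congr rfl fun n hn => ?_
  rw [Finset.mem_range] at hn
  rw [← (hUV.symm.pow_pow n _).eq.symm, ← mul_assoc, apply_mul_pow_of_commute hV]
  conv_rhs => rw [show a - 1 = n + (a - 1 - n) by omega]
  rw [show n + (a - 1 - n) - n = a - 1 - n by omega, h.apply_mul_pow _ _ _ (by omega)]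

theorem IsCoeff.exact_geom (h : IsCoeff a U c) (hUV : Commute U V)
    (hV : ∀ n z, c n (z * V) = c n z * V) {z : E}
    (hz : z * ∑ j ∈ Finset.range a, V ^ j * U ^ (a - 1 - j) = 0) :
    z = quotCoeff a U V c z * (U - V) := by
  conv_lhs => rw [h.eval_add_quot hUV z, h.eval_eq_zero hUV hV hz, zero_add]

end Coefficients

variable {k : Type u} [Field k] {a : ℕ} {q : k}

variable (a q) in
/-- The coefficients of the powers of `y` on the left. -/
def coeffY (n : ℕ) : Alg k a q →ₗ[k] Alg k a q :=
  ∑ u ∈ Finset.range a,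
    ((LinearMap.proj n).comp ((LinearMap.proj u).comp (coef a q))).smulRight
      -- The power of q comes from x^u y^n = q^(un) y^n x^u.
      (q ^ (u * n) • x a q ^ u)

variable (a q) in
/-- The coefficients of the powers of `x` on the left. -/
def coeffX (n : ℕ) : Alg k a q →ₗ[k] Alg k a q :=
  ∑ v ∈ Finset.range a,
    ((LinearMap.proj v).comp ((LinearMap.proj n).comp (coef a q))).smulRight (y a q ^ v)

section

variable (ha : 0 < a) (hq : q ≠ 0)
include ha hq

theorem coeffY_mono (n i j : ℕ) :
    coeffY a q n (x a q ^ i * y a q ^ j) = if j = n ∧ n < a then q ^ (i * n) • x a q ^ i else 0 := by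
  simp only [coeffY, LinearMap.sum_apply, LinearMap.smulRight_apply, LinearMap.comp_apply,
    LinearMap.proj_apply, coef_mono ha hq]
  by_cases hi : a ≤ i
  · rw [x_pow_eq_zero hi, smul_zero, ite_self]
    refine Finset.sum_eq_zero fun u hu => ?_
    rw [Finset.mem_range] at hu
    rw [if_neg (by omega), zero_smul]
  · rw [Finset.sum_eq_single_of_mem i (by simp; omega)]
    · simp only [ite_smul, one_smul, zero_smul, true_and]
      exact if_congr (by omega) rfl rfl
    · intro u _ hu
      rw [if_neg (by omega), zero_smul]

theorem coeffX_mono (n i j : ℕ) :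
    coeffX a q n (x a q ^ i * y a q ^ j) = if i = n ∧ n < a then y a q ^ j else 0 := by
  simp only [coeffX, LinearMap.sum_apply, LinearMap.smulRight_apply, LinearMap.comp_apply,
    LinearMap.proj_apply, coef_mono ha hq]
  by_cases hj : a ≤ j
  · rw [y_pow_eq_zero hj, ite_self]
    refine Finset.sum_eq_zero fun v hv => ?_
    rw [Finset.mem_range] at hv
    rw [if_neg (by omega), zero_smul]
  · rw [Finset.sum_eq_single_of_mem j (by simp; omega)]
    · simp only [ite_smul, one_smul, zero_smul, true_and]
      exact if_congr (by omega) rfl rfl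
    · intro u _ hu
      rw [if_neg (by omega), zero_smul]

theorem sum_coeffY (m : Alg k a q) :
    ∑ n ∈ Finset.range a, y a q ^ n * coeffY a q n m = m := by
  have e : (∑ n ∈ Finset.range a, (LinearMap.mulLeft k (y a q ^ n)).comp (coeffY a q n))
      = LinearMap.id := by
    refine linearMap_ext_mono hq fun i j => ?_
    simp only [LinearMap.sum_apply, LinearMap.comp_apply, coeffY_mono ha hq, LinearMap.id_apply,
      LinearMap.mulLeft_apply]
    by_cases hj : a ≤ j
    · rw [y_pow_eq_zero hj, mul_zero]
      refine Finset.sum_eq_zero fun v hv => ?_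
      rw [Finset.mem_range] at hv
      rw [if_neg (by omega), mul_zero]
    · rw [Finset.sum_eq_single_of_mem j (by simp; omega)]
      · rw [if_pos (by omega), mul_smul_comm, y_pow_mul_x_pow hq, smul_smul, ← mul_pow,
          mul_inv_cancel₀ hq, one_pow, one_smul]
      · intro u _ hu
        rw [if_neg (by omega), mul_zero]
  simpa using LinearMap.congr_fun e m

theorem sum_coeffX (m : Alg k a q) :
    ∑ n ∈ Finset.range a, x a q ^ n * coeffX a q n m = m := by
  have e : (∑ n ∈ Finset.range a, (LinearMap.mulLeft k (x a q ^ n)).comp (coeffX a q n))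
      = LinearMap.id := by
    refine linearMap_ext_mono hq fun i j => ?_
    simp only [LinearMap.sum_apply, LinearMap.comp_apply, coeffX_mono ha hq, LinearMap.id_apply,
      LinearMap.mulLeft_apply]
    by_cases hi : a ≤ i
    · rw [x_pow_eq_zero hi, zero_mul]
      refine Finset.sum_eq_zero fun v hv => ?_
      rw [Finset.mem_range] at hv
      rw [if_neg (by omega), mul_zero]
    · rw [Finset.sum_eq_single_of_mem i (by simp; omega)]
      · rw [if_pos (by omega)]
      · intro u _ hu
        rw [if_neg (by omega), mul_zero]
  simpa using LinearMap.congr_fun e m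

theorem coeffY_y_mul_zero (m : Alg k a q) : coeffY a q 0 (y a q * m) = 0 := by
  have e : (coeffY a q 0).comp (LinearMap.mulLeft k (y a q)) = 0 := by
    refine linearMap_ext_mono hq fun i j => ?_
    simp only [LinearMap.comp_apply, LinearMap.mulLeft_apply, LinearMap.zero_apply]
    rw [← mul_assoc, y_mul_x_pow hq, smul_mul_assoc, mul_assoc, ← pow_succ', map_smul,
      coeffY_mono ha hq, if_neg (by omega), smul_zero]
  exact LinearMap.congr_fun e m

theorem coeffY_y_mul_succ (n : ℕ) (hn : n + 1 < a) (m : Alg k a q) :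
    coeffY a q (n + 1) (y a q * m) = coeffY a q n m := by
  have e : (coeffY a q (n + 1)).comp (LinearMap.mulLeft k (y a q)) = coeffY a q n := by
    refine linearMap_ext_mono hq fun i j => ?_
    simp only [LinearMap.comp_apply, LinearMap.mulLeft_apply]
    rw [← mul_assoc, y_mul_x_pow hq, smul_mul_assoc, mul_assoc, ← pow_succ', map_smul,
      coeffY_mono ha hq, coeffY_mono ha hq, smul_ite, smul_zero]
    refine if_congr (by omega) ?_ rfl
    rw [smul_smul, Nat.mul_succ, pow_add, mul_comm (q ^ _), ← mul_assoc, ← mul_pow,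
      inv_mul_cancel₀ hq, one_pow, one_mul]
  exact LinearMap.congr_fun e m

theorem coeffX_x_mul_zero (m : Alg k a q) : coeffX a q 0 (x a q * m) = 0 := by
  have e : (coeffX a q 0).comp (LinearMap.mulLeft k (x a q)) = 0 := by
    refine linearMap_ext_mono hq fun i j => ?_
    simp only [LinearMap.comp_apply, LinearMap.mulLeft_apply, LinearMap.zero_apply]
    rw [← mul_assoc, ← pow_succ', coeffX_mono ha hq, if_neg (by omega)]
  exact LinearMap.congr_fun e m

theorem coeffX_x_mul_succ (n : ℕ) (hn : n + 1 < a) (m : Alg k a q) :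
    coeffX a q (n + 1) (x a q * m) = coeffX a q n m := by
  have e : (coeffX a q (n + 1)).comp (LinearMap.mulLeft k (x a q)) = coeffX a q n := by
    refine linearMap_ext_mono hq fun i j => ?_
    simp only [LinearMap.comp_apply, LinearMap.mulLeft_apply]
    rw [← mul_assoc, ← pow_succ', coeffX_mono ha hq, coeffX_mono ha hq]
    exact if_congr (by omega) rfl rfl
  exact LinearMap.congr_fun e m

theorem coeffY_x_mul (n : ℕ) (m : Alg k a q) :
    coeffY a q n (x a q * m) = q ^ n • (x a q * coeffY a q n m) := by
  have e : (coeffY a q n).comp (LinearMap.mulLeft k (x a q))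
      = q ^ n • (LinearMap.mulLeft k (x a q)).comp (coeffY a q n) := by
    refine linearMap_ext_mono hq fun i j => ?_
    simp only [LinearMap.comp_apply, LinearMap.mulLeft_apply, LinearMap.smul_apply]
    rw [← mul_assoc, ← pow_succ', coeffY_mono ha hq, coeffY_mono ha hq, mul_ite, mul_zero,
      smul_ite, smul_zero]
    refine if_congr (by omega) ?_ rfl
    rw [mul_smul_comm, smul_smul, ← pow_succ', Nat.succ_mul, pow_add, mul_comm]
  exact LinearMap.congr_fun e m

theorem coeffY_coeffY (n m : ℕ) (hn : n ≠ 0) (b : Alg k a q) :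
    coeffY a q n (coeffY a q m b) = 0 := by
  have e : (coeffY a q n).comp (coeffY a q m) = 0 := by
    refine linearMap_ext_mono hq fun i j => ?_
    simp only [LinearMap.comp_apply, LinearMap.zero_apply]
    rw [coeffY_mono ha hq]
    split_ifs
    · rw [map_smul, ← mul_one (x a q ^ i), ← pow_zero (y a q), coeffY_mono ha hq,
        if_neg (by omega), smul_zero]
    · rw [map_zero]
  exact LinearMap.congr_fun e b

end

/-- The endomorphism of the enveloping algebra induced by a linear map of the right factor. -/
def rmap (f : Alg k a q →ₗ[k] Alg k a q) : Env k a q →ₗ[k] Env k a q :=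
  TensorProduct.map LinearMap.id
    ((MulOpposite.opLinearEquiv k).toLinearMap ∘ₗ f ∘ₗ (MulOpposite.opLinearEquiv k).symm.toLinearMap)

theorem rmap_tmul (f : Alg k a q →ₗ[k] Alg k a q) (b c : Alg k a q) :
    rmap f (tmul b c) = tmul b (f c) := rfl

theorem env_ext {M : Type*} [AddCommMonoid M] [Module k M] {f g : Env k a q →ₗ[k] M}
    (h : ∀ b c, f (tmul b c) = g (tmul b c)) : f = g :=
  TensorProduct.ext' fun b c => h b c.unop

theorem rmap_mul_left (f : Alg k a q →ₗ[k] Alg k a q) (b : Alg k a q) (z : Env k a q) :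
    rmap f (z * tmul b 1) = rmap f z * tmul b 1 := by
  have e : (rmap f).comp (LinearMap.mulRight k (tmul b 1))
      = (LinearMap.mulRight k (tmul b 1)).comp (rmap f) :=
    env_ext fun b' c => by simp [rmap_tmul, tmul_mul_tmul]
  exact LinearMap.congr_fun e z

/-- Because the second factor is opposite, right multiplication by 1 ⊗ y multiplies it by y on the
left. This is why `coeffY` expands with the powers of y on the left. -/
theorem isCoeff_y (ha : 0 < a) (hq : q ≠ 0) :
    IsCoeff a (tmul 1 (y a q)) fun n => rmap (coeffY a q n) where
  sum z := by
    have e : (∑ n ∈ Finset.range a, (LinearMap.mulRight k (tmul 1 (y a q) ^ n)).comp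
        (rmap (coeffY a q n))) = LinearMap.id := env_ext fun b c => by
      simp only [LinearMap.sum_apply, LinearMap.comp_apply, LinearMap.mulRight_apply, rmap_tmul,
        tmul_pow, tmul_mul_tmul, one_pow, mul_one, LinearMap.id_apply]
      conv_rhs => rw [← sum_coeffY ha hq c]
      exact (map_sum ((TensorProduct.mk k _ _ b).comp (MulOpposite.opLinearEquiv k).toLinearMap)
        _ _).symm
    simpa using LinearMap.congr_fun e z
  zero z := by
    have e : (rmap (coeffY a q 0)).comp (LinearMap.mulRight k (tmul 1 (y a q))) = 0 :=
      env_ext fun b c => by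
        simp [rmap_tmul, tmul_mul_tmul, coeffY_y_mul_zero ha hq, tmul_zero_right]
    exact LinearMap.congr_fun e z
  succ n z hn := by
    have e : (rmap (coeffY a q (n + 1))).comp (LinearMap.mulRight k (tmul 1 (y a q)))
        = rmap (coeffY a q n) :=
      env_ext fun b c => by
        simp [rmap_tmul, tmul_mul_tmul, coeffY_y_mul_succ ha hq n hn]
    exact LinearMap.congr_fun e z

theorem isCoeff_x (ha : 0 < a) (hq : q ≠ 0) :
    IsCoeff a (tmul 1 (x a q)) fun n => rmap (coeffX a q n) where
  sum z := by
    have e : (∑ n ∈ Finset.range a, (LinearMap.mulRight k (tmul 1 (x a q) ^ n)).comp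
        (rmap (coeffX a q n))) = LinearMap.id := env_ext fun b c => by
      simp only [LinearMap.sum_apply, LinearMap.comp_apply, LinearMap.mulRight_apply, rmap_tmul,
        tmul_pow, tmul_mul_tmul, one_pow, mul_one, LinearMap.id_apply]
      conv_rhs => rw [← sum_coeffX ha hq c]
      exact (map_sum ((TensorProduct.mk k _ _ b).comp (MulOpposite.opLinearEquiv k).toLinearMap)
        _ _).symm
    simpa using LinearMap.congr_fun e z
  zero z := by
    have e : (rmap (coeffX a q 0)).comp (LinearMap.mulRight k (tmul 1 (x a q))) = 0 :=
      env_ext fun b c => by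
        simp [rmap_tmul, tmul_mul_tmul, coeffX_x_mul_zero ha hq, tmul_zero_right]
    exact LinearMap.congr_fun e z
  succ n z hn := by
    have e : (rmap (coeffX a q (n + 1))).comp (LinearMap.mulRight k (tmul 1 (x a q)))
        = rmap (coeffX a q n) :=
      env_ext fun b c => by
        simp [rmap_tmul, tmul_mul_tmul, coeffX_x_mul_succ ha hq n hn]
    exact LinearMap.congr_fun e z

end QCI

/-! ### The degree filtration and exactness of single rows and columns -/

namespace QCI

variable {k : Type u} [Field k] {a : ℕ} {q : k}

variable (a q) in
/-- The decreasing filtration of the enveloping algebra by total degree. -/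
def Fil (e : ℤ) : Submodule k (Env k a q) :=
  Submodule.span k {z | ∃ i j l m : ℕ, e ≤ i + j + l + m ∧
    z = tmul (x a q ^ i * y a q ^ j) (x a q ^ l * y a q ^ m)}

theorem mono_mem_Fil {e : ℤ} {i j l m : ℕ} (h : e ≤ i + j + l + m) :
    tmul (x a q ^ i * y a q ^ j) (x a q ^ l * y a q ^ m) ∈ Fil a q e :=
  Submodule.subset_span ⟨i, j, l, m, h, rfl⟩

theorem Fil_mono {e e' : ℤ} (h : e' ≤ e) : Fil a q e ≤ Fil a q e' :=
  Submodule.span_mono fun _ ⟨i, j, l, m, h', hz⟩ => ⟨i, j, l, m, h.trans h', hz⟩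

theorem mono_mul_mono (hq : q ≠ 0) (i j i' j' : ℕ) :
    (x a q ^ i * y a q ^ j) * (x a q ^ i' * y a q ^ j')
      = q⁻¹ ^ (i' * j) • (x a q ^ (i + i') * y a q ^ (j + j')) := by
  rw [mul_assoc, ← mul_assoc (y a q ^ j), y_pow_mul_x_pow hq, smul_mul_assoc, mul_smul_comm,
    pow_add, pow_add]
  simp only [mul_assoc]

theorem mul_mem_Fil (hq : q ≠ 0) {e e' : ℤ} {z w : Env k a q} (hz : z ∈ Fil a q e)
    (hw : w ∈ Fil a q e') : z * w ∈ Fil a q (e + e') := by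
  induction hz using Submodule.span_induction with
  | mem z hz =>
    obtain ⟨i, j, l, m, h, rfl⟩ := hz
    induction hw using Submodule.span_induction with
    | mem w hw =>
      obtain ⟨i', j', l', m', h', rfl⟩ := hw
      rw [tmul_mul_tmul, mono_mul_mono hq, mono_mul_mono hq, smul_tmul_left, smul_tmul_right]
      exact Submodule.smul_mem _ _ (Submodule.smul_mem _ _ (mono_mem_Fil (by push_cast; omega)))
    | zero => simp
    | add _ _ _ _ h1 h2 => rw [mul_add]; exact Submodule.add_mem _ h1 h2
    | smul r _ _ h1 => rw [mul_smul_comm]; exact Submodule.smul_mem _ _ h1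
  | zero => simp
  | add _ _ _ _ h1 h2 => rw [add_mul]; exact Submodule.add_mem _ h1 h2
  | smul r _ _ h1 => rw [smul_mul_assoc]; exact Submodule.smul_mem _ _ h1

theorem mul_mem_Fil' (hq : q ≠ 0) {e e' e'' : ℤ} {z w : Env k a q} (hz : z ∈ Fil a q e)
    (hw : w ∈ Fil a q e') (h : e'' ≤ e + e') : z * w ∈ Fil a q e'' :=
  Fil_mono h (mul_mem_Fil hq hz hw)

theorem one_mem_Fil : (1 : Env k a q) ∈ Fil a q 0 := by
  simpa [tmul_one_one] using mono_mem_Fil (a := a) (q := q) (e := 0) (i := 0) (j := 0) (l := 0)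
    (m := 0) (by simp)

theorem x_left_mem_Fil : tmul (x a q) 1 ∈ Fil a q 1 := by
  simpa using mono_mem_Fil (a := a) (q := q) (e := 1) (i := 1) (j := 0) (l := 0) (m := 0) (by simp)

theorem y_left_mem_Fil : tmul (y a q) 1 ∈ Fil a q 1 := by
  simpa using mono_mem_Fil (a := a) (q := q) (e := 1) (i := 0) (j := 1) (l := 0) (m := 0) (by simp)

theorem x_right_mem_Fil : tmul 1 (x a q) ∈ Fil a q 1 := by
  simpa using mono_mem_Fil (a := a) (q := q) (e := 1) (i := 0) (j := 0) (l := 1) (m := 0) (by simp)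

theorem y_right_mem_Fil : tmul 1 (y a q) ∈ Fil a q 1 := by
  simpa using mono_mem_Fil (a := a) (q := q) (e := 1) (i := 0) (j := 0) (l := 0) (m := 1) (by simp)

theorem pow_mem_Fil (hq : q ≠ 0) {z : Env k a q} (hz : z ∈ Fil a q 1) (n : ℕ) :
    z ^ n ∈ Fil a q n := by
  induction n with
  | zero => simpa using one_mem_Fil
  | succ n ih => rw [pow_succ]; exact mul_mem_Fil' hq ih hz (by push_cast; omega)

theorem coeffY_mem_Fil (ha : 0 < a) (hq : q ≠ 0) {e : ℤ} {z : Env k a q} (hz : z ∈ Fil a q e)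
    (n : ℕ) : rmap (coeffY a q n) z ∈ Fil a q (e - n) := by
  induction hz using Submodule.span_induction with
  | mem z hz =>
    obtain ⟨i, j, l, m, h, rfl⟩ := hz
    rw [rmap_tmul, coeffY_mono ha hq]
    split_ifs
    · rw [smul_tmul_right, ← mul_one (x a q ^ l), ← pow_zero (y a q)]
      exact Submodule.smul_mem _ _ (mono_mem_Fil (by push_cast; omega))
    · rw [tmul_zero_right]; exact Submodule.zero_mem _
  | zero => simp
  | add _ _ _ _ h1 h2 => rw [map_add]; exact Submodule.add_mem _ h1 h2
  | smul r _ _ h1 => rw [map_smul]; exact Submodule.smul_mem _ _ h1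

theorem coeffX_mem_Fil (ha : 0 < a) (hq : q ≠ 0) {e : ℤ} {z : Env k a q} (hz : z ∈ Fil a q e)
    (n : ℕ) : rmap (coeffX a q n) z ∈ Fil a q (e - n) := by
  induction hz using Submodule.span_induction with
  | mem z hz =>
    obtain ⟨i, j, l, m, h, rfl⟩ := hz
    rw [rmap_tmul, coeffX_mono ha hq]
    split_ifs
    · rw [← one_mul (y a q ^ m), ← pow_zero (x a q)]
      exact mono_mem_Fil (by push_cast; omega)
    · rw [tmul_zero_right]; exact Submodule.zero_mem _
  | zero => simp
  | add _ _ _ _ h1 h2 => rw [map_add]; exact Submodule.add_mem _ h1 h2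
  | smul r _ _ h1 => rw [map_smul]; exact Submodule.smul_mem _ _ h1

theorem evalCoeff_mem_Fil (hq : q ≠ 0) {V z : Env k a q} {c : ℕ → Env k a q →ₗ[k] Env k a q}
    {e : ℤ} (hc : ∀ n : ℕ, c n z ∈ Fil a q (e - n)) (hV : V ∈ Fil a q 1) :
    evalCoeff a V c z ∈ Fil a q e :=
  Submodule.sum_mem _ fun n _ => mul_mem_Fil' hq (hc n) (pow_mem_Fil hq hV n) (by omega)

/-- The coefficient `c n z` loses n degrees and the inner sum restores n - 1 of them; for n = 0 that
sum is empty. -/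
theorem quotCoeff_mem_Fil (hq : q ≠ 0) {U V z : Env k a q} {c : ℕ → Env k a q →ₗ[k] Env k a q}
    {e : ℤ} (hc : ∀ n : ℕ, c n z ∈ Fil a q (e - n)) (hU : U ∈ Fil a q 1) (hV : V ∈ Fil a q 1) :
    quotCoeff a U V c z ∈ Fil a q (e - 1) := by
  refine Submodule.sum_mem _ fun n _ => mul_mem_Fil' hq (e' := n - 1) (hc n) ?_ (by omega)
  refine Submodule.sum_mem _ fun i hi => ?_
  rw [Finset.mem_range] at hi
  exact mul_mem_Fil' hq (pow_mem_Fil hq hU i) (pow_mem_Fil hq hV _) (by omega)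

theorem gamma₂_eq_geom (s : ℕ) :
    gamma₂ a q s = ∑ j ∈ Finset.range a,
      (q ^ s • tmul (y a q) 1) ^ j * tmul 1 (y a q) ^ (a - 1 - j) := by
  rw [gamma₂_eq]
  refine Finset.sum_congr rfl fun j _ => ?_
  rw [smul_pow, smul_mul_assoc, ← pow_mul, mul_comm j]

theorem tau₁_eq_sub (hq : q ≠ 0) (s : ℕ) :
    tau₁ a q s = q ^ s • (tmul 1 (x a q) - (q⁻¹ ^ s) • tmul (x a q) 1) := by
  rw [tau₁, smul_sub, smul_smul, ← mul_pow, mul_inv_cancel₀ hq, one_pow, one_smul]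

/-- In τ₁ and γ₁ the power of q stands at 1 ⊗ x. Extracting a unit moves it to x ⊗ 1, and reversing
the sum gives the form required by the division lemmas. -/
theorem gamma₁_eq_geom (hq : q ≠ 0) (s : ℕ) :
    gamma₁ a q s = q ^ (s * (a - 1)) • ∑ j ∈ Finset.range a,
      (q⁻¹ ^ s • tmul (x a q) 1) ^ j * tmul 1 (x a q) ^ (a - 1 - j) := by
  rw [gamma₁_eq, Finset.smul_sum]
  conv_lhs => rw [← Finset.sum_range_reflect]
  refine Finset.sum_congr rfl fun j hj => ?_
  rw [Finset.mem_range] at hj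
  obtain ⟨l, hl⟩ : ∃ l, a - 1 = j + l := ⟨a - 1 - j, by omega⟩
  rw [hl, smul_pow, smul_mul_assoc, smul_smul, Nat.add_sub_cancel_left, Nat.add_sub_cancel, mul_add,
    pow_add, ← pow_mul, mul_comm l, mul_comm (q ^ (s * j)), mul_assoc, ← mul_pow,
    mul_inv_cancel₀ hq, one_pow, mul_one]

theorem commute_y (r : k) : Commute (tmul 1 (y a q)) (r • tmul (y a q) 1) :=
  ((commute_tmul a q _ _).smul_left r).symm

theorem commute_x (r : k) : Commute (tmul 1 (x a q)) (r • tmul (x a q) 1) :=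
  ((commute_tmul a q _ _).smul_left r).symm

section

variable (ha : 0 < a) (hq : q ≠ 0)
include ha hq

/-- The cofactor is the top coefficient of z, so it loses exactly the degree a - 1 of γ₂(s). These
bounds are what later keeps the degrees of chain lifts under control. -/
theorem exact_tau₂ {e : ℤ} {z : Env k a q} (hz : z ∈ Fil a q e) (s : ℕ) (h : z * tau₂ a q s = 0) :
    ∃ w ∈ Fil a q (e - (a - 1)), z = w * gamma₂ a q s := by
  refine ⟨rmap (coeffY a q (a - 1)) z, ?_, ?_⟩
  · have := coeffY_mem_Fil ha hq hz (a - 1)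
    rwa [Nat.cast_sub ha, Nat.cast_one] at this
  · rw [gamma₂_eq_geom]
    exact (isCoeff_y ha hq).exact_sub (fun n z => by
      rw [mul_smul_comm, map_smul, rmap_mul_left, mul_smul_comm]) h

theorem exact_gamma₂ {e : ℤ} {z : Env k a q} (hz : z ∈ Fil a q e) (s : ℕ)
    (h : z * gamma₂ a q s = 0) : ∃ w ∈ Fil a q (e - 1), z = w * tau₂ a q s := by
  rw [gamma₂_eq_geom] at h
  exact ⟨_, quotCoeff_mem_Fil hq (coeffY_mem_Fil ha hq hz) y_right_mem_Fil
    (Submodule.smul_mem _ _ y_left_mem_Fil),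
    (isCoeff_y ha hq).exact_geom (commute_y _) (fun n z => by
      rw [mul_smul_comm, map_smul, rmap_mul_left, mul_smul_comm]) h⟩

theorem exact_tau₁ {e : ℤ} {z : Env k a q} (hz : z ∈ Fil a q e) (s : ℕ) (h : z * tau₁ a q s = 0) :
    ∃ w ∈ Fil a q (e - (a - 1)), z = w * gamma₁ a q s := by
  rw [tau₁_eq_sub hq, mul_smul_comm, smul_eq_zero_iff_right (pow_ne_zero _ hq)] at h
  refine ⟨(q ^ (s * (a - 1)))⁻¹ • rmap (coeffX a q (a - 1)) z, Submodule.smul_mem _ _ ?_, ?_⟩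
  · have := coeffX_mem_Fil ha hq hz (a - 1)
    rwa [Nat.cast_sub ha, Nat.cast_one] at this
  · rw [gamma₁_eq_geom hq, mul_smul_comm, smul_mul_assoc, smul_smul,
      mul_inv_cancel₀ (pow_ne_zero _ hq), one_smul]
    exact (isCoeff_x ha hq).exact_sub (fun n z => by
      rw [mul_smul_comm, map_smul, rmap_mul_left, mul_smul_comm]) h

theorem exact_gamma₁ {e : ℤ} {z : Env k a q} (hz : z ∈ Fil a q e) (s : ℕ)
    (h : z * gamma₁ a q s = 0) : ∃ w ∈ Fil a q (e - 1), z = w * tau₁ a q s := by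
  rw [gamma₁_eq_geom hq, mul_smul_comm, smul_eq_zero_iff_right (pow_ne_zero _ hq)] at h
  refine ⟨(q ^ s)⁻¹ • quotCoeff a (tmul 1 (x a q)) (q⁻¹ ^ s • tmul (x a q) 1)
    (fun n => rmap (coeffX a q n)) z, Submodule.smul_mem _ _ ?_, ?_⟩
  · exact quotCoeff_mem_Fil hq (coeffX_mem_Fil ha hq hz) x_right_mem_Fil
      (Submodule.smul_mem _ _ x_left_mem_Fil)
  · rw [tau₁_eq_sub hq, mul_smul_comm, smul_mul_assoc, smul_smul,
      mul_inv_cancel₀ (pow_ne_zero _ hq), one_smul]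
    exact (isCoeff_x ha hq).exact_geom (commute_x _) (fun n z => by
      rw [mul_smul_comm, map_smul, rmap_mul_left, mul_smul_comm]) h

end

variable (a q) in
/-- The subspace `A ⊗ k[x]` of the enveloping algebra. -/
def noY : Submodule k (Env k a q) := ⨅ n ∈ {n : ℕ | n ≠ 0}, LinearMap.ker (rmap (coeffY a q n))

theorem mem_noY {z : Env k a q} : z ∈ noY a q ↔ ∀ n ≠ 0, rmap (coeffY a q n) z = 0 := by
  simp [noY]

theorem noY_mul_x_left {z : Env k a q} (hz : z ∈ noY a q) : z * tmul (x a q) 1 ∈ noY a q := by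
  rw [mem_noY] at hz ⊢
  intro n hn
  rw [rmap_mul_left, hz n hn, zero_mul]

theorem noY_mul_pow {z w : Env k a q} (hz : z ∈ noY a q)
    (hw : ∀ z ∈ noY a q, z * w ∈ noY a q) (n : ℕ) : z * w ^ n ∈ noY a q := by
  induction n with
  | zero => simpa using hz
  | succ n ih => rw [pow_succ, ← mul_assoc]; exact hw _ ih

section

variable (ha : 0 < a) (hq : q ≠ 0)
include ha hq

theorem noY_mul_x_right {z : Env k a q} (hz : z ∈ noY a q) : z * tmul 1 (x a q) ∈ noY a q := by
  rw [mem_noY] at hz ⊢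
  intro n hn
  have e : (rmap (coeffY a q n)).comp (LinearMap.mulRight k (tmul 1 (x a q)))
      = q ^ n • (LinearMap.mulRight k (tmul 1 (x a q))).comp (rmap (coeffY a q n)) :=
    env_ext fun b c => by
      simp [rmap_tmul, tmul_mul_tmul, coeffY_x_mul ha hq, smul_tmul_right]
  have := LinearMap.congr_fun e z
  simpa [hz n hn] using this

theorem noY_mul_tau₁ {z : Env k a q} (hz : z ∈ noY a q) (s : ℕ) : z * tau₁ a q s ∈ noY a q := by
  rw [tau₁, mul_sub, mul_smul_comm]
  exact Submodule.sub_mem _ (Submodule.smul_mem _ _ (noY_mul_x_right ha hq hz))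
    (noY_mul_x_left hz)

theorem noY_mul_gamma₁ {z : Env k a q} (hz : z ∈ noY a q) (s : ℕ) :
    z * gamma₁ a q s ∈ noY a q := by
  rw [gamma₁_eq, Finset.mul_sum]
  refine Submodule.sum_mem _ fun j _ => ?_
  rw [mul_smul_comm, ← mul_assoc]
  exact Submodule.smul_mem _ _ (noY_mul_pow (noY_mul_pow hz
    (fun z hz => noY_mul_x_left hz) _) (fun z hz => noY_mul_x_right ha hq hz) _)

/-- The coefficients lie in A ⊗ k[x], and right multiplication by y ⊗ 1 changes only the left
factor. -/
theorem evalCoeff_mem_noY (r : k) (z : Env k a q) :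
    evalCoeff a (r • tmul (y a q) 1) (fun n => rmap (coeffY a q n)) z ∈ noY a q := by
  refine Submodule.sum_mem _ fun m _ => mem_noY.2 fun n hn => ?_
  have e : (rmap (coeffY a q n)).comp (rmap (coeffY a q m)) = 0 :=
    env_ext fun b c => by simp [rmap_tmul, coeffY_coeffY ha hq n m hn, tmul_zero_right]
  have e' := LinearMap.congr_fun e z
  simp only [LinearMap.comp_apply, LinearMap.zero_apply] at e'
  rw [smul_pow, mul_smul_comm, map_smul, tmul_pow, one_pow, rmap_mul_left, e', zero_mul, smul_zero]

theorem evalCoeff_of_mem_noY {z : Env k a q} (hz : z ∈ noY a q) (V : Env k a q) :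
    evalCoeff a V (fun n => rmap (coeffY a q n)) z = z := by
  rw [mem_noY] at hz
  conv_rhs => rw [← (isCoeff_y ha hq).sum z]
  rw [evalCoeff]
  refine Finset.sum_congr rfl fun n _ => ?_
  obtain _ | n := n
  · simp
  · rw [hz _ (by omega), zero_mul, zero_mul]

/-- Substituting q^s (y ⊗ 1) for 1 ⊗ y fixes A ⊗ k[x] and kills the right multiples of τ₂(s). With
`exists_noY`, the two subspaces are complementary. -/
theorem eq_zero_of_mem_noY {z w : Env k a q} (hz : z ∈ noY a q) {s : ℕ}
    (h : z = w * tau₂ a q s) : z = 0 := by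
  rw [← evalCoeff_of_mem_noY ha hq hz (q ^ s • tmul (y a q) 1), h]
  refine (isCoeff_y ha hq).eval_mul_left (fun n z => by
      rw [mul_smul_comm, map_smul, rmap_mul_left, mul_smul_comm]) ?_ w
  rw [smul_pow, tmul_pow, y_pow, tmul_zero_left, smul_zero]

theorem exists_noY {e : ℤ} {z : Env k a q} (hz : z ∈ Fil a q e) (s : ℕ) :
    ∃ z' ∈ noY a q, z' ∈ Fil a q e ∧ ∃ w ∈ Fil a q (e - 1), z = z' + w * tau₂ a q s :=
  ⟨_, evalCoeff_mem_noY ha hq (q ^ s) z, evalCoeff_mem_Fil hq (coeffY_mem_Fil ha hq hz)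
    (Submodule.smul_mem _ _ y_left_mem_Fil), _, quotCoeff_mem_Fil hq (coeffY_mem_Fil ha hq hz)
      y_right_mem_Fil (Submodule.smul_mem _ _ y_left_mem_Fil),
      (isCoeff_y ha hq).eval_add_quot (commute_y _) z⟩

/-- By `hC` right multiplication by τ₁(u) descends to the quotients by multiples of τ₂. On
representatives in A ⊗ k[x], which it preserves, vanishing in the quotient means vanishing, so
`exact_tau₁` applies. -/
theorem row_exact_tau₁ {e : ℤ} {z : Env k a q} (hz : z ∈ Fil a q e) {s s' u : ℕ} {C w : Env k a q}
    (hC : tau₂ a q s' * tau₁ a q u = C * tau₂ a q s) (h : z * tau₁ a q u = w * tau₂ a q s) :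
    ∃ w₁ ∈ Fil a q (e - 1), ∃ w₂ ∈ Fil a q (e - (a - 1)),
      z = w₁ * tau₂ a q s' + w₂ * gamma₁ a q u := by
  obtain ⟨z', hz', hz'F, w₁, hw₁, rfl⟩ := exists_noY ha hq hz s'
  have h0 : z' * tau₁ a q u = 0 := by
    refine eq_zero_of_mem_noY ha hq (noY_mul_tau₁ ha hq hz' u) (w := w - w₁ * C) (s := s) ?_
    rw [sub_mul, ← h, mul_assoc, ← hC, add_mul, mul_assoc, add_sub_cancel_right]
  obtain ⟨w₂, hw₂, e₂⟩ := exact_tau₁ ha hq hz'F u h0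
  exact ⟨w₁, hw₁, w₂, hw₂, by rw [add_comm, ← e₂]⟩

theorem row_exact_gamma₁ {e : ℤ} {z : Env k a q} (hz : z ∈ Fil a q e) {s s' u : ℕ}
    {C w : Env k a q} (hC : tau₂ a q s' * gamma₁ a q u = C * tau₂ a q s)
    (h : z * gamma₁ a q u = w * tau₂ a q s) :
    ∃ w₁ ∈ Fil a q (e - 1), ∃ w₂ ∈ Fil a q (e - 1),
      z = w₁ * tau₂ a q s' + w₂ * tau₁ a q u := by
  obtain ⟨z', hz', hz'F, w₁, hw₁, rfl⟩ := exists_noY ha hq hz s'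
  have h0 : z' * gamma₁ a q u = 0 := by
    refine eq_zero_of_mem_noY ha hq (noY_mul_gamma₁ ha hq hz' u) (w := w - w₁ * C) (s := s) ?_
    rw [sub_mul, ← h, mul_assoc, ← hC, add_mul, mul_assoc, add_sub_cancel_right]
  obtain ⟨w₂, hw₂, e₂⟩ := exact_gamma₁ ha hq hz'F u h0
  exact ⟨w₁, hw₁, w₂, hw₂, by rw [add_comm, ← e₂]⟩

end

variable (a q) in
/-- The multiplication map `b ⊗ c ↦ b c`. -/
def mulMap : Env k a q →ₗ[k] Alg k a q where
  toFun z := z • (1 : Alg k a q)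
  map_add' z w := add_smul z w _
  map_smul' r z := by
    have e : (r • z : Env k a q) = tmul (r • 1) 1 * z := by
      rw [smul_tmul_left, tmul_one_one, smul_mul_assoc, one_mul]
    rw [e, mul_smul, tmul_smul, mul_one, smul_mul_assoc, one_mul]
    rfl

/-- The two substitutions move the right factor to the left one. For x^i y^j the factor q^(ij) from
expanding in y cancels against y^j x^i = q^(-ij) x^i y^j. -/
theorem evalCoeff_evalCoeff (ha : 0 < a) (hq : q ≠ 0) (z : Env k a q) :
    evalCoeff a (tmul (x a q) 1) (fun n => rmap (coeffX a q n))
      (evalCoeff a (tmul (y a q) 1) (fun n => rmap (coeffY a q n)) z)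
      = tmul (z • (1 : Alg k a q)) 1 := by
  have e : (∑ n ∈ Finset.range a, (LinearMap.mulRight k (tmul (x a q) 1 ^ n)).comp
      (rmap (coeffX a q n))).comp (∑ n ∈ Finset.range a,
        (LinearMap.mulRight k (tmul (y a q) 1 ^ n)).comp (rmap (coeffY a q n)))
      = (TensorProduct.mk k (Alg k a q) (Alg k a q)ᵐᵒᵖ).flip 1 ∘ₗ mulMap a q := by
    refine env_ext fun b c => ?_
    have e' := linearMap_ext_mono (a := a) hq
      (f := ((∑ n ∈ Finset.range a, (LinearMap.mulRight k (tmul (x a q) 1 ^ n)).comp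
      (rmap (coeffX a q n))).comp (∑ n ∈ Finset.range a,
        (LinearMap.mulRight k (tmul (y a q) 1 ^ n)).comp (rmap (coeffY a q n)))).comp
          ((TensorProduct.mk k (Alg k a q) (Alg k a q)ᵐᵒᵖ b).comp
            (MulOpposite.opLinearEquiv k).toLinearMap))
      (g := ((TensorProduct.mk k (Alg k a q) (Alg k a q)ᵐᵒᵖ).flip 1 ∘ₗ mulMap a q).comp
          ((TensorProduct.mk k (Alg k a q) (Alg k a q)ᵐᵒᵖ b).comp
            (MulOpposite.opLinearEquiv k).toLinearMap)) fun i j => ?_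
    · exact LinearMap.congr_fun e' c
    change (∑ n ∈ Finset.range a, (LinearMap.mulRight k (tmul (x a q) 1 ^ n)).comp
      (rmap (coeffX a q n))) ((∑ n ∈ Finset.range a,
        (LinearMap.mulRight k (tmul (y a q) 1 ^ n)).comp (rmap (coeffY a q n)))
          (tmul b (x a q ^ i * y a q ^ j))) = tmul (tmul b (x a q ^ i * y a q ^ j) • 1) 1
    have hin : (∑ n ∈ Finset.range a, (LinearMap.mulRight k (tmul (y a q) 1 ^ n)).comp
        (rmap (coeffY a q n))) (tmul b (x a q ^ i * y a q ^ j))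
        = q ^ (i * j) • tmul (b * y a q ^ j) (x a q ^ i) := by
      simp only [LinearMap.sum_apply, LinearMap.comp_apply, LinearMap.mulRight_apply, rmap_tmul,
        coeffY_mono ha hq, tmul_pow, one_pow, tmul_mul_tmul, one_mul]
      by_cases hj : a ≤ j
      · rw [y_pow_eq_zero hj, mul_zero, tmul_zero_left, smul_zero]
        refine Finset.sum_eq_zero fun n hn => ?_
        rw [Finset.mem_range] at hn
        rw [if_neg (by omega), tmul_zero_right]
      · rw [Finset.sum_eq_single_of_mem j (by simp; omega)
          (fun n _ hn => by rw [if_neg (by omega), tmul_zero_right]), if_pos (by omega),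
          smul_tmul_right]
    rw [hin, tmul_smul, mul_one]
    simp only [LinearMap.sum_apply, LinearMap.comp_apply, LinearMap.mulRight_apply,
      tmul_pow, one_pow]
    simp only [map_smul, rmap_tmul]
    have ex : x a q ^ i = x a q ^ i * y a q ^ 0 := by simp
    rw [ex]
    simp only [coeffX_mono ha hq]
    rw [← ex]
    by_cases hi : a ≤ i
    · rw [Finset.sum_eq_zero, x_pow_eq_zero hi, zero_mul, mul_zero, tmul_zero_left]
      · intro n hn
        rw [Finset.mem_range] at hn
        rw [if_neg (by omega), tmul_zero_right, smul_zero, zero_mul]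
    rw [Finset.sum_eq_single_of_mem (a := i) (by simp; omega)
      (fun n _ hn => by rw [if_neg (by omega), tmul_zero_right, smul_zero, zero_mul]),
      if_pos (by omega), pow_zero, smul_mul_assoc, tmul_mul_tmul, ← smul_tmul_left, mul_assoc,
      y_pow_mul_x_pow hq, mul_one, mul_smul_comm, smul_smul, ← mul_pow, mul_inv_cancel₀ hq, one_pow,
      one_smul]
  have := LinearMap.congr_fun e z
  simp only [LinearMap.sum_apply, LinearMap.comp_apply, LinearMap.mulRight_apply] at this
  exact this

/-- Divide by τ₂(0), then divide the remainder by τ₁(0). The last remainder is the image under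
multiplication, placed in the left factor, and so it is zero. -/
theorem exact_mu (ha : 0 < a) (hq : q ≠ 0) {e : ℤ} {z : Env k a q} (hz : z ∈ Fil a q e)
    (h : z • (1 : Alg k a q) = 0) :
    ∃ w₁ ∈ Fil a q (e - 1), ∃ w₂ ∈ Fil a q (e - 1),
      z = w₁ * tau₂ a q 0 + w₂ * tau₁ a q 0 := by
  have h0 := evalCoeff_evalCoeff ha hq z
  rw [h, tmul_zero_left] at h0
  have e₁ := (isCoeff_y ha hq).eval_add_quot (commute_tmul a q (y a q) (y a q)).symm z
  have hF := evalCoeff_mem_Fil hq (coeffY_mem_Fil ha hq hz) (y_left_mem_Fil (a := a) (q := q))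
  have e₂ := (isCoeff_x ha hq).eval_add_quot (commute_tmul a q (x a q) (x a q)).symm
    (evalCoeff a (tmul (y a q) 1) (fun n => rmap (coeffY a q n)) z)
  rw [h0, zero_add] at e₂
  refine ⟨_, quotCoeff_mem_Fil hq (coeffY_mem_Fil ha hq hz) y_right_mem_Fil y_left_mem_Fil,
    _, quotCoeff_mem_Fil hq (coeffX_mem_Fil ha hq hF) x_right_mem_Fil x_left_mem_Fil, ?_⟩
  conv_lhs => rw [e₁]
  rw [tau₂, tau₁, pow_zero, one_smul, one_smul, add_comm]
  exact congrArg (_ + ·) e₂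

end QCI

/-! ### The double complex and exactness of the resolution -/

namespace QCI

variable {k : Type u} [Field k] {a : ℕ} {q : k}

section Periodicity

variable (hq : q ^ a = 1)
include hq

theorem q_pow_add (j s : ℕ) : q ^ (a * j + s) = q ^ s := by
  rw [pow_add, pow_mul, hq, one_pow, one_mul]

theorem tau₁_add (j s : ℕ) : tau₁ a q (a * j + s) = tau₁ a q s := by
  rw [tau₁, tau₁, q_pow_add hq]

theorem tau₂_add (j s : ℕ) : tau₂ a q (a * j + s) = tau₂ a q s := by
  rw [tau₂, tau₂, q_pow_add hq]

theorem gamma₁_add (j s : ℕ) : gamma₁ a q (a * j + s) = gamma₁ a q s := by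
  simp only [gamma₁, mul_comm _ (a * j + s), mul_comm _ s, pow_mul, q_pow_add hq]

theorem gamma₂_add (j s : ℕ) : gamma₂ a q (a * j + s) = gamma₂ a q s := by
  simp only [gamma₂, mul_comm _ (a * j + s), mul_comm _ s, pow_mul, q_pow_add hq]

theorem tau₁_mul (j : ℕ) : tau₁ a q (a * j) = tau₁ a q 0 := tau₁_add hq j 0
theorem tau₂_mul (j : ℕ) : tau₂ a q (a * j) = tau₂ a q 0 := tau₂_add hq j 0
theorem gamma₁_mul (j : ℕ) : gamma₁ a q (a * j) = gamma₁ a q 0 := gamma₁_add hq j 0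
theorem gamma₂_mul (j : ℕ) : gamma₂ a q (a * j) = gamma₂ a q 0 := gamma₂_add hq j 0

end Periodicity

variable (a q) in
/-- The coefficient of `f_i^{n-1}` in `d f_i^n`, where `r = n - i`. -/
def vC (r i : ℕ) : Env k a q :=
  if Even i then if Even r then gamma₂ a q 0 else tau₂ a q 0
  else if Even r then -gamma₂ a q 1 else -tau₂ a q 1

variable (a q) in
/-- The coefficient of `f_{i-1}^{n-1}` in `d f_i^n`, where `r = n - i`. -/
def hC (r i : ℕ) : Env k a q :=
  if Even i then if Even r then gamma₁ a q 0 else gamma₁ a q 1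
  else if Even r then tau₁ a q 0 else tau₁ a q 1

/-- By periodicity, the coefficients of the differential depend only on parities. -/
theorem dGen_eq (hq : q ^ a = 1) {m i : ℕ} (hi : i ≤ m + 1) :
    dGen a q m i = vC a q (m + 1 - i) i • gen a q m i + hC a q (m + 1 - i) i • gen a q m (i - 1) := by
  obtain ⟨r, hr⟩ : ∃ r, m + 1 = i + r := ⟨m + 1 - i, by omega⟩
  rw [show m + 1 - i = r by omega]
  obtain ⟨j, rfl | rfl⟩ := Nat.even_or_odd' i <;> obtain ⟨s, rfl | rfl⟩ := Nat.even_or_odd' r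
  · rw [dGen_even_even a q (j := j) (s := s) (by omega), gamma₂_mul hq, gamma₁_mul hq]
    simp [vC, hC]
  · rw [dGen_odd_even a q (j := j) (s := s) (by omega), tau₂_mul hq, gamma₁_add hq]
    simp [vC, hC]
  · rw [dGen_odd_odd a q (j := j) (s := s) (by omega), gamma₂_add hq, tau₁_mul hq]
    simp [vC, hC]
  · rw [dGen_even_odd a q (j := j) (s := s) (by omega), tau₂_add hq, tau₁_add hq]
    simp [vC, hC]

theorem d_apply (hq : q ^ a = 1) (m : ℕ) (v : P a q (m + 1)) (j : Fin (m + 1)) :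
    d a q m v j = v j.castSucc * vC a q (m + 1 - j) j + v j.succ * hC a q (m - j) (j + 1) := by
  have e : ∀ i : Fin (m + 1 + 1), v i * dGen a q m i j
      = (if i = j.castSucc then v j.castSucc * vC a q (m + 1 - j) j else 0)
        + if i = j.succ then v j.succ * hC a q (m - j) (j + 1) else 0 := by
    intro i
    rw [dGen_eq hq (by omega)]
    simp only [Pi.add_apply, Pi.smul_apply, gen, smul_eq_mul, mul_ite, mul_one, mul_zero, mul_add]
    congr 1
    · by_cases h : i = j.castSucc
      · subst h; simp
      · rw [if_neg h, if_neg]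
        intro h'
        exact h (Fin.ext (by simp; omega))
    · by_cases h : i = j.succ
      · subst h
        rw [if_pos rfl, if_pos (by simp)]
        simp
      · rw [if_neg h, if_neg]
        intro h'
        exact h (Fin.ext (by simp; omega))
  rw [d, Fintype.linearCombination_apply, Finset.sum_apply]
  simp only [Pi.smul_apply, smul_eq_mul, e]
  rw [Finset.sum_add_distrib, Finset.sum_ite_eq' Finset.univ, Finset.sum_ite_eq' Finset.univ,
    if_pos (Finset.mem_univ _), if_pos (Finset.mem_univ _)]

theorem hC_mul_hC (r i : ℕ) : hC a q r (i + 1) * hC a q r i = 0 := by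
  simp only [hC, Nat.even_add_one]
  split_ifs <;> simp_all [gamma₁_mul_tau₁, tau₁_mul_gamma₁]

/-- The squares anticommute because of the signs in the odd columns. The shifts by a - 1 in the
commutation rules fit since 1 + (a - 1) is 0 modulo the period a. -/
theorem vC_mul_hC (hq : q ^ a = 1) (ha : 0 < a) (r i : ℕ) :
    vC a q (r + 1) (i + 1) * hC a q r (i + 1) + hC a q (r + 1) (i + 1) * vC a q (r + 1) i = 0 := by
  have e : 1 + (a - 1) = a * 1 := by omega
  have h1 := gamma₂_mul_gamma₁ a q 1 1
  rw [e, gamma₁_mul hq, gamma₂_mul hq] at h1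
  have h2 := gamma₂_mul_tau₁ a q 0 1
  rw [e, tau₁_mul hq, zero_add] at h2
  have h3 := tau₂_mul_gamma₁ a q 1 0
  rw [e, tau₂_mul hq, zero_add] at h3
  have h4 := tau₂_mul_tau₁ a q 0 0
  rw [zero_add] at h4
  simp only [vC, hC, Nat.even_add_one]
  split_ifs <;> simp_all

variable (a) in
/-- The degree of a generator in one variable. -/
def wt (r : ℕ) : ℤ := a * (r / 2 : ℕ) + (r % 2 : ℕ)

theorem wt_zero : wt a 0 = 0 := by simp [wt]

theorem wt_nonneg (r : ℕ) : 0 ≤ wt a r := by unfold wt; positivity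

theorem wt_even {r : ℕ} (h : Even r) : wt a (r + 1) = wt a r + 1 := by
  obtain ⟨s, rfl⟩ := h
  rw [wt, wt, show (s + s + 1) / 2 = s by omega, show (s + s) / 2 = s by omega,
    show (s + s + 1) % 2 = 1 by omega, show (s + s) % 2 = 0 by omega]
  simp

theorem wt_odd {r : ℕ} (h : ¬ Even r) : wt a (r + 1) = wt a r + (a - 1) := by
  obtain ⟨s, rfl⟩ := Nat.not_even_iff_odd.1 h
  rw [wt, wt, show (2 * s + 1 + 1) / 2 = s + 1 by omega, show (2 * s + 1) / 2 = s by omega,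
    show (2 * s + 1 + 1) % 2 = 0 by omega, show (2 * s + 1) % 2 = 1 by omega]
  push_cast
  ring

theorem exists_mul_neg {e : ℤ} {z c : Env k a q} (h : ∃ w ∈ Fil a q e, z = w * c) :
    ∃ w ∈ Fil a q e, z = w * -c := by
  obtain ⟨w, hw, rfl⟩ := h
  exact ⟨-w, Submodule.neg_mem _ hw, by simp⟩

section

variable (ha : 0 < a) (hq : q ≠ 0)
include ha hq

/-- Within a column the maps are, up to sign, alternately τ₂ and γ₂ with one fixed parameter, so the
one-variable exactness applies in every row. -/
theorem exact_vC {e : ℤ} {z : Env k a q} (hz : z ∈ Fil a q e) (r i : ℕ)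
    (h : z * vC a q r i = 0) :
    ∃ w ∈ Fil a q (e - (wt a (r + 1) - wt a r)), z = w * vC a q (r + 1) i := by
  by_cases hr : Even r
  · rw [wt_even hr, add_sub_cancel_left]
    by_cases hi : Even i
    · simp only [vC, hr, hi, Nat.even_add_one, not_true, if_true, if_false] at h ⊢
      exact exact_gamma₂ ha hq hz _ h
    · simp only [vC, hr, hi, if_true, if_false, mul_neg, neg_eq_zero] at h
      simp only [vC, hr, hi, Nat.even_add_one, not_true, if_false]
      exact exists_mul_neg (exact_gamma₂ ha hq hz _ h)
  · rw [wt_odd hr, add_sub_cancel_left]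
    by_cases hi : Even i
    · simp only [vC, hr, hi, Nat.even_add_one, not_false_eq_true, if_true, if_false] at h ⊢
      exact exact_tau₂ ha hq hz _ h
    · simp only [vC, hr, hi, if_false, mul_neg, neg_eq_zero] at h
      simp only [vC, hr, hi, Nat.even_add_one, not_false_eq_true, if_true, if_false]
      exact exists_mul_neg (exact_tau₂ ha hq hz _ h)

end

theorem vC_one_left {i : ℕ} {z : Env k a q} (h : ∃ w, z = w * vC a q 1 i) :
    ∃ w, z = w * tau₂ a q (if Even i then 0 else 1) := by
  obtain ⟨w, rfl⟩ := h
  by_cases hi : Even i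
  · exact ⟨w, by simp [vC, hi]⟩
  · exact ⟨-w, by simp [vC, hi]⟩

theorem vC_one_right {i : ℕ} {e : ℤ} {z : Env k a q}
    (h : ∃ w ∈ Fil a q e, z = w * tau₂ a q (if Even i then 0 else 1)) :
    ∃ w ∈ Fil a q e, z = w * vC a q 1 i := by
  by_cases hi : Even i
  · simpa [vC, hi] using h
  · have := exists_mul_neg h
    simpa [vC, hi] using this

/-- This is exactness of row 0 modulo the images of the vertical maps from row 1, the only place
where the columns are not exact. -/
theorem exact_hC (ha : 0 < a) (hq : q ^ a = 1) {e : ℤ} {z : Env k a q} (hz : z ∈ Fil a q e)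
    (i : ℕ) {w : Env k a q} (h : z * hC a q 0 (i + 1) = w * vC a q 1 i) :
    ∃ w₁ ∈ Fil a q (e - 1), ∃ w₂ ∈ Fil a q (e - (wt a (i + 2) - wt a (i + 1))),
      z = w₁ * vC a q 1 (i + 1) + w₂ * hC a q 0 (i + 2) := by
  have hq0 : q ≠ 0 := by
    rintro rfl
    rw [zero_pow ha.ne'] at hq
    exact zero_ne_one hq
  obtain ⟨w', hw'⟩ := vC_one_left ⟨w, h⟩
  -- The anticommuting square supplies the factor `C` through which the row map descends to
  -- cokernels.
  obtain ⟨C, hC'⟩ : ∃ C, tau₂ a q (if Even (i + 1) then 0 else 1) * hC a q 0 (i + 1)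
      = C * tau₂ a q (if Even i then 0 else 1) := by
    obtain ⟨t, -, ht⟩ := vC_one_right (a := a) (q := q) (i := i + 1) (e := 0)
      (z := tau₂ a q (if Even (i + 1) then 0 else 1)) ⟨1, one_mem_Fil, by rw [one_mul]⟩
    refine vC_one_left ⟨-(t * hC a q 1 (i + 1)), ?_⟩
    rw [ht, mul_assoc, eq_neg_of_add_eq_zero_left (vC_mul_hC hq ha 0 i), mul_neg, neg_mul,
      mul_assoc]
  have key : ∃ w₁ ∈ Fil a q (e - 1), ∃ w₂ ∈ Fil a q (e - (wt a (i + 2) - wt a (i + 1))),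
      z = w₁ * tau₂ a q (if Even (i + 1) then 0 else 1) + w₂ * hC a q 0 (i + 2) := by
    by_cases hi : Even i
    · have h1 : hC a q 0 (i + 1) = tau₁ a q 0 := by simp [hC, hi, Nat.even_add_one]
      have h2 : hC a q 0 (i + 2) = gamma₁ a q 0 := by simp [hC, hi, Nat.even_add]
      rw [wt_odd (r := i + 1) (by simpa [Nat.even_add_one] using hi), add_sub_cancel_left, h2]
      rw [h1] at hC' hw'
      exact row_exact_tau₁ ha hq0 hz hC' hw'
    · have h1 : hC a q 0 (i + 1) = gamma₁ a q 0 := by simp [hC, hi, Nat.even_add_one]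
      have h2 : hC a q 0 (i + 2) = tau₁ a q 0 := by simp [hC, hi, Nat.even_add]
      rw [wt_even (r := i + 1) (by simpa [Nat.even_add_one] using hi), add_sub_cancel_left, h2]
      rw [h1] at hC' hw'
      exact row_exact_gamma₁ ha hq0 hz hC' hw'
  obtain ⟨w₁, hw₁, w₂, hw₂, e₁⟩ := key
  obtain ⟨w₃, hw₃, e₃⟩ := vC_one_right ⟨w₁, hw₁, rfl⟩
  exact ⟨w₃, hw₃, w₂, hw₂, by rw [e₁, e₃]⟩

/-- Z r is the row r component of a cycle of total degree n. Once row 0 is solved, the rows are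
solved upwards: each new W (R + 2) corrects Z (R + 1) - W (R + 1) hC by column exactness. -/
theorem chase (ha : 0 < a) (hq : q ^ a = 1) {n : ℕ} {e : ℤ} {Z : ℕ → Env k a q}
    (hZ : ∀ r ≤ n, Z r ∈ Fil a q (e - wt a r - wt a (n - r)))
    (hc : ∀ r < n, Z (r + 1) * vC a q (r + 1) (n - (r + 1)) + Z r * hC a q r (n - r) = 0)
    {w₀ w₁ : Env k a q} (hw₀ : w₀ ∈ Fil a q (e - wt a 0 - wt a (n + 1)))
    (hw₁ : w₁ ∈ Fil a q (e - wt a 1 - wt a n))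
    (h0 : Z 0 = w₁ * vC a q 1 n + w₀ * hC a q 0 (n + 1)) (R : ℕ) (hR : R ≤ n) :
    ∃ W : ℕ → Env k a q, (∀ r ≤ R + 1, W r ∈ Fil a q (e - wt a r - wt a (n + 1 - r))) ∧
      ∀ r ≤ R, Z r = W (r + 1) * vC a q (r + 1) (n - r) + W r * hC a q r (n + 1 - r) := by
  have hq0 : q ≠ 0 := by
    rintro rfl
    rw [zero_pow ha.ne'] at hq
    exact zero_ne_one hq
  induction R with
  | zero =>
    refine ⟨fun r => if r = 0 then w₀ else w₁, fun r hr => ?_, fun r hr => ?_⟩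
    · obtain rfl | rfl : r = 0 ∨ r = 1 := by omega
      · simpa using hw₀
      · simpa using hw₁
    · obtain rfl : r = 0 := by omega
      simpa using h0
  | succ R ih =>
    obtain ⟨W, hW, hWe⟩ := ih (by omega)
    obtain ⟨i, rfl⟩ : ∃ i, n = i + (R + 1) := ⟨n - (R + 1), by omega⟩
    have e1 : i + (R + 1) - R = i + 1 := by omega
    have e2 : i + (R + 1) - (R + 1) = i := by omega
    have e3 : i + (R + 1) + 1 - (R + 1) = i + 1 := by omega
    have e4 : i + (R + 1) + 1 - R = i + 2 := by omega
    have hz : Z (R + 1) - W (R + 1) * hC a q (R + 1) (i + 1)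
        ∈ Fil a q (e - wt a (R + 1) - wt a i) := by
      refine Submodule.sub_mem _ (by simpa [e2] using hZ (R + 1) hR) ?_
      have := hW (R + 1) le_rfl
      rw [e3] at this
      refine mul_mem_Fil' hq0 (e' := wt a (i + 1) - wt a i) this ?_ (by omega)
      by_cases hi : Even i
      · rw [wt_even hi, add_sub_cancel_left, hC, if_neg (by simpa [Nat.even_add_one] using hi)]
        have ht : ∀ s, tau₁ a q s ∈ Fil a q 1 := fun s =>
          Submodule.sub_mem _ (Submodule.smul_mem _ _ x_right_mem_Fil) x_left_mem_Fil
        split_ifs <;> exact ht _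
      · rw [wt_odd hi, add_sub_cancel_left, hC, if_pos (by simpa [Nat.even_add_one] using hi)]
        have ht : ∀ s, gamma₁ a q s ∈ Fil a q (a - 1) := fun s => by
          rw [gamma₁_eq]
          refine Submodule.sum_mem _ fun j hj => Submodule.smul_mem _ _ ?_
          rw [Finset.mem_range] at hj
          exact mul_mem_Fil' hq0 (pow_mem_Fil hq0 x_left_mem_Fil _)
            (pow_mem_Fil hq0 x_right_mem_Fil _) (by omega)
        split_ifs <;> exact ht _
    -- The difference is a vertical cycle: the cycle condition for Z, the equation for Z R, the
    -- anticommuting square and `hC_mul_hC` cancel all terms.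
    obtain ⟨w, hw, ew⟩ := exact_vC ha hq0 hz (R + 1) i (by
      have h1 := hc R (by omega)
      have h2 := hWe R le_rfl
      have h3 := vC_mul_hC hq ha R i
      rw [e1, e4] at h2
      rw [e2, e1] at h1
      rw [sub_mul, mul_assoc, eq_neg_of_add_eq_zero_left h1, eq_neg_of_add_eq_zero_right h3, h2,
        add_mul, mul_assoc, mul_assoc, hC_mul_hC]
      simp)
    refine ⟨Function.update W (R + 2) w, fun r hr => ?_, fun r hr => ?_⟩
    · obtain rfl | h : r = R + 2 ∨ r ≤ R + 1 := by omega
      · rw [Function.update_self, show i + (R + 1) + 1 - (R + 2) = i by omega]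
        exact Fil_mono (le_of_eq (by ring)) hw
      · rw [Function.update_of_ne (by omega)]
        exact hW r h
    · obtain rfl | h : r = R + 1 ∨ r ≤ R := by omega
      · rw [Function.update_self, Function.update_of_ne (by omega), e2, e3, ← ew]
        abel
      · rw [Function.update_of_ne (by omega), Function.update_of_ne (by omega)]
        exact hWe r h

variable (a q) in
/-- The filtration of `P n` for which `d` preserves degrees. -/
def PFil (n : ℕ) (e : ℤ) : Submodule k (P a q n) where
  carrier := {v | ∀ i : Fin (n + 1), v i ∈ Fil a q (e - wt a (n - i) - wt a i)}
  add_mem' hv hw i := Submodule.add_mem _ (hv i) (hw i)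
  zero_mem' _ := Submodule.zero_mem _
  smul_mem' r _ hv i := Submodule.smul_mem _ r (hv i)

theorem exists_d_eq (hq : q ^ a = 1) {n : ℕ} {e : ℤ} {v : P a q n} {W : ℕ → Env k a q}
    (hW : ∀ r ≤ n + 1, W r ∈ Fil a q (e - wt a r - wt a (n + 1 - r)))
    (hWe : ∀ i : Fin (n + 1), v i = W (n - i + 1) * vC a q (n - i + 1) i
      + W (n - i) * hC a q (n - i) (i + 1)) : ∃ w ∈ PFil a q (n + 1) e, d a q n w = v := by
  refine ⟨fun i => W (n + 1 - i), fun i => ?_, ?_⟩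
  · have := hW (n + 1 - i) (by omega)
    rwa [show n + 1 - (n + 1 - (i : ℕ)) = i by omega] at this
  · funext j
    rw [d_apply hq, hWe j, Fin.val_castSucc, Fin.val_succ, show n + 1 - (j : ℕ) = n - j + 1 by omega,
      show n + 1 - ((j : ℕ) + 1) = n - j by omega]

theorem exact_d (ha : 0 < a) (hq : q ^ a = 1) {m : ℕ} {e : ℤ} {v : P a q (m + 1)}
    (hv : v ∈ PFil a q (m + 1) e) (h : d a q m v = 0) :
    ∃ w ∈ PFil a q (m + 2) e, d a q (m + 1) w = v := by
  -- Components are reindexed by the row r = m + 1 - i; `Fin.ofNat` only makes the function total.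
  let Z : ℕ → Env k a q := fun r => v (Fin.ofNat (m + 1 + 1) (m + 1 - r))
  have hZi : ∀ i : Fin (m + 1 + 1), Z (m + 1 - i) = v i := fun i => by
    refine congrArg v (Fin.ext ?_)
    rw [Fin.val_ofNat, Nat.mod_eq_of_lt (by omega)]
    omega
  have hc : ∀ r < m + 1, Z (r + 1) * vC a q (r + 1) (m + 1 - (r + 1))
      + Z r * hC a q r (m + 1 - r) = 0 := by
    intro r hr
    have := congrFun h ⟨m - r, by omega⟩
    rw [d_apply hq, ← hZi, ← hZi] at this
    simpa [show m + 1 - (m - r) = r + 1 by omega, show m - (m - r) = r by omega,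
      show m - r + 1 = m + 1 - r by omega, show m + 1 - (m + 1 - r) = r by omega] using this
  have hZ : ∀ r ≤ m + 1, Z r ∈ Fil a q (e - wt a r - wt a (m + 1 - r)) := by
    intro r hr
    have := hv ⟨m + 1 - r, by omega⟩
    rw [← hZi] at this
    simpa [show m + 1 - (m + 1 - r) = r by omega] using this
  have h0 := hc 0 (by omega)
  obtain ⟨w₁, hw₁, w₀, hw₀, e₀⟩ := exact_hC ha hq (hZ 0 (by omega)) m
    (w := -Z 1) (by
      simp only [zero_add, Nat.add_sub_cancel, Nat.sub_zero] at h0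
      rw [neg_mul]
      exact eq_neg_of_add_eq_zero_right h0)
  obtain ⟨W, hW, hWe⟩ := chase ha hq hZ hc (w₀ := w₀) (w₁ := w₁)
    (Fil_mono (by simp) hw₀) (Fil_mono (by simp [wt]) hw₁) e₀ (m + 1) le_rfl
  refine exists_d_eq hq hW fun i => ?_
  rw [← hZi i, hWe _ (by omega), show m + 1 - (m + 1 - (i : ℕ)) = i by omega,
    show m + 1 + 1 - (m + 1 - (i : ℕ)) = i + 1 by omega]

theorem mu_apply (v : P a q 0) : mu a q v = v 0 • (1 : Alg k a q) := by
  rw [mu, cochain, Fintype.linearCombination_apply]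
  simp

theorem exact_d_zero (ha : 0 < a) (hq : q ^ a = 1) {e : ℤ} {v : P a q 0}
    (hv : v ∈ PFil a q 0 e) (h : mu a q v = 0) : ∃ w ∈ PFil a q 1 e, d a q 0 w = v := by
  have hq0 : q ≠ 0 := by
    rintro rfl
    rw [zero_pow ha.ne'] at hq
    exact zero_ne_one hq
  have hv0 := hv 0
  rw [mu_apply] at h
  obtain ⟨w₁, hw₁, w₀, hw₀, e₀⟩ := exact_mu ha hq0 hv0 h
  have h1 : wt a 1 = 1 := by simp [wt]
  simp only [Fin.coe_ofNat_eq_mod, Nat.zero_mod, Nat.sub_self, wt_zero, sub_zero] at hw₁ hw₀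
  refine exists_d_eq hq (W := fun r => if r = 0 then w₀ else w₁) (fun r hr => ?_) fun i => ?_
  · obtain rfl | rfl : r = 0 ∨ r = 1 := by omega
    · simpa [wt_zero, h1] using hw₀
    · simpa [wt_zero, h1] using hw₁
  · obtain rfl : i = 0 := Fin.ext (by omega)
    simpa [vC, hC] using e₀

theorem Fil_eq_top (hq : q ≠ 0) {e : ℤ} (he : e ≤ 0) : Fil a q e = ⊤ := by
  rw [eq_top_iff]
  rintro z -
  have e1 : (Fil a q e).mkQ = 0 := by
    refine env_ext fun b c => ?_
    have e2 : (Fil a q e).mkQ.comp ((TensorProduct.mk k _ _ b).comp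
        (MulOpposite.opLinearEquiv k).toLinearMap) = 0 := by
      refine linearMap_ext_mono hq fun l m => ?_
      have e3 : (Fil a q e).mkQ.comp ((TensorProduct.mk k (Alg k a q) (Alg k a q)ᵐᵒᵖ).flip
          (MulOpposite.op (x a q ^ l * y a q ^ m))) = 0 := by
        refine linearMap_ext_mono hq fun i j => ?_
        exact (Submodule.Quotient.mk_eq_zero _).2 (mono_mem_Fil (by omega))
      exact LinearMap.congr_fun e3 b
    exact LinearMap.congr_fun e2 c
  exact (Submodule.Quotient.mk_eq_zero _).1 (LinearMap.congr_fun e1 z)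

/-- Generators have nonnegative degree, so filtration 0 is no condition and filtered exactness
contains plain exactness. -/
theorem mem_PFil_zero (hq : q ≠ 0) {n : ℕ} (v : P a q n) : v ∈ PFil a q n 0 := fun i => by
  rw [Fil_eq_top hq]
  · trivial
  · have := wt_nonneg (a := a) (n - i); have := wt_nonneg (a := a) i; omega

theorem mu_surjective : Function.Surjective (mu a q) := fun b =>
  ⟨fun _ => tmul b 1, by rw [mu_apply, tmul_smul, mul_one, mul_one]⟩

theorem quasiIso_augmentation (ha : 0 < a) (hq : q ^ a = 1) : QuasiIso (augmentation a q) := by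
  have hq0 : q ≠ 0 := by
    rintro rfl
    rw [zero_pow ha.ne'] at hq
    exact zero_ne_one hq
  constructor
  rintro (_ | n)
  · rw [ChainComplex.quasiIsoAt₀_iff, ShortComplex.quasiIso_iff_of_zeros' _ rfl rfl rfl]
    constructor
    · rw [ShortComplex.moduleCat_exact_iff]
      intro v hv
      change (augmentation a q).f 0 v = 0 at hv
      rw [augmentation_f_zero] at hv
      obtain ⟨w, -, hw⟩ := exact_d_zero ha hq (mem_PFil_zero hq0 v) hv
      refine ⟨w, ?_⟩
      change (complex a q).d 1 0 w = v
      rw [complex_d]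
      exact hw
    · rw [ModuleCat.epi_iff_surjective]
      change Function.Surjective ((augmentation a q).f 0)
      rw [augmentation_f_zero]
      exact mu_surjective
  · rw [quasiIsoAt_iff_exactAt' (hL := ChainComplex.exactAt_succ_single_obj ..),
      HomologicalComplex.exactAt_iff' _ (n + 2) (n + 1) n (by simp) (by simp),
      ShortComplex.moduleCat_exact_iff]
    intro v hv
    change (complex a q).d (n + 1) n v = 0 at hv
    rw [complex_d] at hv
    obtain ⟨w, -, hw⟩ := exact_d ha hq (mem_PFil_zero hq0 v) hv
    refine ⟨w, ?_⟩
    change (complex a q).d (n + 2) (n + 1) w = v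
    rw [complex_d]
    exact hw

end QCI

/-! ### Values of cocycles of even degree -/

namespace QCI

variable {k : Type u} [Field k] {a : ℕ} {q : k}

section

variable (ha : 0 < a) (hq : q ≠ 0)
include ha hq

theorem coef_tau₂_smul (s : ℕ) (m : Alg k a q) (u v : ℕ) :
    coef a q (tau₂ a q s • m) u v =
      if 1 ≤ v ∧ v < a then (1 - q ^ s * q⁻¹ ^ u) * coef a q m u (v - 1) else 0 := by
  have e : tau₂ a q s • m = m * y a q - q ^ s • (y a q * m) := by
    rw [tau₂, ← smul_tmul_left, sub_smul, tmul_smul, tmul_smul, one_mul, mul_one, smul_mul_assoc]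
  rw [e, map_sub, map_smul, Pi.sub_apply, Pi.sub_apply, Pi.smul_apply, Pi.smul_apply,
    coef_mul_y ha hq, coef_y_mul ha hq, opY_apply]
  split_ifs
  · simp only [smul_eq_mul]; ring
  · simp

theorem coef_tau₁_smul (s : ℕ) (m : Alg k a q) (u v : ℕ) :
    coef a q (tau₁ a q s • m) u v =
      if 1 ≤ u ∧ u < a then (q ^ s * q⁻¹ ^ v - 1) * coef a q m (u - 1) v else 0 := by
  have e : tau₁ a q s • m = q ^ s • (m * x a q) - x a q * m := by
    rw [tau₁, ← smul_tmul_right, sub_smul, tmul_smul, tmul_smul, one_mul, mul_one, mul_smul_comm]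
  rw [e, map_sub, map_smul, Pi.sub_apply, Pi.sub_apply, Pi.smul_apply, Pi.smul_apply,
    coef_mul_x ha hq, coef_x_mul ha hq, opX_apply]
  split_ifs
  · simp only [smul_eq_mul]; ring
  · simp

theorem coef_gamma₂_smul_eq_sum (s : ℕ) (m : Alg k a q) (u v : ℕ) :
    coef a q (gamma₂ a q s • m) u v =
      if v + 1 = a then (∑ j ∈ Finset.range a, (q ^ s * q⁻¹ ^ u) ^ j) * coef a q m u 0 else 0 := by
  have e : gamma₂ a q s • m
      = ∑ j ∈ Finset.range a, q ^ (j * s) • (y a q ^ j * m * y a q ^ (a - 1 - j)) := by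
    rw [gamma₂, Finset.sum_smul]
    refine Finset.sum_congr rfl fun j _ => ?_
    rw [← smul_tmul_left, tmul_smul, smul_mul_assoc, smul_mul_assoc]
  rw [e, map_sum, Finset.sum_apply, Finset.sum_apply, Finset.sum_mul]
  split_ifs with h
  · refine Finset.sum_congr rfl fun j hj => ?_
    rw [Finset.mem_range] at hj
    rw [map_smul, Pi.smul_apply, Pi.smul_apply, coef_mul_y_pow ha hq, if_pos (by omega),
      coef_y_pow_mul ha hq, if_pos (by omega), show v - (a - 1 - j) - j = 0 by omega, smul_eq_mul,
      mul_pow, ← pow_mul, ← pow_mul, mul_comm j, mul_assoc]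
  · refine Finset.sum_eq_zero fun j hj => ?_
    rw [Finset.mem_range] at hj
    rw [map_smul, Pi.smul_apply, Pi.smul_apply, coef_mul_y_pow ha hq]
    split_ifs with h1
    · rw [coef_y_pow_mul ha hq, if_neg (by omega), smul_zero]
    · rw [smul_zero]

theorem coef_gamma₁_smul_eq_sum (s : ℕ) (m : Alg k a q) (u v : ℕ) :
    coef a q (gamma₁ a q s • m) u v =
      if u + 1 = a then (∑ j ∈ Finset.range a, (q ^ s * q⁻¹ ^ v) ^ j) * coef a q m 0 v else 0 := by
  have e : gamma₁ a q s • m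
      = ∑ j ∈ Finset.range a, q ^ (j * s) • (x a q ^ (a - 1 - j) * m * x a q ^ j) := by
    rw [gamma₁, Finset.sum_smul]
    refine Finset.sum_congr rfl fun j _ => ?_
    rw [← smul_tmul_left, tmul_smul, smul_mul_assoc, smul_mul_assoc]
  rw [e, map_sum, Finset.sum_apply, Finset.sum_apply, Finset.sum_mul]
  split_ifs with h
  · refine Finset.sum_congr rfl fun j hj => ?_
    rw [Finset.mem_range] at hj
    rw [map_smul, Pi.smul_apply, Pi.smul_apply, coef_mul_x_pow ha hq, if_pos (by omega),
      coef_x_pow_mul ha hq, if_pos (by omega), show u - j - (a - 1 - j) = 0 by omega, smul_eq_mul,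
      mul_pow, ← pow_mul, ← pow_mul, mul_comm j, mul_assoc]
  · refine Finset.sum_eq_zero fun j hj => ?_
    rw [Finset.mem_range] at hj
    rw [map_smul, Pi.smul_apply, Pi.smul_apply, coef_mul_x_pow ha hq]
    split_ifs with h1
    · rw [coef_x_pow_mul ha hq, if_neg (by omega), mul_zero, smul_zero]
    · rw [smul_zero]

end

theorem mul_inv_pow_eq_one_iff (hq : IsPrimitiveRoot q a) {s u : ℕ} (hs : s < a) (hu : u < a) :
    q ^ s * q⁻¹ ^ u = 1 ↔ u = s := by
  have h0 : q ≠ 0 := hq.ne_zero (by omega)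
  rw [inv_pow, mul_inv_eq_one₀ (pow_ne_zero _ h0)]
  exact ⟨fun h => (hq.pow_inj hs hu h).symm, fun h => by rw [h]⟩

/-- An a-th root of unity other than 1 has vanishing power sum. As a result γ₁(s) and γ₂(s) act on A
with rank at most one, for s < a. -/
theorem geom_sum_root (hq : IsPrimitiveRoot q a) {s u : ℕ} (hs : s < a) (hu : u < a) :
    ∑ j ∈ Finset.range a, (q ^ s * q⁻¹ ^ u) ^ j = if u = s then (a : k) else 0 := by
  split_ifs with h
  · rw [(mul_inv_pow_eq_one_iff hq hs hu).2 h]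
    simp
  · have h1 : q ^ s * q⁻¹ ^ u ≠ 1 := fun h' => h ((mul_inv_pow_eq_one_iff hq hs hu).1 h')
    rw [geom_sum_eq h1, mul_pow, ← pow_mul, ← pow_mul, mul_comm s, mul_comm u, pow_mul, pow_mul,
      inv_pow, hq.pow_eq_one]
    simp

theorem coef_gamma₂_smul (hq : IsPrimitiveRoot q a) {s : ℕ} (hs : s < a) (m : Alg k a q)
    (u v : ℕ) : coef a q (gamma₂ a q s • m) u v =
      if v + 1 = a ∧ u = s then (a : k) * coef a q m s 0 else 0 := by
  have ha : 0 < a := by omega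
  have h0 : q ≠ 0 := hq.ne_zero ha.ne'
  rw [coef_gamma₂_smul_eq_sum ha h0, ite_and]
  split_ifs with h1 h2
  · rw [geom_sum_root hq hs (by omega), if_pos h2, h2]
  · by_cases hu : u < a
    · rw [geom_sum_root hq hs hu, if_neg h2, zero_mul]
    · rw [coef_out ha h0 (by omega), mul_zero]
  · rfl

theorem coef_gamma₁_smul (hq : IsPrimitiveRoot q a) {s : ℕ} (hs : s < a) (m : Alg k a q)
    (u v : ℕ) : coef a q (gamma₁ a q s • m) u v =
      if u + 1 = a ∧ v = s then (a : k) * coef a q m 0 s else 0 := by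
  have ha : 0 < a := by omega
  have h0 : q ≠ 0 := hq.ne_zero ha.ne'
  rw [coef_gamma₁_smul_eq_sum ha h0, ite_and]
  split_ifs with h1 h2
  · rw [geom_sum_root hq hs (by omega), if_pos h2, h2]
  · by_cases hv : v < a
    · rw [geom_sum_root hq hs hv, if_neg h2, zero_mul]
    · rw [coef_out ha h0 (by omega), mul_zero]
  · rfl

variable (a q) in
/-- The element of `A` with the given coefficients. -/
def ofCoef (f : ℕ → ℕ → k) : Alg k a q :=
  ∑ u ∈ Finset.range a, ∑ v ∈ Finset.range a, f u v • (x a q ^ u * y a q ^ v)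

theorem coef_ofCoef (ha : 0 < a) (hq : q ≠ 0) (f : ℕ → ℕ → k) {u v : ℕ} (hu : u < a) (hv : v < a) :
    coef a q (ofCoef a q f) u v = f u v := by
  simp only [ofCoef, map_sum, map_smul, Finset.sum_apply, Pi.smul_apply, coef_mono ha hq,
    smul_eq_mul, mul_ite, mul_one, mul_zero]
  rw [Finset.sum_eq_single_of_mem u (by simpa), Finset.sum_eq_single_of_mem v (by simpa),
    if_pos (by omega)]
  · intro v' _ hv'
    rw [if_neg (by omega)]
  · intro u' _ hu'
    exact Finset.sum_eq_zero fun v' _ => if_neg (by omega)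

/-- The value of `p ∘ d` on generators. -/
theorem comp_d_gen (hq : q ^ a = 1) {n : ℕ} (p : P a q n →ₗ[Env k a q] Alg k a q) {i : ℕ}
    (hi : i ≤ n + 1) : p (d a q n (gen a q (n + 1) i))
      = vC a q (n + 1 - i) i • p (gen a q n i) + hC a q (n + 1 - i) i • p (gen a q n (i - 1)) := by
  rw [d_gen a q n hi, dGen_eq hq hi, map_add, map_smul, map_smul]

variable (a q) in
/-- The socle part of the classes in even degrees: `x ^ (a - 1) y ^ (a - 1)` at the even
generators and `x y` at the odd ones. -/
def etaVal (i : ℕ) : Alg k a q :=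
  if Even i then x a q ^ (a - 1) * y a q ^ (a - 1) else x a q * y a q

variable (a) in
/-- The exponent of `x` and `y` in `etaVal`. -/
def etaExp (i : ℕ) : ℕ := if Even i then a - 1 else 1

theorem etaVal_eq (i : ℕ) : etaVal a q i = x a q ^ etaExp a i * y a q ^ etaExp a i := by
  unfold etaVal etaExp
  split_ifs <;> simp

section Cocycle

variable {n : ℕ} (hn : Even n) (hq : IsPrimitiveRoot q a) (ha : 3 ≤ a)
include hn hq

theorem even_cocycle (p : P a q n →ₗ[Env k a q] Alg k a q) (hp : p ∘ₗ d a q n = 0) {i : ℕ}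
    (hi : Even i) (hin : i ≤ n) :
    tau₂ a q 0 • p (gen a q n i) + gamma₁ a q 1 • p (gen a q n (i - 1)) = 0 ∧
      -(gamma₂ a q 1 • p (gen a q n (i + 1))) + tau₁ a q 0 • p (gen a q n i) = 0 := by
  have h1 := comp_d_gen hq.pow_eq_one p (i := i) (by omega)
  have h2 := comp_d_gen hq.pow_eq_one p (i := i + 1) (by omega)
  rw [← LinearMap.comp_apply, hp, LinearMap.zero_apply] at h1 h2
  have e1 : ¬ Even (n + 1 - i) := by
    rw [Nat.even_sub (by omega)]
    simp [Nat.even_add_one, hn, hi]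
  have e2 : Even (n + 1 - (i + 1)) := by
    rw [Nat.even_sub (by omega)]
    simp [Nat.even_add_one, hn, hi]
  constructor
  · simpa [vC, hC, hi, e1] using h1.symm
  · have e3 : ¬ Even (i + 1) := by simpa [Nat.even_add_one] using hi
    simp only [vC, hC, e3, e2, if_true, if_false, neg_smul] at h2
    rw [h2]
    simp

include ha in
/-- The coefficients of the even values of a cocycle. -/
theorem coef_even_cocycle (p : P a q n →ₗ[Env k a q] Alg k a q) (hp : p ∘ₗ d a q n = 0) {i : ℕ}
    (hi : Even i) (hin : i ≤ n) :
    (∀ u v, u < a → v < a → ¬ (u = 0 ∧ v = 0) → ¬ (u = a - 1 ∧ v = a - 1) →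
      ¬ (u = a - 1 ∧ v = 0) → ¬ (u = 0 ∧ v = a - 1) → coef a q (p (gen a q n i)) u v = 0) ∧
    (1 - q) * coef a q (p (gen a q n i)) (a - 1) 0
      + a * coef a q (p (gen a q n (i - 1))) 0 1 = 0 ∧
    -(a * coef a q (p (gen a q n (i + 1))) 1 0)
      + (q - 1) * coef a q (p (gen a q n i)) 0 (a - 1) = 0 := by
  have ha0 : 0 < a := by omega
  have hq0 : q ≠ 0 := hq.ne_zero ha0.ne'
  have hqa : q⁻¹ ^ (a - 1) = q := by
    rw [inv_pow]
    exact inv_eq_of_mul_eq_one_right (by rw [← pow_succ, Nat.sub_add_cancel ha0, hq.pow_eq_one])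
  obtain ⟨h1, h2⟩ := even_cocycle hn hq p hp hi hin
  have h1' : ∀ u v, coef a q (tau₂ a q 0 • p (gen a q n i)) u v
      + coef a q (gamma₁ a q 1 • p (gen a q n (i - 1))) u v = 0 := fun u v => by
    have := congrFun (congrFun (congrArg (coef a q) h1) u) v
    simpa using this
  have h2' : ∀ u v, -coef a q (gamma₂ a q 1 • p (gen a q n (i + 1))) u v
      + coef a q (tau₁ a q 0 • p (gen a q n i)) u v = 0 := fun u v => by
    have := congrFun (congrFun (congrArg (coef a q) h2) u) v
    simpa using this
  simp only [coef_tau₂_smul ha0 hq0, coef_gamma₁_smul hq (show 1 < a by omega),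
    coef_tau₁_smul ha0 hq0, coef_gamma₂_smul hq (show 1 < a by omega), pow_zero, one_mul] at h1' h2'
  refine ⟨fun u v hu hv c1 c2 c3 c4 => ?_, ?_, ?_⟩
  -- The τ₂ equation kills the coefficients with u ≠ 0 and v < a - 1, the τ₁ equation the others.
  -- The exceptions are 1 and the socle, which neither sees, and the two corners where a γ term
  -- interferes.
  · by_cases hc : u ≠ 0 ∧ v + 1 < a
    · have := h1' u (v + 1)
      rw [if_pos (by omega), if_neg (by omega), add_zero, Nat.add_sub_cancel] at this
      refine (mul_eq_zero.1 this).resolve_left fun h => hc.1 ?_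
      rw [sub_eq_zero] at h
      exact (mul_inv_pow_eq_one_iff hq (s := 0) ha0 hu).1 (by rw [pow_zero, one_mul, ← h])
    · have := h2' (u + 1) v
      rw [if_neg (by omega), if_pos (by omega), neg_zero, zero_add, Nat.add_sub_cancel] at this
      refine (mul_eq_zero.1 this).resolve_left fun h => ?_
      rw [sub_eq_zero] at h
      have := (mul_inv_pow_eq_one_iff hq (s := 0) ha0 hv).1 (by rw [pow_zero, one_mul, h])
      omega
  · have := h1' (a - 1) 1
    rwa [if_pos (by omega), if_pos (by omega), hqa, Nat.sub_self] at this
  · have := h2' 1 (a - 1)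
    rwa [if_pos (by omega), if_pos (by omega), hqa, Nat.sub_self] at this

end Cocycle

/-- The values on generators of a cochain whose coboundary is the inessential part of the
cocycle `p`. -/
def primitive {n : ℕ} (p : P a q n →ₗ[Env k a q] Alg k a q) (i : ℤ) : Alg k a q :=
  if Even i then
    -- Only the monomials x^(u+1) and x y^v of the odd value above are treated here; the rest is
    -- reached through τ₂ in the other branch. At v = 1 the denominator is zero and the quotient is
    -- 0 by convention, which skips xy.
    ofCoef a q fun u v => if v = 0 ∨ u = 0 then
      coef a q (p (gen a q n (i + 1))) (u + 1) v / (q * q⁻¹ ^ v - 1) else 0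
  else
    ofCoef a q fun u v => if u = 1 then 0 else
      -(coef a q (p (gen a q n i)) u (v + 1) / (1 - q * q⁻¹ ^ u))

theorem primitive_eq_zero {n : ℕ} (p : P a q n →ₗ[Env k a q] Alg k a q) {i : ℤ}
    (h : p (gen a q n (if Even i then i + 1 else i)) = 0) : primitive p i = 0 := by
  unfold primitive
  split_ifs with hi
  · rw [if_pos hi] at h
    simp [h, ofCoef]
  · rw [if_neg hi] at h
    simp [h, ofCoef]

section Cocycle

variable {n : ℕ} (hn : Even n) (hq : IsPrimitiveRoot q a) (ha : 3 ≤ a)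
include hn hq ha

/-- At x^(a-1) and y^(a-1) the cocycle relations and the γ terms express the same thing: a times a
neighbouring odd coefficient, divided by ±(q - 1). Hence no division by a occurs. -/
theorem cocycle_even_eq (p : P a q n →ₗ[Env k a q] Alg k a q) (hp : p ∘ₗ d a q n = 0) {i : ℕ}
    (hi : Even i) (hin : i ≤ n) :
    p (gen a q n i) = coef a q (p (gen a q n i)) 0 0 • 1
      + coef a q (p (gen a q n i)) (a - 1) (a - 1) • (x a q ^ (a - 1) * y a q ^ (a - 1))
      + (gamma₂ a q 0 • primitive p i + gamma₁ a q 0 • primitive p (i - 1)) := by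
  have ha0 : 0 < a := by omega
  have hq0 : q ≠ 0 := hq.ne_zero ha0.ne'
  have hq1 : q - 1 ≠ 0 := sub_ne_zero.2 (hq.ne_one (by omega))
  have hq2 : 1 - q ≠ 0 := sub_ne_zero.2 (hq.ne_one (by omega)).symm
  obtain ⟨h0, h1, h2⟩ := coef_even_cocycle hn hq ha p hp hi hin
  have hiZ : Even (i : ℤ) := by exact_mod_cast hi
  have hiZ' : ¬ Even ((i : ℤ) - 1) := by simpa [Int.even_sub_one] using hiZ
  have e1 : coef a q (primitive p i) 0 0 = coef a q (p (gen a q n (i + 1))) 1 0 / (q - 1) := by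
    rw [primitive, if_pos hiZ, coef_ofCoef ha0 hq0 _ ha0 ha0]
    simp
  have e2 : coef a q (primitive p (i - 1)) 0 0
      = -(coef a q (p (gen a q n (i - 1))) 0 1 / (1 - q)) := by
    rw [primitive, if_neg hiZ', coef_ofCoef ha0 hq0 _ ha0 ha0]
    simp
  refine alg_ext ha0 hq0 fun u v hu hv => ?_
  simp only [map_add, map_smul, Pi.add_apply, Pi.smul_apply, coef_one ha0 hq0, coef_mono ha0 hq0,
    coef_gamma₂_smul hq ha0, coef_gamma₁_smul hq ha0, e1, e2, smul_eq_mul]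
  by_cases c1 : u = 0 ∧ v = 0
  · obtain ⟨rfl, rfl⟩ := c1
    rw [if_pos (by omega), if_neg (by omega), if_neg (by omega), if_neg (by omega)]
    ring
  by_cases c2 : u = a - 1 ∧ v = a - 1
  · obtain ⟨rfl, rfl⟩ := c2
    rw [if_neg (by omega), if_pos (by omega), if_neg (by omega), if_neg (by omega)]
    ring
  by_cases c3 : u = a - 1 ∧ v = 0
  · obtain ⟨rfl, rfl⟩ := c3
    rw [if_neg (by omega), if_neg (by omega), if_neg (by omega), if_pos (by omega)]
    field_simp
    linear_combination h1
  by_cases c4 : u = 0 ∧ v = a - 1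
  · obtain ⟨rfl, rfl⟩ := c4
    rw [if_neg (by omega), if_neg (by omega), if_pos (by omega), if_neg (by omega)]
    field_simp
    linear_combination h2
  rw [h0 u v hu hv c1 c2 c3 c4, if_neg (by omega), if_neg (by omega), if_neg (by omega),
    if_neg (by omega)]
  ring

end Cocycle

/-- No cocycle condition enters: τ₂(1) reaches all monomials with v ≥ 1, u ≠ 1, and τ₁(1) all those
with u ≥ 1, v ≠ 1, so only 1 and xy are left over. -/
theorem cocycle_odd_eq (hq : IsPrimitiveRoot q a) (ha : 3 ≤ a) {n : ℕ} (p : P a q n →ₗ[Env k a q] Alg k a q) {i : ℕ} (hi : ¬ Even i) :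
    p (gen a q n i) = coef a q (p (gen a q n i)) 0 0 • 1
      + coef a q (p (gen a q n i)) 1 1 • (x a q * y a q)
      + (-(tau₂ a q 1 • primitive p i) + tau₁ a q 1 • primitive p (i - 1)) := by
  have ha0 : 0 < a := by omega
  have hq0 : q ≠ 0 := hq.ne_zero ha0.ne'
  have hiZ : ¬ Even (i : ℤ) := by exact_mod_cast hi
  have hiZ' : Even ((i : ℤ) - 1) := by simpa [Int.even_sub_one] using hiZ
  have hxy : x a q * y a q = x a q ^ 1 * y a q ^ 1 := by simp
  refine alg_ext ha0 hq0 fun u v hu hv => ?_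
  simp only [map_add, map_smul, map_neg, Pi.add_apply, Pi.smul_apply, Pi.neg_apply,
    coef_one ha0 hq0, hxy, coef_mono ha0 hq0, coef_tau₂_smul ha0 hq0, coef_tau₁_smul ha0 hq0,
    smul_eq_mul, pow_one]
  have hne : ∀ w, w < a → w ≠ 1 → q * q⁻¹ ^ w - 1 ≠ 0 := fun w hw hw1 h =>
    hw1 ((mul_inv_pow_eq_one_iff hq (s := 1) (by omega) hw).1 (by
      rw [pow_one]; exact sub_eq_zero.1 h))
  have hne' : ∀ w, w < a → w ≠ 1 → 1 - q * q⁻¹ ^ w ≠ 0 := fun w hw hw1 h =>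
    hne w hw hw1 (by rw [← neg_sub, h, neg_zero])
  have E1 : (if 1 ≤ v ∧ v < a then (1 - q * q⁻¹ ^ u) * coef a q (primitive p i) u (v - 1) else 0)
      = if 1 ≤ v ∧ u ≠ 1 then -coef a q (p (gen a q n i)) u v else 0 := by
    by_cases hv1 : 1 ≤ v
    · rw [if_pos ⟨hv1, hv⟩, primitive, if_neg hiZ, coef_ofCoef ha0 hq0 _ hu (by omega),
        Nat.sub_add_cancel hv1]
      by_cases hu1 : u = 1
      · simp [hu1]
      · have := hne' u hu hu1
        rw [if_neg hu1, if_pos ⟨hv1, hu1⟩, mul_neg, mul_div_cancel₀ _ this]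
    · rw [if_neg (by omega), if_neg (by omega)]
  have E2 : (if 1 ≤ u ∧ u < a then
        (q * q⁻¹ ^ v - 1) * coef a q (primitive p (i - 1)) (u - 1) v else 0)
      = if 1 ≤ u ∧ (v = 0 ∨ u = 1) ∧ v ≠ 1 then coef a q (p (gen a q n i)) u v else 0 := by
    by_cases hu1 : 1 ≤ u
    · rw [if_pos ⟨hu1, hu⟩, primitive, if_pos hiZ', coef_ofCoef ha0 hq0 _ (by omega) hv,
        Nat.sub_add_cancel hu1, sub_add_cancel]
      by_cases hv1 : v = 1
      · subst hv1
        rw [if_neg (c := 1 ≤ u ∧ _) (by omega)]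
        simp [hq0]
      · have := hne v hv hv1
        by_cases hc : v = 0 ∨ u = 1
        · rw [if_pos (by omega), if_pos ⟨hu1, hc, hv1⟩, mul_div_cancel₀ _ this]
        · rw [if_neg (by omega), if_neg (by omega), mul_zero]
    · rw [if_neg (by omega), if_neg (by omega)]
  rw [E1, E2]
  by_cases c1 : u = 0 ∧ v = 0
  · obtain ⟨rfl, rfl⟩ := c1
    rw [if_pos (by omega), if_neg (by omega), if_neg (by omega), if_neg (by omega)]
    ring
  by_cases c2 : u = 1 ∧ v = 1
  · obtain ⟨rfl, rfl⟩ := c2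
    rw [if_neg (by omega), if_pos (by omega), if_neg (by omega), if_neg (by omega)]
    ring
  by_cases c3 : 1 ≤ v ∧ u ≠ 1
  · rw [if_neg (by omega), if_neg (by omega), if_pos c3, if_neg (by omega)]
    ring
  · rw [if_neg (by omega), if_neg (by omega), if_neg c3, if_pos (by omega)]
    ring

end QCI

/-! ### Coboundaries and the vanishing criterion -/

namespace QCI

variable {k : Type u} [Field k] {a : ℕ} {q : k}

theorem single_eq_gen {n : ℕ} (i : Fin (n + 1)) :
    (Pi.single i 1 : P a q n) = gen a q n ((i : ℕ) : ℤ) := by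
  funext j
  simp [gen, Pi.single_apply, Fin.ext_iff]

theorem ext_gen {n : ℕ} {M : Type*} [AddCommMonoid M] [Module (Env k a q) M]
    {p p' : P a q n →ₗ[Env k a q] M}
    (h : ∀ i : ℕ, i ≤ n → p (gen a q n i) = p' (gen a q n i)) : p = p' := by
  refine LinearMap.pi_ext' fun i => LinearMap.ext_ring ?_
  simp only [LinearMap.comp_apply, LinearMap.single_apply, single_eq_gen]
  exact h i (by omega)

section Coboundary

variable {m : ℕ} (hm : Even (m + 1)) (hq : IsPrimitiveRoot q a)
include hm hq

/-- The value of a coboundary of even degree at the even generators. -/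
theorem coboundary_even (g : P a q m →ₗ[Env k a q] Alg k a q) {i : ℕ} (hi : Even i)
    (him : i ≤ m + 1) : (g ∘ₗ d a q m) (gen a q (m + 1) i)
      = gamma₂ a q 0 • g (gen a q m i) + gamma₁ a q 0 • g (gen a q m (i - 1)) := by
  have e : Even (m + 1 - i) := (Nat.even_sub him).2 (by simp [hm, hi])
  rw [LinearMap.comp_apply, comp_d_gen hq.pow_eq_one g him, vC, hC, if_pos hi, if_pos hi, if_pos e,
    if_pos e]

/-- The value of a coboundary of even degree at the odd generators. -/
theorem coboundary_odd (g : P a q m →ₗ[Env k a q] Alg k a q) {i : ℕ} (hi : ¬ Even i)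
    (him : i ≤ m + 1) : (g ∘ₗ d a q m) (gen a q (m + 1) i)
      = -(tau₂ a q 1 • g (gen a q m i)) + tau₁ a q 1 • g (gen a q m (i - 1)) := by
  have e : ¬ Even (m + 1 - i) := by rw [Nat.even_sub him]; simp [hm, hi]
  rw [LinearMap.comp_apply, comp_d_gen hq.pow_eq_one g him, vC, hC, if_neg hi, if_neg hi, if_neg e,
    if_neg e, neg_smul]

/-- At even generators γ₁(0) and γ₂(0) produce only x^(a-1) and y^(a-1). At odd ones τ₁(1) and τ₂(1)
raise an exponent, so they miss 1, and their scaling factors vanish at xy. -/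
theorem coef_coboundary (ha : 3 ≤ a) (g : P a q m →ₗ[Env k a q] Alg k a q) {i : ℕ}
    (him : i ≤ m + 1) : coef a q ((g ∘ₗ d a q m) (gen a q (m + 1) i)) 0 0 = 0 ∧
      coef a q ((g ∘ₗ d a q m) (gen a q (m + 1) i)) (etaExp a i) (etaExp a i) = 0 := by
  have ha0 : 0 < a := by omega
  have hq0 : q ≠ 0 := hq.ne_zero ha0.ne'
  by_cases hi : Even i
  · rw [coboundary_even hm hq g hi him, etaExp, if_pos hi]
    simp only [map_add, Pi.add_apply, coef_gamma₂_smul hq ha0, coef_gamma₁_smul hq ha0]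
    constructor
    · rw [if_neg (by omega), if_neg (by omega), add_zero]
    · rw [if_neg (by omega), if_neg (by omega), add_zero]
  · rw [coboundary_odd hm hq g hi him, etaExp, if_neg hi]
    simp only [map_add, map_neg, Pi.add_apply, Pi.neg_apply, coef_tau₂_smul ha0 hq0,
      coef_tau₁_smul ha0 hq0]
    simp [hq0]

theorem exists_comp_d_eq (ha : 3 ≤ a) (p : P a q (m + 1) →ₗ[Env k a q] Alg k a q)
    (hp : p ∘ₗ d a q (m + 1) = 0)
    (h0 : ∀ i : ℕ, i ≤ m + 1 → coef a q (p (gen a q (m + 1) i)) 0 0 = 0)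
    (h1 : ∀ i : ℕ, i ≤ m + 1 → coef a q (p (gen a q (m + 1) i)) (etaExp a i) (etaExp a i) = 0) :
    ∃ g : P a q m →ₗ[Env k a q] Alg k a q, g ∘ₗ d a q m = p := by
  have hm' : ¬ Even m := by simpa [Nat.even_add_one] using hm
  have hg : ∀ i : ℤ, -1 ≤ i → i ≤ m + 1 →
      cochain a q m (fun i => primitive p i) (gen a q m i) = primitive p i := by
    intro i hi hi'
    -- At i = -1 and i = m + 1 the generator is zero, and so is `primitive`, since it reads p at a
    -- generator out of range.
    obtain rfl | rfl | h : i = -1 ∨ i = m + 1 ∨ (0 ≤ i ∧ i < m + 1) := by omega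
    · rw [gen_neg_one, map_zero, primitive_eq_zero]
      rw [if_neg (by decide), gen_neg_one, map_zero]
    · rw [gen_succ a q m rfl, map_zero, primitive_eq_zero]
      rw [if_pos (by exact_mod_cast hm), gen_succ a q (m + 1) (by push_cast; ring), map_zero]
    · lift i to ℕ using h.1
      exact cochain_gen a q m _ (⟨i, by omega⟩ : Fin (m + 1))
  refine ⟨cochain a q m fun i => primitive p i, ext_gen fun i hi => ?_⟩
  have e1 := hg i (by omega) (by omega)
  have e2 := hg (i - 1) (by omega) (by omega)
  by_cases hie : Even i
  · have h1' := h1 i hi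
    rw [etaExp, if_pos hie] at h1'
    rw [coboundary_even hm hq _ hie hi, e1, e2, cocycle_even_eq hm hq ha p hp hie hi, h0 i hi, h1',
      zero_smul, zero_smul, zero_add, zero_add]
  · have h1' := h1 i hi
    rw [etaExp, if_neg hie] at h1'
    rw [coboundary_odd hm hq _ hie hi, e1, e2, cocycle_odd_eq hq ha p hie, h0 i hi, h1',
      zero_smul, zero_smul, zero_add, zero_add]

end Coboundary

/-- In degree 0 both `primitive` terms of `cocycle_even_eq` refer to generators out of range, so a
cocycle is its essential part. -/
theorem eq_zero_of_coef_eq_zero (hq : IsPrimitiveRoot q a) (ha : 3 ≤ a)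
    (p : P a q 0 →ₗ[Env k a q] Alg k a q) (hp : p ∘ₗ d a q 0 = 0)
    (h0 : coef a q (p (gen a q 0 0)) 0 0 = 0)
    (h1 : coef a q (p (gen a q 0 0)) (a - 1) (a - 1) = 0) : p = 0 := by
  refine ext_gen fun i hi => ?_
  obtain rfl : i = 0 := by omega
  have h := cocycle_even_eq Even.zero hq ha p hp (i := 0) Even.zero le_rfl
  have e1 : primitive p 0 = 0 := primitive_eq_zero p (by
    rw [if_pos Even.zero, gen_succ a q 0 (by simp), map_zero])
  have e2 : primitive p (-1) = 0 := primitive_eq_zero p (by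
    rw [if_neg (by decide), gen_neg_one, map_zero])
  rw [Nat.cast_zero] at h ⊢
  rw [h, h0, h1, zero_sub, e1, e2]
  simp

theorem hhClass_zero_eq_zero_iff (hP : QuasiIso (augmentation a q))
    (p : P a q 0 →ₗ[Env k a q] Alg k a q) (hp : p ∘ₗ d a q 0 = 0) :
    hhClass hP p hp = 0 ↔ p = 0 := by
  refine ((resolution a q hP).extMk_zero_eq_zero_iff _ _).trans ⟨fun h => ?_, fun h => ?_⟩
  · exact congrArg ModuleCat.Hom.hom h
  · subst h
    rfl

theorem hhClass_eq_zero_iff (hP : QuasiIso (augmentation a q)) {m : ℕ}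
    (p : P a q (m + 1) →ₗ[Env k a q] Alg k a q) (hp : p ∘ₗ d a q (m + 1) = 0) :
    hhClass hP p hp = 0 ↔ ∃ g : P a q m →ₗ[Env k a q] Alg k a q, g ∘ₗ d a q m = p := by
  refine ((resolution a q hP).extMk_eq_zero_iff _ _ rfl _ m rfl).trans ⟨fun ⟨g, h⟩ => ?_,
    fun ⟨g, h⟩ => ⟨ModuleCat.ofHom g, ?_⟩⟩
  · change (complex a q).d (m + 1) m ≫ g = _ at h
    rw [complex_d] at h
    exact ⟨g.hom, congrArg ModuleCat.Hom.hom h⟩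
  · change (complex a q).d (m + 1) m ≫ _ = _
    rw [complex_d, ← h]
    rfl

/-- A cocycle of even degree without essential coefficients is a coboundary, and conversely. -/
theorem hhClass_eq_zero_iff_coef (hP : QuasiIso (augmentation a q)) (hq : IsPrimitiveRoot q a)
    (ha : 3 ≤ a) {n : ℕ} (hn : Even n) (p : P a q n →ₗ[Env k a q] Alg k a q)
    (hp : p ∘ₗ d a q n = 0) : hhClass hP p hp = 0 ↔
      ∀ i : ℕ, i ≤ n → coef a q (p (gen a q n i)) 0 0 = 0 ∧
        coef a q (p (gen a q n i)) (etaExp a i) (etaExp a i) = 0 := by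
  rcases n with _ | m
  · rw [hhClass_zero_eq_zero_iff]
    refine ⟨fun h i _ => by simp [h], fun h => ?_⟩
    exact eq_zero_of_coef_eq_zero hq ha p hp (h 0 le_rfl).1 (h 0 le_rfl).2
  · rw [hhClass_eq_zero_iff]
    refine ⟨?_, fun h => ?_⟩
    · rintro ⟨g, rfl⟩ i hi
      exact coef_coboundary hn hq ha g hi
    · exact exists_comp_d_eq hn hq ha p hp (fun i hi => (h i hi).1) fun i hi => (h i hi).2

end QCI

/-! ### Chain lifts with degree control, and squares of classes -/

namespace QCI

variable {k : Type u} [Field k] {a : ℕ} {q : k}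

variable (a q) in
/-- The decreasing filtration of `A` by total degree. -/
def AFil (e : ℤ) : Submodule k (Alg k a q) :=
  Submodule.span k {b | ∃ i j : ℕ, e ≤ i + j ∧ b = x a q ^ i * y a q ^ j}

theorem mono_mem_AFil {e : ℤ} {i j : ℕ} (h : e ≤ i + j) : x a q ^ i * y a q ^ j ∈ AFil a q e :=
  Submodule.subset_span ⟨i, j, h, rfl⟩

theorem coef_eq_zero_of_mem_AFil (ha : 0 < a) (hq : q ≠ 0) {e : ℤ} {b : Alg k a q}
    (hb : b ∈ AFil a q e) {u v : ℕ} (h : (u + v : ℤ) < e) : coef a q b u v = 0 := by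
  induction hb using Submodule.span_induction with
  | mem b hb =>
    obtain ⟨i, j, h', rfl⟩ := hb
    rw [coef_mono ha hq, if_neg (by omega)]
  | zero => simp
  | add _ _ _ _ h1 h2 => rw [map_add, Pi.add_apply, Pi.add_apply, h1, h2, add_zero]
  | smul r _ _ h1 => rw [map_smul, Pi.smul_apply, Pi.smul_apply, h1, smul_zero]

theorem smul_env_smul (r : k) (z : Env k a q) (b : Alg k a q) : (r • z) • b = r • (z • b) := by
  have e : ∀ c : Alg k a q, r • c = (r • (1 : Env k a q)) • c := fun c => by
    rw [← tmul_one_one, ← smul_tmul_left, tmul_smul, mul_one, smul_mul_assoc, one_mul]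
  rw [e, smul_smul, smul_mul_assoc, one_mul]

theorem env_smul_smul (r : k) (z : Env k a q) (b : Alg k a q) : z • (r • b) = r • (z • b) := by
  have e : ∀ c : Alg k a q, r • c = (r • (1 : Env k a q)) • c := fun c => by
    rw [smul_env_smul, one_smul]
  rw [e, smul_smul, mul_smul_comm, mul_one, smul_env_smul]

theorem smul_mem_AFil (hq : q ≠ 0) {e e' : ℤ} {z : Env k a q} {b : Alg k a q}
    (hz : z ∈ Fil a q e) (hb : b ∈ AFil a q e') : z • b ∈ AFil a q (e + e') := by
  induction hz using Submodule.span_induction with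
  | mem z hz =>
    obtain ⟨i, j, l, m, h, rfl⟩ := hz
    induction hb using Submodule.span_induction with
    | mem b hb =>
      obtain ⟨i', j', h', rfl⟩ := hb
      rw [tmul_smul, mono_mul_mono hq, smul_mul_assoc, mono_mul_mono hq]
      exact Submodule.smul_mem _ _ (Submodule.smul_mem _ _ (mono_mem_AFil (by push_cast; omega)))
    | zero => simp
    | add _ _ _ _ h1 h2 => rw [smul_add]; exact Submodule.add_mem _ h1 h2
    | smul r _ _ h1 => rw [env_smul_smul]; exact Submodule.smul_mem _ _ h1
  | zero => simp
  | add _ _ _ _ h1 h2 => rw [add_smul]; exact Submodule.add_mem _ h1 h2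
  | smul r _ _ h1 => rw [smul_env_smul]; exact Submodule.smul_mem _ _ h1

theorem tmul_one_mem_Fil {e : ℤ} {b : Alg k a q} (hb : b ∈ AFil a q e) : tmul b 1 ∈ Fil a q e := by
  induction hb using Submodule.span_induction with
  | mem b hb =>
    obtain ⟨i, j, h, rfl⟩ := hb
    simpa using mono_mem_Fil (a := a) (q := q) (i := i) (j := j) (l := 0) (m := 0) (by simpa using h)
  | zero => simp [tmul_zero_left]
  | add b c _ _ h1 h2 =>
    rw [show tmul (b + c) (1 : Alg k a q) = tmul b 1 + tmul c 1 from TensorProduct.add_tmul _ _ _]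
    exact Submodule.add_mem _ h1 h2
  | smul r _ _ h1 => rw [smul_tmul_left]; exact Submodule.smul_mem _ _ h1

theorem smul_mem_PFil (hq : q ≠ 0) {n : ℕ} {e e' : ℤ} {z : Env k a q} {v : P a q n}
    (hz : z ∈ Fil a q e) (hv : v ∈ PFil a q n e') : z • v ∈ PFil a q n (e + e') := fun i =>
  mul_mem_Fil' hq hz (hv i) (by omega)

/-- A linear map which raises the degree of the generators by `D` raises all degrees by `D`. -/
theorem map_mem_of_gen {M : Type*} [AddCommGroup M] [Module (Env k a q) M] [Module k M]
    {F : ℤ → Submodule k M}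
    (hF : ∀ {e e' : ℤ} {z : Env k a q} {b : M}, z ∈ Fil a q e → b ∈ F e' → z • b ∈ F (e + e'))
    {n : ℕ} {D : ℤ} (f : P a q n →ₗ[Env k a q] M)
    (hf : ∀ i : ℕ, i ≤ n → f (gen a q n i) ∈ F (wt a (n - i) + wt a i + D)) {e : ℤ} {v : P a q n}
    (hv : v ∈ PFil a q n e) : f v ∈ F (e + D) := by
  have e1 : v = ∑ i, v i • gen a q n ((i : ℕ) : ℤ) := by
    simp_rw [← single_eq_gen]
    exact (pi_eq_sum_univ' v).trans (Finset.sum_congr rfl fun i _ => by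
      congr 1)
  rw [e1, map_sum]
  refine Submodule.sum_mem _ fun i _ => ?_
  rw [map_smul]
  have := hF (hv i) (hf i (by omega))
  rwa [show e - wt a (n - i) - wt a i + (wt a (n - i) + wt a i + D) = e + D by ring] at this

theorem tau₁_mem_Fil (s : ℕ) : tau₁ a q s ∈ Fil a q 1 :=
  Submodule.sub_mem _ (Submodule.smul_mem _ _ x_right_mem_Fil) x_left_mem_Fil

theorem tau₂_mem_Fil (s : ℕ) : tau₂ a q s ∈ Fil a q 1 :=
  Submodule.sub_mem _ y_right_mem_Fil (Submodule.smul_mem _ _ y_left_mem_Fil)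

theorem gamma₁_mem_Fil (hq : q ≠ 0) (s : ℕ) : gamma₁ a q s ∈ Fil a q (a - 1) := by
  rw [gamma₁_eq]
  refine Submodule.sum_mem _ fun j hj => Submodule.smul_mem _ _ ?_
  rw [Finset.mem_range] at hj
  exact mul_mem_Fil' hq (pow_mem_Fil hq x_left_mem_Fil _) (pow_mem_Fil hq x_right_mem_Fil _)
    (by omega)

theorem gamma₂_mem_Fil (hq : q ≠ 0) (s : ℕ) : gamma₂ a q s ∈ Fil a q (a - 1) := by
  rw [gamma₂_eq]
  refine Submodule.sum_mem _ fun j hj => Submodule.smul_mem _ _ ?_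
  rw [Finset.mem_range] at hj
  exact mul_mem_Fil' hq (pow_mem_Fil hq y_left_mem_Fil _) (pow_mem_Fil hq y_right_mem_Fil _)
    (by omega)

theorem vC_mem_Fil (hq : q ≠ 0) (r i : ℕ) : vC a q (r + 1) i ∈ Fil a q (wt a (r + 1) - wt a r) := by
  by_cases hr : Even r
  · rw [wt_even hr, add_sub_cancel_left]
    simp only [vC, Nat.even_add_one, hr, not_true, if_false]
    split_ifs
    · exact tau₂_mem_Fil _
    · exact Submodule.neg_mem _ (tau₂_mem_Fil _)
  · rw [wt_odd hr, add_sub_cancel_left]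
    simp only [vC, Nat.even_add_one, hr, not_false_eq_true, if_true]
    split_ifs
    · exact gamma₂_mem_Fil hq _
    · exact Submodule.neg_mem _ (gamma₂_mem_Fil hq _)

theorem hC_mem_Fil (hq : q ≠ 0) (r i : ℕ) : hC a q r (i + 1) ∈ Fil a q (wt a (i + 1) - wt a i) := by
  by_cases hi : Even i
  · rw [wt_even hi, add_sub_cancel_left]
    simp only [hC, Nat.even_add_one, hi, not_true, if_false]
    split_ifs <;> exact tau₁_mem_Fil _
  · rw [wt_odd hi, add_sub_cancel_left]
    simp only [hC, Nat.even_add_one, hi, not_false_eq_true, if_true]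
    split_ifs <;> exact gamma₁_mem_Fil hq _

theorem d_mem_PFil (hq : q ^ a = 1) (hq0 : q ≠ 0) {m : ℕ} {e : ℤ} {v : P a q (m + 1)}
    (hv : v ∈ PFil a q (m + 1) e) : d a q m v ∈ PFil a q m e := fun j => by
  rw [d_apply hq]
  have h1 := hv j.castSucc
  have h2 := hv j.succ
  rw [Fin.val_castSucc] at h1
  rw [Fin.val_succ, Nat.add_sub_add_right] at h2
  obtain ⟨r, hr⟩ : ∃ r, m - j = r := ⟨_, rfl⟩
  have hr' : m + 1 - j = r + 1 := by omega
  rw [hr'] at h1 ⊢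
  rw [hr] at h2 ⊢
  exact Submodule.add_mem _ (mul_mem_Fil' hq0 h1 (vC_mem_Fil hq0 _ _) (by omega))
    (mul_mem_Fil' hq0 h2 (hC_mem_Fil hq0 _ _) (by omega))

theorem gen_mem_PFil {n i : ℕ} : gen a q n i ∈ PFil a q n (wt a (n - i) + wt a i) := fun j => by
  rw [gen]
  split_ifs with h
  · rw [show (j : ℕ) = i by exact_mod_cast h]
    simpa using one_mem_Fil
  · exact Submodule.zero_mem _

theorem exists_linearMap {N m : ℕ} {M : Type*} [AddCommGroup M] [Module (Env k a q) M]
    (F : ℕ → Set (P a q m)) (f : P a q m →ₗ[Env k a q] M) (g : P a q N →ₗ[Env k a q] M)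
    (h : ∀ i : ℕ, i ≤ N → ∃ w ∈ F i, f w = g (gen a q N i)) :
    ∃ φ : P a q N →ₗ[Env k a q] P a q m, f ∘ₗ φ = g ∧ ∀ i : ℕ, i ≤ N → φ (gen a q N i) ∈ F i := by
  choose! w hw hw' using h
  have e : ∀ i : ℕ, i ≤ N →
      Fintype.linearCombination (Env k a q) (fun i : Fin (N + 1) => w i) (gen a q N i) = w i := by
    intro i hi
    have := single_eq_gen (a := a) (q := q) (⟨i, by omega⟩ : Fin (N + 1))
    rw [← this]
    simp
  refine ⟨Fintype.linearCombination (Env k a q) fun i : Fin (N + 1) => w i, ext_gen fun i hi => ?_,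
    fun i hi => ?_⟩
  · rw [LinearMap.comp_apply, e i hi, hw' i hi]
  · rw [e i hi]
    exact hw i hi

section Lift

variable {n : ℕ} (D : ℤ)

/-- A map `P (n + m) → P m` which raises degrees by `D` and extends to the next degree. -/
structure IsPartialLift (m : ℕ) (φ : P a q (n + m) →ₗ[Env k a q] P a q m) : Prop where
  gen_mem : ∀ i : ℕ, i ≤ n + m → φ (gen a q (n + m) i) ∈ PFil a q m (wt a (n + m - i) + wt a i + D)
  exists_d_eq : ∀ i : ℕ, i ≤ n + m + 1 →
    ∃ w ∈ PFil a q (m + 1) (wt a (n + m + 1 - i) + wt a i + D),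
      d a q m w = φ (d a q (n + m) (gen a q (n + m + 1) i))

variable {D} (ha : 0 < a) (hq : q ^ a = 1) (hq0 : q ≠ 0)
include ha hq hq0

/-- A value b lifts along `mu` to b ⊗ 1, which has the same degree; filtered exactness at P 0 gives
the extension property. -/
theorem IsPartialLift.zero {p : P a q n →ₗ[Env k a q] Alg k a q} (hp : p ∘ₗ d a q n = 0)
    (hpD : ∀ i : ℕ, i ≤ n → p (gen a q n i) ∈ AFil a q (wt a (n - i) + wt a i + D)) :
    ∃ φ : P a q (n + 0) →ₗ[Env k a q] P a q 0, IsPartialLift D 0 φ ∧ mu a q ∘ₗ φ = p := by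
  obtain ⟨φ, h1, h2⟩ := exists_linearMap (F := fun i => PFil a q 0 (wt a (n - i) + wt a i + D))
    (mu a q) p fun i hi => ⟨fun _ => tmul (p (gen a q n i)) 1, fun j => by
      obtain rfl : j = 0 := Fin.ext (by omega)
      simpa [wt_zero] using tmul_one_mem_Fil (hpD i hi), by
      rw [mu_apply, tmul_smul, mul_one, mul_one]⟩
  refine ⟨φ, ⟨h2, fun i hi => exact_d_zero ha hq ?_ ?_⟩, h1⟩
  · exact map_mem_of_gen (F := PFil a q 0) (smul_mem_PFil hq0) φ h2 (d_mem_PFil hq hq0 gen_mem_PFil)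
  · rw [← LinearMap.comp_apply, h1]
    exact LinearMap.congr_fun hp _

/-- The solutions recorded in `exists_d_eq` define the next map on generators. Then d ∘ d = 0 and
`exact_d` make the equation solvable one degree higher, with the same shift D. -/
theorem IsPartialLift.succ {m : ℕ} {φ : P a q (n + m) →ₗ[Env k a q] P a q m}
    (hφ : IsPartialLift D m φ) :
    ∃ ψ : P a q (n + (m + 1)) →ₗ[Env k a q] P a q (m + 1), IsPartialLift D (m + 1) ψ ∧
      d a q m ∘ₗ ψ = φ ∘ₗ d a q (n + m) := by
  obtain ⟨ψ, h1, h2⟩ := exists_linearMap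
    (F := fun i => PFil a q (m + 1) (wt a (n + m + 1 - i) + wt a i + D))
    (d a q m) (φ ∘ₗ d a q (n + m)) hφ.exists_d_eq
  refine ⟨ψ, ⟨h2, fun i hi => exact_d ha hq ?_ ?_⟩, h1⟩
  · exact map_mem_of_gen (F := PFil a q (m + 1)) (smul_mem_PFil hq0) ψ h2
      (d_mem_PFil hq hq0 gen_mem_PFil)
  · have := LinearMap.congr_fun h1 (d a q (n + m + 1) (gen a q (n + m + 2) i))
    rw [LinearMap.comp_apply] at this
    refine this.trans ?_
    have h3 := LinearMap.congr_fun (d_comp_d a q (n + m)) (gen a q (n + m + 2) i)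
    rw [LinearMap.comp_apply] at h3 ⊢
    rw [h3, LinearMap.zero_apply, map_zero]

/-- A cocycle which raises degrees by `D` lifts to a chain map which raises degrees by `D`. -/
theorem exists_lift {p : P a q n →ₗ[Env k a q] Alg k a q} (hp : p ∘ₗ d a q n = 0)
    (hpD : ∀ i : ℕ, i ≤ n → p (gen a q n i) ∈ AFil a q (wt a (n - i) + wt a i + D)) :
    ∃ φ : ∀ m, P a q (n + m) →ₗ[Env k a q] P a q m, mu a q ∘ₗ φ 0 = p ∧
      (∀ m, d a q m ∘ₗ φ (m + 1) = φ m ∘ₗ d a q (n + m)) ∧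
      ∀ m (i : ℕ), i ≤ n + m →
        φ m (gen a q (n + m) i) ∈ PFil a q m (wt a (n + m - i) + wt a i + D) := by
  obtain ⟨φ₀, h0, h0'⟩ := IsPartialLift.zero ha hq hq0 hp hpD
  choose f hf hf' using fun (m : ℕ) (φ : {φ : P a q (n + m) →ₗ[Env k a q] P a q m //
    IsPartialLift D m φ}) => IsPartialLift.succ ha hq hq0 φ.2
  let Φ : ∀ m, {φ : P a q (n + m) →ₗ[Env k a q] P a q m // IsPartialLift D m φ} :=
    fun m => Nat.rec ⟨φ₀, h0⟩ (fun m φ => ⟨f m φ, hf m φ⟩) m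
  exact ⟨fun m => (Φ m).1, h0', fun m => hf' m (Φ m), fun m => (Φ m).2.gen_mem⟩

end Lift

/-- The Yoneda product in terms of a lift of the first factor. -/
theorem hhClass_comp_hhClass (hP : QuasiIso (augmentation a q)) {n m : ℕ} (hn : Even n)
    {p : P a q n →ₗ[Env k a q] Alg k a q} (hp : p ∘ₗ d a q n = 0)
    {p' : P a q m →ₗ[Env k a q] Alg k a q} (hp' : p' ∘ₗ d a q m = 0)
    (φ : ∀ m, P a q (n + m) →ₗ[Env k a q] P a q m) (h0 : mu a q ∘ₗ φ 0 = p)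
    (hφ : ∀ m, d a q m ∘ₗ φ (m + 1) = φ m ∘ₗ d a q (n + m)) :
    (hhClass hP p hp).comp (hhClass hP p' hp') rfl = hhClass hP (p' ∘ₗ φ m) (by
      rw [LinearMap.comp_assoc, ← hφ, ← LinearMap.comp_assoc, hp', LinearMap.zero_comp]) := by
  refine (resolution a q hP).extMk_comp_extMk (resolution a q hP) hn
    (fun m => ModuleCat.ofHom (φ m)) (fun m => ?_) _ _ ?_ _ _ _
  · change (complex a q).d (n + m + 1) (n + m) ≫ _ = _ ≫ (complex a q).d (m + 1) m
    rw [complex_d, complex_d]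
    exact congrArg ModuleCat.ofHom (hφ m).symm
  · change _ ≫ (augmentation a q).f 0 = _
    rw [augmentation_f_zero]
    exact congrArg ModuleCat.ofHom h0

/-- All even generators of P (2t) have one common degree, and by `wt_add_wt_odd` so do all odd ones;
hence a single shift D serves for every η. -/
theorem wt_add_wt_even {t i : ℕ} (hi : Even i) (h : i ≤ 2 * t) :
    wt a (2 * t - i) + wt a i = a * t := by
  obtain ⟨j, rfl⟩ := hi
  obtain ⟨s, rfl⟩ : ∃ s, t = j + s := ⟨t - j, by omega⟩
  rw [wt, wt, show (2 * (j + s) - (j + j)) / 2 = s by omega, show (j + j) / 2 = j by omega,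
    show (2 * (j + s) - (j + j)) % 2 = 0 by omega, show (j + j) % 2 = 0 by omega]
  push_cast
  ring

theorem wt_add_wt_odd {t i : ℕ} (hi : Odd i) (h : i ≤ 2 * t) :
    wt a (2 * t - i) + wt a i = a * (t - 1) + 2 := by
  obtain ⟨j, rfl⟩ := hi
  obtain ⟨s, rfl⟩ : ∃ s, t = j + s + 1 := ⟨t - j - 1, by omega⟩
  rw [wt, wt, show (2 * (j + s + 1) - (2 * j + 1)) / 2 = s by omega,
    show (2 * j + 1) / 2 = j by omega,
    show (2 * (j + s + 1) - (2 * j + 1)) % 2 = 1 by omega, show (2 * j + 1) % 2 = 1 by omega]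
  push_cast
  ring

/-- A cocycle of high degree in even cohomological degree has square zero. -/
theorem hhClass_comp_self_eq_zero (hP : QuasiIso (augmentation a q)) (hq : IsPrimitiveRoot q a)
    (ha : 3 ≤ a) {t : ℕ} {p : P a q (2 * t) →ₗ[Env k a q] Alg k a q} (hp : p ∘ₗ d a q (2 * t) = 0)
    (hpD : ∀ i : ℕ, i ≤ 2 * t →
      p (gen a q (2 * t) i) ∈ AFil a q (wt a (2 * t - i) + wt a i + (a - a * t))) :
    (hhClass hP p hp).comp (hhClass hP p hp) rfl = 0 := by
  have ha0 : 0 < a := by omega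
  have hq0 : q ≠ 0 := hq.ne_zero ha0.ne'
  obtain ⟨φ, h0, hφ, hφD⟩ := exists_lift ha0 hq.pow_eq_one hq0 hp hpD
  rw [hhClass_comp_hhClass hP (even_two_mul t) hp hp φ h0 hφ,
    hhClass_eq_zero_iff_coef hP hq ha ((even_two_mul t).add (even_two_mul t))]
  intro i hi
  -- The cocycle and its lift each contribute a - at. In degree 4t this leaves filtration 2a > 2a -
  -- 2 at even generators and a + 2 > 2 at odd ones.
  have hc := map_mem_of_gen (F := AFil a q) (smul_mem_AFil hq0) p hpD (hφD (2 * t) i hi)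
  rw [LinearMap.comp_apply]
  by_cases hie : Even i
  · have e : wt a (2 * t + 2 * t - i) + wt a i + (a - a * t) + (a - a * t) = 2 * a := by
      rw [← mul_add, wt_add_wt_even hie (by omega)]
      push_cast
      ring
    rw [e] at hc
    rw [etaExp, if_pos hie]
    exact ⟨coef_eq_zero_of_mem_AFil ha0 hq0 hc (by omega),
      coef_eq_zero_of_mem_AFil ha0 hq0 hc (by omega)⟩
  · have e : wt a (2 * t + 2 * t - i) + wt a i + (a - a * t) + (a - a * t) = a + 2 := by
      rw [← mul_add, wt_add_wt_odd (Nat.not_even_iff_odd.1 hie) (by omega)]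
      push_cast
      ring
    rw [e] at hc
    rw [etaExp, if_neg hie]
    exact ⟨coef_eq_zero_of_mem_AFil ha0 hq0 hc (by omega),
      coef_eq_zero_of_mem_AFil ha0 hq0 hc (by omega)⟩

theorem hhNilpotent_of_comp_self_eq_zero {n : ℕ} {z : HH a q n} (h : z.comp z rfl = 0) :
    HHNilpotent z := by
  refine ⟨2, ?_⟩
  change ((Ext.mk₀ (𝟙 (algObj a q))).comp z _).comp z _ = 0
  rw [Ext.comp_assoc _ _ _ _ rfl (by ring), h, Ext.comp_zero]

/-- With the shift a - at the required degree is a at even generators and 2 at odd ones. The socle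
element has degree 2a - 2 ≥ a, and xy has degree exactly 2. -/
theorem etaVal_mem_AFil (ha : 3 ≤ a) {t i : ℕ} (hi : i ≤ 2 * t) :
    etaVal a q i ∈ AFil a q (wt a (2 * t - i) + wt a i + (a - a * t)) := by
  rw [etaVal_eq]
  refine mono_mem_AFil ?_
  by_cases hie : Even i
  · rw [wt_add_wt_even hie hi, etaExp, if_pos hie]
    push_cast [Nat.cast_sub (show 1 ≤ a by omega)]
    linarith
  · rw [wt_add_wt_odd (Nat.not_even_iff_odd.1 hie) hi, etaExp, if_neg hie]
    push_cast
    linarith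

end QCI

/-! ### The basis of essential classes -/

namespace QCI

variable {k : Type u} [Field k] {a : ℕ} {q : k}

theorem hhClass_congr (hP : QuasiIso (augmentation a q)) {n : ℕ}
    {p p' : P a q n →ₗ[Env k a q] Alg k a q} (hp : p ∘ₗ d a q n = 0) (h : p = p') :
    hhClass hP p hp = hhClass hP p' (h ▸ hp) := by
  subst h
  rfl

theorem hhClass_add (hP : QuasiIso (augmentation a q)) {n : ℕ}
    {p p' : P a q n →ₗ[Env k a q] Alg k a q} (hp : p ∘ₗ d a q n = 0) (hp' : p' ∘ₗ d a q n = 0) :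
    hhClass hP (p + p') (by rw [LinearMap.add_comp, hp, hp', add_zero])
      = hhClass hP p hp + hhClass hP p' hp' :=
  ((resolution a q hP).add_extMk (ModuleCat.ofHom p) (ModuleCat.ofHom p') _ _ _ _).symm

/-- The scalars of the module category act through A^e, those in `h` directly on A; the point is
that the two agree. -/
theorem hhClass_smul (hP : QuasiIso (augmentation a q)) {n : ℕ} (r : k)
    {p p' : P a q n →ₗ[Env k a q] Alg k a q} (hp : p ∘ₗ d a q n = 0) (hp' : p' ∘ₗ d a q n = 0)
    (h : ∀ v, p' v = r • p v) : hhClass hP p' hp' = r • hhClass hP p hp := by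
  refine Eq.trans ?_ ((resolution a q hP).extMk_smul (ModuleCat.ofHom p) _ r)
  have e : ModuleCat.ofHom p' = r • ModuleCat.ofHom p := by
    refine ModuleCat.hom_ext (LinearMap.ext fun v => ?_)
    change p' v = algebraMap k (Env k a q) r • p v
    rw [h, Algebra.algebraMap_eq_smul_one, smul_env_smul, one_smul]
  rw [hhClass]
  congr 1

theorem exists_hhClass_eq (hP : QuasiIso (augmentation a q)) {n : ℕ} (z : HH a q n) :
    ∃ (p : P a q n →ₗ[Env k a q] Alg k a q) (hp : p ∘ₗ d a q n = 0), hhClass hP p hp = z := by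
  obtain ⟨f, hf, rfl⟩ := (resolution a q hP).extMk_surjective z (n + 1) rfl
  refine ⟨f.hom, ?_, rfl⟩
  change (complex a q).d (n + 1) n ≫ f = 0 at hf
  rw [complex_d] at hf
  exact congrArg ModuleCat.Hom.hom hf

theorem cochain_apply_smul {n : ℕ} (r : k) (f : Fin (n + 1) → Alg k a q) (v : P a q n) :
    cochain a q n (r • f) v = r • cochain a q n f v := by
  simp [cochain, Fintype.linearCombination_apply, Finset.smul_sum, env_smul_smul]

theorem cochain_add {n : ℕ} (f g : Fin (n + 1) → Alg k a q) :
    cochain a q n (f + g) = cochain a q n f + cochain a q n g := by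
  refine LinearMap.ext fun v => ?_
  simp [cochain, Fintype.linearCombination_apply, Finset.sum_add_distrib]

/-- For even n, d meets the even generators of P n only with τ₁(0), τ₂(0) and the odd ones only with
γ₁(1), ±γ₂(1). Requiring each term to vanish separately is sufficient. -/
theorem comp_d_eq_zero_of_annihilated (hq : q ^ a = 1) {n : ℕ} (hn : Even n)
    (p : P a q n →ₗ[Env k a q] Alg k a q)
    (h0 : ∀ i : ℕ, i ≤ n → Even i →
      tau₁ a q 0 • p (gen a q n i) = 0 ∧ tau₂ a q 0 • p (gen a q n i) = 0)
    (h1 : ∀ i : ℕ, i ≤ n → ¬ Even i →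
      gamma₁ a q 1 • p (gen a q n i) = 0 ∧ gamma₂ a q 1 • p (gen a q n i) = 0) :
    p ∘ₗ d a q n = 0 := by
  have hv : ∀ i : ℕ, i ≤ n + 1 → vC a q (n + 1 - i) i • p (gen a q n i) = 0 := by
    intro i hi
    obtain rfl | hi' : i = n + 1 ∨ i ≤ n := by omega
    · rw [gen_succ a q n (by push_cast; rfl), map_zero, smul_zero]
    have e : Even (n + 1 - i) ↔ ¬ Even i := by
      rw [Nat.even_sub hi]
      simp [Nat.even_add_one, hn]
    by_cases hie : Even i
    · rw [vC, if_pos hie, if_neg (by simpa [e] using hie)]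
      exact (h0 i hi' hie).2
    · rw [vC, if_neg hie, if_pos (e.2 hie), neg_smul, (h1 i hi' hie).2, neg_zero]
  have hh : ∀ i : ℕ, i ≤ n + 1 → hC a q (n + 1 - i) i • p (gen a q n (i - 1)) = 0 := by
    intro i hi
    rcases i with _ | i
    · rw [gen_eq_zero a q (by simp), map_zero, smul_zero]
    have e : Even (n + 1 - (i + 1)) ↔ Even i := by
      rw [Nat.add_sub_add_right, Nat.even_sub (by omega)]
      simp [hn]
    rw [Nat.cast_succ, add_sub_cancel_right, hC]
    simp only [Nat.even_add_one]
    by_cases hie : Even i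
    · rw [if_neg (not_not.2 hie), if_pos (e.2 hie)]
      exact (h0 i (by omega) hie).1
    · rw [if_pos hie, if_neg (by rwa [e])]
      exact (h1 i (by omega) hie).1
  refine ext_gen fun i hi => ?_
  rw [LinearMap.comp_apply, comp_d_gen hq p hi, hv i hi, hh i hi, add_zero, LinearMap.zero_apply]

section Basis

variable {n : ℕ}

variable (a q) in
/-- The cochain with the given coefficients at `1` and at `etaVal`. -/
def essential (w : Fin (n + 1) ⊕ Fin (n + 1) → k) (i : Fin (n + 1)) : Alg k a q :=
  w (Sum.inl i) • 1 + w (Sum.inr i) • etaVal a q i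

theorem coef_essential (hq : q ≠ 0) (ha : 3 ≤ a) (w : Fin (n + 1) ⊕ Fin (n + 1) → k)
    (i : Fin (n + 1)) (u v : ℕ) : coef a q (essential a q w i) u v =
      (if u = 0 ∧ v = 0 then w (Sum.inl i) else 0)
        + if u = etaExp a i ∧ v = etaExp a i then w (Sum.inr i) else 0 := by
  have h : etaExp a i < a := by unfold etaExp; split_ifs <;> omega
  rw [essential, etaVal_eq, map_add, map_smul, map_smul, Pi.add_apply, Pi.add_apply, Pi.smul_apply,
    Pi.smul_apply, Pi.smul_apply, Pi.smul_apply, coef_one (by omega) hq, coef_mono (by omega) hq,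
    smul_eq_mul, smul_eq_mul, mul_ite, mul_ite, mul_one, mul_zero, mul_one, mul_zero]
  congr 1
  exact if_congr (by omega) rfl rfl

theorem cochain_gen_nat (f : Fin (n + 1) → Alg k a q) {i : ℕ} (hi : i ≤ n) :
    cochain a q n f (gen a q n i) = f ⟨i, by omega⟩ :=
  cochain_gen a q n f ⟨i, by omega⟩

/-- τ₁(0) and τ₂(0) act as commutators with x and y, up to sign, so they kill 1 and the socle. γ₁(1)
and γ₂(1) only read the coefficients of y and x, which 1 and xy lack. -/
theorem essential_comp_d (hq : IsPrimitiveRoot q a) (ha : 3 ≤ a) (hn : Even n)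
    (w : Fin (n + 1) ⊕ Fin (n + 1) → k) : cochain a q n (essential a q w) ∘ₗ d a q n = 0 := by
  have ha0 : 0 < a := by omega
  have hq0 : q ≠ 0 := hq.ne_zero ha0.ne'
  refine comp_d_eq_zero_of_annihilated hq.pow_eq_one hn _ (fun i hi hie => ?_) fun i hi hie => ?_
  · rw [cochain_gen_nat _ hi]
    have hE : etaExp a i = a - 1 := if_pos hie
    constructor <;> refine alg_ext ha0 hq0 fun u v hu hv => ?_
    · rw [coef_tau₁_smul ha0 hq0, coef_essential hq0 ha, map_zero]
      simp only [hE, Pi.zero_apply]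
      split_ifs with h1 h2 h3 h3
      all_goals first | omega | skip
      · rw [h2.2]; simp
      · simp
      · rfl
    · rw [coef_tau₂_smul ha0 hq0, coef_essential hq0 ha, map_zero]
      simp only [hE, Pi.zero_apply]
      split_ifs with h1 h2 h3 h3
      all_goals first | omega | skip
      · rw [h2.1]; simp
      · simp
      · rfl
  · rw [cochain_gen_nat _ hi]
    have hE : etaExp a i = 1 := if_neg hie
    constructor <;> refine alg_ext ha0 hq0 fun u v hu hv => ?_
    · rw [coef_gamma₁_smul hq (by omega), coef_essential hq0 ha, map_zero]
      simp [hE]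
    · rw [coef_gamma₂_smul hq (by omega), coef_essential hq0 ha, map_zero]
      simp [hE]

/-- The linear map sending a family of coefficients to the class of the corresponding cocycle. -/
def essentialClass (hP : QuasiIso (augmentation a q)) (hq : IsPrimitiveRoot q a) (ha : 3 ≤ a)
    (hn : Even n) : (Fin (n + 1) ⊕ Fin (n + 1) → k) →ₗ[k] HH a q n where
  toFun w := hhClass hP _ (essential_comp_d hq ha hn w)
  map_add' w w' := by
    rw [← hhClass_add]
    refine hhClass_congr hP _ ?_
    rw [← cochain_add]
    congr 1
    funext i
    simp only [essential, Pi.add_apply]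
    module
  map_smul' r w := by
    refine hhClass_smul hP r _ _ fun v => ?_
    rw [← cochain_apply_smul]
    congr 2
    funext i
    simp only [essential, Pi.smul_apply, smul_eq_mul]
    module

/-- Both halves follow from `hhClass_eq_zero_iff_coef`: for surjectivity, subtract from a cocycle
the essential one with the same two coefficients at each generator. -/
theorem essentialClass_bijective (hP : QuasiIso (augmentation a q)) (hq : IsPrimitiveRoot q a)
    (ha : 3 ≤ a) (hn : Even n) : Function.Bijective (essentialClass hP hq ha hn) := by
  have hq0 : q ≠ 0 := hq.ne_zero (by omega)
  have hE : ∀ i, etaExp a i ≠ 0 := fun i => by unfold etaExp; split_ifs <;> omega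
  have hc : ∀ w (i : Fin (n + 1)), coef a q (essential a q w i) 0 0 = w (Sum.inl i) ∧
      coef a q (essential a q w i) (etaExp a i) (etaExp a i) = w (Sum.inr i) := fun w i => by
    rw [coef_essential hq0 ha, coef_essential hq0 ha]
    simp [hE, (hE _).symm]
  constructor
  · rw [← LinearMap.ker_eq_bot, LinearMap.ker_eq_bot']
    intro w hw
    have h := (hhClass_eq_zero_iff_coef hP hq ha hn _ (essential_comp_d hq ha hn w)).1 hw
    funext s
    rcases s with i | i
    · have := (h i (by omega)).1
      rwa [cochain_gen, (hc w i).1] at this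
    · have := (h i (by omega)).2
      rwa [cochain_gen, (hc w i).2] at this
  · intro z
    obtain ⟨p, hp, rfl⟩ := exists_hhClass_eq hP z
    let w : Fin (n + 1) ⊕ Fin (n + 1) → k := Sum.elim (fun i => coef a q (p (gen a q n i)) 0 0)
      fun i => coef a q (p (gen a q n i)) (etaExp a i) (etaExp a i)
    have hw := essential_comp_d hq ha hn w
    have hd : (p - cochain a q n (essential a q w)) ∘ₗ d a q n = 0 := by
      rw [LinearMap.sub_comp, hp, hw, sub_zero]
    have h0 : hhClass hP _ hd = 0 := (hhClass_eq_zero_iff_coef hP hq ha hn _ hd).2 fun i hi => by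
      have h1 := hc w ⟨i, by omega⟩
      rw [LinearMap.sub_apply, cochain_gen_nat _ hi, map_sub]
      simp only [Pi.sub_apply]
      rw [h1.1]
      exact ⟨sub_self _, sub_eq_zero.2 h1.2.symm⟩
    have h1 := hhClass_add hP hd hw
    exact ⟨w, ((h1.trans (by rw [h0, zero_add]; rfl)).symm).trans (hhClass_congr hP _ (sub_add_cancel _ _))⟩

end Basis

/-- The index set of the classes `η_j^±` is the set of all generators. -/
def etaEquiv (t : ℕ) : EtaIndex t ≃ Fin (2 * t + 1) :=
  ((Equiv.refl _).sumCongr (Equiv.subtypeEquivRight fun _ => Nat.not_even_iff_odd.symm)).trans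
    (Equiv.sumCompl fun j : Fin (2 * t + 1) => Even (j : ℕ))

theorem zeta_eq (t : ℕ) (j : Fin (2 * t + 1)) :
    zeta a q t j = cochain a q (2 * t) (essential a q (Pi.single (Sum.inl j) 1)) := by
  rw [zeta]
  congr 1
  funext i
  simp [essential, Pi.single_apply, ite_smul]

theorem eta_eq (t : ℕ) (s : EtaIndex t) :
    eta a q t s = cochain a q (2 * t) (essential a q (Pi.single (Sum.inr (etaEquiv t s)) 1)) := by
  rcases s with ⟨j, hj⟩ | ⟨j, hj⟩
  · change cochain a q (2 * t) _ = cochain a q (2 * t) _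
    congr 1
    funext i
    change _ = essential a q (Pi.single (Sum.inr j) 1) i
    by_cases h : i = j
    · subst h
      simp [essential, etaVal, hj]
    · simp [essential, h]
  · change cochain a q (2 * t) _ = cochain a q (2 * t) _
    congr 1
    funext i
    change _ = essential a q (Pi.single (Sum.inr j) 1) i
    by_cases h : i = j
    · subst h
      simp [essential, etaVal, Nat.not_even_iff_odd.2 hj]
    · simp [essential, h]

theorem card_index (t : ℕ) : Nat.card (Fin (2 * t + 1) ⊕ EtaIndex t) = 4 * t + 2 := by
  rw [Nat.card_congr ((Equiv.refl _).sumCongr (etaEquiv t))]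
  simp
  ring

theorem eta_gen_mem_AFil (ha : 3 ≤ a) (t : ℕ) (s : EtaIndex t) {i : ℕ} (hi : i ≤ 2 * t) :
    eta a q t s (gen a q (2 * t) i)
      ∈ AFil a q (wt a (2 * t - i) + wt a i + (a - a * t)) := by
  rw [eta_eq, cochain_gen_nat _ hi, essential]
  exact Submodule.add_mem _ (by simp) (Submodule.smul_mem _ _ (etaVal_mem_AFil ha hi))

end QCI

end

theorem lemma5p2 {k : Type u} [Field k] (a : ℕ) (ha : 3 ≤ a) (q : k) (hq : IsPrimitiveRoot q a)
    (t : ℕ) :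
    ∃ (hP : QuasiIso (QCI.augmentation a q))
      (hζ : ∀ j : Fin (2 * t + 1), QCI.zeta a q t j ∘ₗ QCI.d a q (2 * t) = 0)
      (hη : ∀ s : QCI.EtaIndex t, QCI.eta a q t s ∘ₗ QCI.d a q (2 * t) = 0),
      (∃ b : Module.Basis (Fin (2 * t + 1) ⊕ QCI.EtaIndex t) k (QCI.HH a q (2 * t)),
        (∀ j, b (Sum.inl j) = QCI.hhClass hP (QCI.zeta a q t j) (hζ j)) ∧
        (∀ s, b (Sum.inr s) = QCI.hhClass hP (QCI.eta a q t s) (hη s))) ∧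
      Nat.card (Fin (2 * t + 1) ⊕ QCI.EtaIndex t) = 4 * t + 2 ∧
      (∀ s, QCI.HHNilpotent (QCI.hhClass hP (QCI.eta a q t s) (hη s))) := by
  have ht : Even (2 * t) := even_two_mul t
  have hP := QCI.quasiIso_augmentation (a := a) (q := q) (by omega) hq.pow_eq_one
  have hζ : ∀ j, QCI.zeta a q t j ∘ₗ QCI.d a q (2 * t) = 0 := fun j => by
    rw [QCI.zeta_eq]
    exact QCI.essential_comp_d hq ha ht _
  have hη : ∀ s, QCI.eta a q t s ∘ₗ QCI.d a q (2 * t) = 0 := fun s => by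
    rw [QCI.eta_eq]
    exact QCI.essential_comp_d hq ha ht _
  let e := LinearEquiv.ofBijective _ (QCI.essentialClass_bijective hP hq ha ht)
  -- Even and odd j together exhaust the generators, so the standard basis of coefficient families
  -- is reindexed by the ζ and η classes.
  let σ := (Equiv.refl (Fin (2 * t + 1))).sumCongr (QCI.etaEquiv t)
  have hb : ∀ s, ((Pi.basisFun k _).map e).reindex σ.symm s
      = QCI.hhClass hP _ (QCI.essential_comp_d hq ha ht (Pi.single (σ s) 1)) := fun s => by
    rw [Module.Basis.reindex_apply, Module.Basis.map_apply, Pi.basisFun_apply]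
    rfl
  refine ⟨hP, hζ, hη, ⟨((Pi.basisFun k _).map e).reindex σ.symm, fun j => ?_, fun s => ?_⟩,
    QCI.card_index t, fun s => ?_⟩
  · exact (hb _).trans (QCI.hhClass_congr hP _ (QCI.zeta_eq t j).symm)
  · exact (hb _).trans (QCI.hhClass_congr hP _ (QCI.eta_eq t s).symm)
  · exact QCI.hhNilpotent_of_comp_self_eq_zero (QCI.hhClass_comp_self_eq_zero hP hq ha (hη s)
      fun i hi => QCI.eta_gen_mem_AFil ha t s hi)
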